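/- Let $k$ be an algebraically closed field of characteristic $0$, complete with respect to a non-trivial non-archimedean absolute value $|\cdot|$. A strict open disc is an open disc $D$ in the Berkovich affine line over $k$ of radius in $|k^*|$. For $x\in D(k)$ and $s\in(0,1]$, let $D(x,s^-)\subseteq D$ be the open subdisc centred at $x$ of radius $s$, measured in a coordinate identifying $D$ with the open unit disc (so $D(x,1^-)=D$). A differential equation of rank $n$ on $D$ is a pair $(\mathscr F,\nabla)$, where $\mathscr F$ is a locally free $\mathscr O_D$-module of rank $n$ and $\nabla:\mathscr F\to\Omega^1_D\otimes\mathscr F$ is a connection; $H^0(U,(\mathscr F,\nabla))$ denotes the $k$-vector space of its horizontal sections over an open set $U$. Its radii of convergence at $x\in D(k)$ are, for $i=1,\dots,n$, $$\mathcal R_i(x,(\mathscr F,\nabla))=\sup\{s\in(0,1)\mid \dim_k H^0(D(x,s^-),(\mathscr F,\nabla))\ge n-i+1\}.$$ **Proposition.** Let $\varphi:D_2\to D_1$ be a finite étale morphism of degree $d$ between strict open discs, let $(\mathscr E,\nabla)$ be a differential equation of rank $r$ on $D_2$, and let $(\mathscr F,\nabla)=\varphi_*(\mathscr E,\nabla)$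 be its pushforward, a differential equation of rank $rd$ on $D_1$. Let $x\in D_1(k)$ and, for $s\in(0,1]$, put $$\Phi_x(s)=\dim_k H^0\big(\varphi^{-1}(D(x,s^-)),(\mathscr E,\nabla)\big).$$ Then $\Phi_x(s)$ is finite for every $s\in(0,1]$, and $$\#\{i\in\{1,\dots,rd\}\mid \mathcal R_i(x,(\mathscr F,\nabla))=1\}=\Phi_x(1).$$ For each $R\in(0,1)$, the limit $\Phi_x(R^+)=\lim_{s\to R,\ s>R}\Phi_x(s)$ exists and $$\#\{i\in\{1,\dots,rd\}\mid \mathcal R_i(x,(\mathscr F,\nabla))=R\}=\Phi_x(R)-\Phi_x(R^+).$$ In particular, the set of those radii of convergence of $(\mathscr F,\nabla)$ at $x$ that are smaller than $1$ is exactly the set of break-points of $\Phi_x$, i.e. of the points $R\in(0,1)$ at which $\Phi_x$ is discontinuous. -/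

import Mathlib

open Polynomial TopologicalSpace Filter Topology

universe u v

namespace Berk

noncomputable section

section Line

variable (k : Type u) [NontriviallyNormedField k]

/-- The Berkovich affine line over `k`: the multiplicative seminorms on `k[T]` that extend the
norm of `k`. -/
def Line : Type u := {x : MulRingSeminorm k[X] // ∀ c : k, x (C c) = ‖c‖}

/-- The topology of the affine line is the coarsest one for which all the maps `x ↦ |P|ₓ`,
`P ∈ k[T]`, are continuous. -/
instance : TopologicalSpace (Line k) :=
  TopologicalSpace.induced (fun x => fun P : k[X] => x.1 P) inferInstance

variable {k}

/-- The point of the affine line given by `a ∈ k`: the seminorm `P ↦ |P(a)|`. -/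
def pt (a : k) : Line k :=
  ⟨{ toFun := fun P => ‖P.eval a‖
     map_zero' := by simp
     add_le' := fun P Q => by simpa using norm_add_le _ _
     neg' := fun P => by simp
     map_one' := by simp
     map_mul' := fun P Q => by simp }, fun c => by
      change ‖(C c).eval a‖ = ‖c‖
      simp⟩

theorem pt_apply (a : k) (P : k[X]) : (pt a).1 P = ‖P.eval a‖ := rfl

theorem continuous_eval (P : k[X]) : Continuous fun x : Line k => x.1 P :=
  (continuous_apply P).comp continuous_induced_dom

end Line

/-- A strict open disc `D(c, r⁻)` of the affine line, `r ∈ |k^*|`. -/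
structure Disc (k : Type u) [NontriviallyNormedField k] where
  /-- the centre `c` -/
  center : k
  /-- the radius `r` -/
  radius : ℝ
  strict : ∃ ρ : k, ρ ≠ 0 ∧ ‖ρ‖ = radius

section Disc

variable {k : Type u} [NontriviallyNormedField k]

theorem Disc.radius_pos (D : Disc k) : 0 < D.radius := by
  obtain ⟨ρ, h0, h⟩ := D.strict
  rw [← h]; exact norm_pos_iff.2 h0

/-- The Berkovich points of a disc, with the topology induced from the affine line. -/
def Disc.Pt (D : Disc k) : Type u := {x : Line k // x.1 (X - C D.center) < D.radius}

instance (D : Disc k) : TopologicalSpace D.Pt := instTopologicalSpaceSubtype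

variable {D : Disc k}

theorem Disc.continuous_eval (P : k[X]) : Continuous fun x : D.Pt => x.1.1 P :=
  (Berk.continuous_eval P).comp continuous_subtype_val

/-- The set `U(k)` of rational points of an open subset `U` of a disc. -/
def rat (U : Opens D.Pt) : Set k := {a | ∃ y ∈ U, y.1 = pt a}

theorem rat_mono {U V : Opens D.Pt} (h : V ≤ U) : rat V ⊆ rat U :=
  fun _ ⟨y, hy, e⟩ => ⟨y, h hy, e⟩

/-- The open subdisc `D(x, s⁻)` of `D`, where `x ∈ k` and the radius `s` is measured with respect
to a normalizing coordinate of `D`, so that `D(x, 1⁻) = D` for `x ∈ D(k)`. -/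
def Disc.sub (D : Disc k) (x : k) (s : ℝ) : Opens D.Pt :=
  ⟨{y | y.1.1 (X - C x) < s * D.radius},
    isOpen_lt (Disc.continuous_eval _) continuous_const⟩

/-- Analytic functions on an open subset `U` of a disc: the functions which are, locally on the
Berkovich space `U`, uniform limits of rational functions without poles. An analytic function is
recorded through its values at the rational points of `U` (at these points the residue field is
`k`; they are dense in `U`, so that the other values are determined by these). -/
def IsAnalytic (U : Opens D.Pt) (f : rat U → k) : Prop :=
  ∀ x ∈ U, ∃ V : Opens D.Pt, x ∈ V ∧ V ≤ U ∧ ∀ ε : ℝ, 0 < ε → ∃ g h : k[X],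
    (∀ y ∈ V, y.1.1 h ≠ 0) ∧
      ∀ a : rat U, a.1 ∈ rat V → ‖f a - g.eval a.1 / h.eval a.1‖ < ε

theorem eval_ne_zero {V : Opens D.Pt} {h : k[X]} (hh : ∀ y ∈ V, y.1.1 h ≠ 0) {a : k}
    (ha : a ∈ rat V) : h.eval a ≠ 0 := by
  obtain ⟨y, hy, e⟩ := ha
  have := hh y hy
  rw [e, pt_apply] at this
  exact norm_ne_zero_iff.1 this

theorem bdd_rational {V : Opens D.Pt} {g h : k[X]} (hh : ∀ y ∈ V, y.1.1 h ≠ 0) {x : D.Pt}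
    (hx : x ∈ V) : ∃ W : Opens D.Pt, x ∈ W ∧ W ≤ V ∧ ∃ M : ℝ, 0 < M ∧
      ∀ a ∈ rat W, ‖g.eval a / h.eval a‖ ≤ M := by
  have hpos : 0 < x.1.1 h := lt_of_le_of_ne (apply_nonneg _ _) (hh x hx).symm
  have hg0 : 0 ≤ x.1.1 g := apply_nonneg _ _
  refine ⟨V ⊓ ⟨{y | y.1.1 g < x.1.1 g + 1} ∩ {y | x.1.1 h / 2 < y.1.1 h},
    (isOpen_lt (Disc.continuous_eval _) continuous_const).inter
      (isOpen_lt continuous_const (Disc.continuous_eval _))⟩, ⟨hx, ?_, ?_⟩, inf_le_left,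
      (x.1.1 g + 1) / (x.1.1 h / 2), by positivity, ?_⟩
  · simp
  · simpa using hpos
  · rintro a ⟨y, ⟨hyV, hy1, hy2⟩, e⟩
    simp only [Set.mem_ofPred_eq, e, pt_apply] at hy1 hy2
    rw [norm_div]
    gcongr

theorem IsAnalytic.const (U : Opens D.Pt) (c : k) : IsAnalytic U fun _ => c := fun x hx =>
  ⟨U, hx, le_rfl, fun ε hε => ⟨C c, 1, fun y _ => by simp, fun a _ => by simpa using hε⟩⟩

theorem IsAnalytic.add {U : Opens D.Pt} {f₁ f₂ : rat U → k} (h₁ : IsAnalytic U f₁)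
    (h₂ : IsAnalytic U f₂) : IsAnalytic U (f₁ + f₂) := by
  intro x hx
  obtain ⟨V, hV, hVU, HV⟩ := h₁ x hx
  obtain ⟨W, hW, hWU, HW⟩ := h₂ x hx
  refine ⟨V ⊓ W, ⟨hV, hW⟩, inf_le_left.trans hVU, fun ε hε => ?_⟩
  obtain ⟨g, h, hh, H⟩ := HV (ε / 2) (by positivity)
  obtain ⟨g', h', hh', H'⟩ := HW (ε / 2) (by positivity)
  refine ⟨g * h' + g' * h, h * h', fun y hy => by
    rw [map_mul]; exact mul_ne_zero (hh y hy.1) (hh' y hy.2), fun a ha => ?_⟩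
  have e1 := eval_ne_zero hh (rat_mono inf_le_left ha)
  have e2 := eval_ne_zero hh' (rat_mono inf_le_right ha)
  have : (f₁ + f₂) a - (g * h' + g' * h).eval a.1 / (h * h').eval a.1
      = (f₁ a - g.eval a.1 / h.eval a.1) + (f₂ a - g'.eval a.1 / h'.eval a.1) := by
    simp only [Pi.add_apply, eval_add, eval_mul]
    field_simp
    ring
  rw [this]
  refine (norm_add_le _ _).trans_lt ?_
  linarith [H a (rat_mono inf_le_left ha), H' a (rat_mono inf_le_right ha)]

theorem IsAnalytic.mul {U : Opens D.Pt} {f₁ f₂ : rat U → k} (h₁ : IsAnalytic U f₁)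
    (h₂ : IsAnalytic U f₂) : IsAnalytic U (f₁ * f₂) := by
  intro x hx
  obtain ⟨V, hV, hVU, HV⟩ := h₁ x hx
  obtain ⟨W, hW, hWU, HW⟩ := h₂ x hx
  obtain ⟨g₀, h₀, hh₀, H₀⟩ := HV 1 one_pos
  obtain ⟨g₁, h₁, hh₁, H₁⟩ := HW 1 one_pos
  obtain ⟨A, hxA, hAV, M, hM, HM⟩ := bdd_rational (g := g₀) hh₀ hV
  obtain ⟨B, hxB, hBW, N, hN, HN⟩ := bdd_rational (g := g₁) hh₁ hW
  refine ⟨A ⊓ B, ⟨hxA, hxB⟩, (inf_le_left.trans hAV).trans hVU, fun ε hε => ?_⟩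
  obtain ⟨g, h, hh, H⟩ := HV (min 1 (ε / (2 * (N + 2)))) (by positivity)
  obtain ⟨g', h', hh', H'⟩ := HW (ε / (2 * (M + 2))) (by positivity)
  refine ⟨g * g', h * h', fun y hy => by
    rw [map_mul]; exact mul_ne_zero (hh y (hAV hy.1)) (hh' y (hBW hy.2)), fun a ha => ?_⟩
  have aA := rat_mono inf_le_left ha
  have aB := rat_mono inf_le_right ha
  have b1 := H₁ a (rat_mono hBW aB)
  have b0 := H₀ a (rat_mono hAV aA)
  have c0 := HM a aA
  have c1 := HN a aB
  have d := H a (rat_mono hAV aA)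
  have d' := H' a (rat_mono hBW aB)
  have f1 : ‖f₁ a‖ ≤ M + 1 := by
    have := norm_add_le (f₁ a - eval a.1 g₀ / eval a.1 h₀) (eval a.1 g₀ / eval a.1 h₀)
    rw [sub_add_cancel] at this; linarith
  have f2 : ‖f₂ a‖ ≤ N + 1 := by
    have := norm_add_le (f₂ a - eval a.1 g₁ / eval a.1 h₁) (eval a.1 g₁ / eval a.1 h₁)
    rw [sub_add_cancel] at this; linarith
  have q1 : ‖eval a.1 g / eval a.1 h‖ ≤ M + 2 := by
    have := norm_sub_le (f₁ a) (f₁ a - eval a.1 g / eval a.1 h)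
    rw [sub_sub_cancel] at this
    linarith [min_le_left 1 (ε / (2 * (N + 2)))]
  have : (f₁ * f₂) a - (g * g').eval a.1 / (h * h').eval a.1
      = (f₁ a - g.eval a.1 / h.eval a.1) * f₂ a +
        g.eval a.1 / h.eval a.1 * (f₂ a - g'.eval a.1 / h'.eval a.1) := by
    simp only [Pi.mul_apply, eval_mul, mul_div_mul_comm]
    ring
  rw [this]
  refine (norm_add_le _ _).trans_lt ?_
  rw [norm_mul, norm_mul]
  have t1 : ‖f₁ a - g.eval a.1 / h.eval a.1‖ * ‖f₂ a‖ ≤ ε / (2 * (N + 2)) * (N + 1) := by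
    gcongr
    exact d.le.trans (min_le_right _ _)
  have t2 : ‖g.eval a.1 / h.eval a.1‖ * ‖f₂ a - g'.eval a.1 / h'.eval a.1‖ ≤
      (M + 2) * (ε / (2 * (M + 2))) := by gcongr
  have t3 : ε / (2 * (N + 2)) * (N + 1) < ε / 2 := by
    rw [div_mul_eq_mul_div, div_lt_div_iff₀ (by positivity) (by positivity)]
    nlinarith
  have t4 : (M + 2) * (ε / (2 * (M + 2))) = ε / 2 := by field_simp
  linarith

theorem IsAnalytic.restrict {U V : Opens D.Pt} (h : V ≤ U) {f : rat U → k}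
    (hf : IsAnalytic U f) : IsAnalytic V fun a => f ⟨a.1, rat_mono h a.2⟩ := by
  intro x hx
  obtain ⟨W, hW, hWU, H⟩ := hf x (h hx)
  refine ⟨W ⊓ V, ⟨hW, hx⟩, inf_le_right, fun ε hε => ?_⟩
  obtain ⟨g, q, hq, Hq⟩ := H ε hε
  exact ⟨g, q, fun y hy => hq y hy.1, fun a ha => Hq _ (rat_mono inf_le_left ha)⟩

theorem IsAnalytic.of_local {U : Opens D.Pt} {f : rat U → k}
    (H : ∀ x ∈ U, ∃ (V : Opens D.Pt) (h : V ≤ U), x ∈ V ∧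
      IsAnalytic V fun a => f ⟨a.1, rat_mono h a.2⟩) : IsAnalytic U f := by
  intro x hx
  obtain ⟨V, h, hV, HV⟩ := H x hx
  obtain ⟨W, hW, hWV, HW⟩ := HV x hV
  refine ⟨W, hW, hWV.trans h, fun ε hε => ?_⟩
  obtain ⟨g, q, hq, Hq⟩ := HW ε hε
  exact ⟨g, q, hq, fun a ha => Hq ⟨a.1, rat_mono hWV ha⟩ ha⟩

/-- The structure sheaf of a disc: the `k`-algebra `𝒪(U)` of analytic functions on `U`. -/
def O (U : Opens D.Pt) : Subalgebra k (rat U → k) where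
  carrier := {f | IsAnalytic U f}
  mul_mem' := IsAnalytic.mul
  add_mem' := IsAnalytic.add
  algebraMap_mem' := IsAnalytic.const U

/-- Restriction of analytic functions. -/
def resO {U V : Opens D.Pt} (h : V ≤ U) : O U →ₐ[k] O V where
  toFun f := ⟨fun a => f.1 ⟨a.1, rat_mono h a.2⟩, f.2.restrict h⟩
  map_one' := rfl
  map_mul' _ _ := rfl
  map_zero' := rfl
  map_add' _ _ := rfl
  commutes' _ := rfl

/-- The coordinate function `T` on `U`. -/
def coord (U : Opens D.Pt) : O U :=
  ⟨fun a => a.1, fun x hx => ⟨U, hx, le_rfl, fun ε hε =>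
    ⟨X, 1, fun y _ => by simp, fun a _ => by simpa using hε⟩⟩⟩

end Disc

section Cauchy

variable {k : Type u} [NontriviallyNormedField k]

theorem exists_norm_between [IsAlgClosed k] {l u : ℝ} (hl : 0 < l) (hu : l < u) :
    ∃ t : k, l < ‖t‖ ∧ ‖t‖ < u := by
  obtain ⟨w, hw⟩ := NormedField.exists_one_lt_norm k
  have hul : 1 < u / l := (one_lt_div hl).2 hu
  obtain ⟨n, hn⟩ := pow_unbounded_of_one_lt ‖w‖ hul
  have hn0 : n ≠ 0 := by rintro rfl; simp at hn; linarith
  obtain ⟨z, hz⟩ := IsAlgClosed.exists_pow_nat_eq w (Nat.pos_of_ne_zero hn0)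
  have hzn : ‖z‖ ^ n = ‖w‖ := by rw [← norm_pow, hz]
  have hz1 : 1 < ‖z‖ := by
    by_contra h
    have := pow_le_one₀ (n := n) (norm_nonneg z) (not_lt.1 h)
    linarith
  have hzu : ‖z‖ < u / l := by
    refine lt_of_pow_lt_pow_left₀ n (by positivity) ?_
    rwa [hzn]
  obtain ⟨m, hm1, hm2⟩ := exists_mem_Ico_zpow hl hz1
  refine ⟨z ^ (m + 1), by rwa [norm_zpow], ?_⟩
  rw [norm_zpow, zpow_add_one₀ (by positivity)]
  calc ‖z‖ ^ m * ‖z‖ ≤ l * ‖z‖ := by gcongr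
    _ < l * (u / l) := by gcongr
    _ = u := by field_simp

theorem poly_eq [IsAlgClosed k] (P : k[X]) : P = C P.leadingCoeff * (P.roots.map fun α => X - C α).prod :=
  (IsAlgClosed.splits P).eq_prod_roots

variable [IsUltrametricDist k]

theorem poly_max_aux (a : k) {l ε : ℝ} (hl : l < ε) (s : Multiset k) :
    ∃ l' : ℝ, l ≤ l' ∧ l' < ε ∧ ∀ c : k, l' < ‖c - a‖ → ‖c - a‖ < ε → ∀ b : k, ‖b - a‖ ≤ l →
      ‖((s.map fun α => X - C α).prod).eval b‖ ≤ ‖((s.map fun α => X - C α).prod).eval c‖ := by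
  induction s using Multiset.induction_on with
  | empty => exact ⟨l, le_rfl, hl, fun c _ _ b _ => by simp⟩
  | cons α s ih =>
    obtain ⟨l', h1, h2, H⟩ := ih
    refine ⟨if ‖α - a‖ < ε then max l' ‖α - a‖ else l', ?_, ?_, fun c hc hc' b hb => ?_⟩
    · split_ifs
      · exact h1.trans (le_max_left _ _)
      · exact h1
    · split_ifs with h
      · exact max_lt h2 h
      · exact h2
    · have hcl : l' < ‖c - a‖ := by
        refine lt_of_le_of_lt ?_ hc
        split_ifs
        · exact le_max_left _ _
        · exact le_rfl
      simp only [Multiset.map_cons, Multiset.prod_cons, eval_mul, norm_mul]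
      refine mul_le_mul ?_ (H c hcl hc' b hb) (norm_nonneg _) (norm_nonneg _)
      simp only [eval_sub, eval_X, eval_C]
      have hne : ‖c - a‖ ≠ ‖α - a‖ := by
        intro e
        split_ifs at hc with h
        · exact absurd (le_max_right l' ‖α - a‖) (not_le.2 (e ▸ hc))
        · exact h (e ▸ hc')
      have e1 : ‖c - α‖ = max ‖c - a‖ ‖α - a‖ := by
        have := IsUltrametricDist.norm_add_eq_max_of_norm_ne_norm (x := c - a) (y := -(α - a))
          (by rwa [norm_neg])
        rw [norm_neg] at this
        rw [← this]; congr 1; ring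
      have e2 : ‖b - α‖ ≤ max ‖b - a‖ ‖α - a‖ := by
        have := IsUltrametricDist.norm_add_le_max (b - a) (-(α - a))
        rw [norm_neg] at this
        refine le_trans (le_of_eq ?_) this
        congr 1; ring
      rw [e1]
      exact e2.trans (max_le_max (hb.trans (h1.trans hcl.le)) le_rfl)

variable [IsAlgClosed k]

theorem poly_max (P : k[X]) (a : k) {l ε : ℝ} (h0 : 0 < l) (hl : l < ε) :
    ∃ c : k, l < ‖c - a‖ ∧ ‖c - a‖ < ε ∧ ∀ b : k, ‖b - a‖ ≤ l → ‖P.eval b‖ ≤ ‖P.eval c‖ := by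
  obtain ⟨l', h1, h2, H⟩ := poly_max_aux a hl P.roots
  obtain ⟨t, ht1, ht2⟩ := exists_norm_between (k := k) (h0.trans_le h1) h2
  refine ⟨a + t, by simpa using h1.trans_lt ht1, by simpa using ht2, fun b hb => ?_⟩
  rw [poly_eq P, eval_mul, eval_mul, norm_mul, norm_mul, eval_C, eval_C]
  exact mul_le_mul_of_nonneg_left (H _ (by simpa using ht1) (by simpa using ht2) b hb)
    (norm_nonneg _)

theorem norm_eval_eq (P : k[X]) (a : k) {ε : ℝ} (H : ∀ b, ‖b - a‖ < ε → P.eval b ≠ 0) {b : k}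
    (hb : ‖b - a‖ < ε) : ‖P.eval b‖ = ‖P.eval a‖ := by
  have key : ∀ s : Multiset k, (∀ α ∈ s, ε ≤ ‖α - a‖) →
      ‖((s.map fun α => X - C α).prod).eval b‖ = ‖((s.map fun α => X - C α).prod).eval a‖ := by
    intro s
    induction s using Multiset.induction_on with
    | empty => simp
    | cons α s ih =>
      intro hs
      simp only [Multiset.map_cons, Multiset.prod_cons, eval_mul, norm_mul, eval_sub, eval_X,
        eval_C]
      rw [ih fun β hβ => hs β (Multiset.mem_cons_of_mem hβ)]
      congr 1
      have h := hs α (Multiset.mem_cons_self _ _)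
      have := IsUltrametricDist.norm_add_eq_max_of_norm_ne_norm (x := b - a) (y := -(α - a))
        (by rw [norm_neg]; exact (hb.trans_le h).ne)
      rw [norm_neg, max_eq_right (hb.trans_le h).le] at this
      rw [show b - α = b - a + -(α - a) by ring, this, norm_sub_rev]
  rcases eq_or_ne P 0 with rfl | hP
  · simp
  have := key P.roots fun α hα => by
    by_contra h
    exact H α (not_le.1 h) ((mem_roots hP).1 hα)
  rw [poly_eq P, eval_mul, eval_mul, norm_mul, norm_mul, eval_C, eval_C, this]

/-- Schwarz lemma for rational functions without poles on a disc. -/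
theorem rational_lipschitz (g h : k[X]) (a : k) {ε M : ℝ} (hε : 0 < ε)
    (hh : ∀ b, ‖b - a‖ < ε → h.eval b ≠ 0)
    (hM : ∀ b, ‖b - a‖ < ε → ‖g.eval b / h.eval b‖ ≤ M) {b : k} (hb : ‖b - a‖ < ε) :
    ‖g.eval b / h.eval b - g.eval a / h.eval a‖ ≤ 2 * M / ε * ‖b - a‖ := by
  have haa : ‖a - a‖ < ε := by simpa using hε
  set q : k → k := fun b => g.eval b / h.eval b with hq
  set N : k[X] := g - C (q a) * h with hN
  have hNe : ∀ b, ‖b - a‖ < ε → N.eval b = h.eval b * (q b - q a) := by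
    intro b hb
    have := hh b hb
    simp only [hN, hq, eval_sub, eval_mul, eval_C]
    field_simp
  have hdvd : (X - C a) ∣ N := dvd_iff_isRoot.2 (by
    have := hNe a haa
    simpa [IsRoot] using this)
  obtain ⟨N₁, hN₁⟩ := hdvd
  have hbound : ∀ b, ‖b - a‖ < ε → ‖N.eval b‖ ≤ ‖h.eval a‖ * M := by
    intro b hb
    rw [hNe b hb, norm_mul, norm_eval_eq h a hh hb]
    gcongr
    have := IsUltrametricDist.norm_add_le_max (q b) (-(q a))
    rw [norm_neg, ← sub_eq_add_neg] at this
    exact this.trans (max_le (hM b hb) (hM a haa))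
  have hl : max ‖b - a‖ (ε / 2) < ε := max_lt hb (by linarith)
  obtain ⟨c, hc1, hc2, hc⟩ := poly_max N₁ a (lt_of_lt_of_le (by positivity) (le_max_right _ _)) hl
  have hc3 : ε / 2 < ‖c - a‖ := (le_max_right _ _).trans_lt hc1
  have hcN := hbound c hc2
  have hbN := hNe b hb
  rw [hN₁, eval_mul, norm_mul] at hcN
  rw [hN₁, eval_mul] at hbN
  simp only [eval_sub, eval_X, eval_C] at hcN hbN
  have hb1 := hc b (le_max_left _ _)
  have hha : 0 < ‖h.eval a‖ := norm_pos_iff.2 (hh a haa)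
  have e : ‖b - a‖ * ‖N₁.eval b‖ = ‖h.eval a‖ * ‖q b - q a‖ := by
    rw [← norm_mul, hbN, norm_mul, norm_eval_eq h a hh hb]
  have k1 : ε / 2 * ‖N₁.eval b‖ ≤ ‖h.eval a‖ * M :=
    (mul_le_mul hc3.le hb1 (norm_nonneg _) (norm_nonneg _)).trans hcN
  have k2 : ‖N₁.eval b‖ ≤ ‖h.eval a‖ * (2 * M / ε) := by
    have : ‖N₁.eval b‖ = (ε / 2 * ‖N₁.eval b‖) * (2 / ε) := by field_simp
    rw [this]
    calc _ ≤ ‖h.eval a‖ * M * (2 / ε) := by gcongr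
      _ = _ := by ring
  change ‖q b - q a‖ ≤ _
  refine le_of_mul_le_mul_left ?_ hha
  rw [← e]
  calc ‖b - a‖ * ‖N₁.eval b‖ ≤ ‖b - a‖ * (‖h.eval a‖ * (2 * M / ε)) := by gcongr
    _ = _ := by ring

variable [CompleteSpace k]

/-- A uniform limit of rational functions without poles on a disc is differentiable, with a bound
for the derivative. -/
theorem limit_hasDerivAt (f : k → k) (a : k) {ε : ℝ} (hε : 0 < ε)
    (hf : ∀ η : ℝ, 0 < η → ∃ g h : k[X], (∀ b, ‖b - a‖ < ε → h.eval b ≠ 0) ∧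
      ∀ b, ‖b - a‖ < ε → ‖f b - g.eval b / h.eval b‖ < η) :
    ∃ f' : k, HasDerivAt f f' a ∧ ∀ (η : ℝ) (g h : k[X]), 0 < η →
      (∀ b, ‖b - a‖ < ε → h.eval b ≠ 0) →
      (∀ b, ‖b - a‖ < ε → ‖f b - g.eval b / h.eval b‖ < η) →
      ‖f' - (g.derivative.eval a * h.eval a - g.eval a * h.derivative.eval a) / h.eval a ^ 2‖
        ≤ 2 * η / ε := by
  have haa : ‖a - a‖ < ε := by simpa using hε
  have lip : ∀ (η : ℝ) (g h : k[X]), 0 < η → (∀ b, ‖b - a‖ < ε → h.eval b ≠ 0) →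
      (∀ b, ‖b - a‖ < ε → ‖f b - g.eval b / h.eval b‖ < η) → ∀ b, ‖b - a‖ < ε →
      ‖(f b - f a) - (g.eval b / h.eval b - g.eval a / h.eval a)‖ ≤ 2 * η / ε * ‖b - a‖ := by
    intro η g h hη hh H b hb
    refine le_of_forall_pos_le_add fun δ hδ => ?_
    obtain ⟨g', h', hh', H'⟩ := hf (min η δ) (lt_min hη hδ)
    have key := rational_lipschitz (g' * h - g * h') (h' * h) a (M := η) hε
      (fun b hb => by rw [eval_mul]; exact mul_ne_zero (hh' b hb) (hh b hb))
      (fun b hb => by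
        have e1 := hh b hb
        have e2 := hh' b hb
        have : (g' * h - g * h').eval b / (h' * h).eval b
            = (f b - g.eval b / h.eval b) + -(f b - g'.eval b / h'.eval b) := by
          simp only [eval_sub, eval_mul]
          field_simp
          ring
        rw [this]
        refine (IsUltrametricDist.norm_add_le_max _ _).trans (max_le (H b hb).le ?_)
        rw [norm_neg]
        exact (H' b hb).le.trans (min_le_left _ _)) hb
    have e1 := hh b hb
    have e2 := hh' b hb
    have e3 := hh a haa
    have e4 := hh' a haa
    have : (f b - f a) - (g.eval b / h.eval b - g.eval a / h.eval a) =
      ((g' * h - g * h').eval b / (h' * h).eval b - (g' * h - g * h').eval a / (h' * h).eval a)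
      + ((f b - g'.eval b / h'.eval b) + -(f a - g'.eval a / h'.eval a)) := by
      simp only [eval_sub, eval_mul]
      field_simp
      ring
    rw [this]
    refine (norm_add_le _ _).trans (add_le_add key ?_)
    refine (IsUltrametricDist.norm_add_le_max _ _).trans (max_le ?_ ?_)
    · exact (H' b hb).le.trans (min_le_right _ _)
    · rw [norm_neg]; exact (H' a haa).le.trans (min_le_right _ _)
  have qd : ∀ (g h : k[X]), (∀ b, ‖b - a‖ < ε → h.eval b ≠ 0) →
      Tendsto (slope (fun b => g.eval b / h.eval b) a) (𝓝[≠] a)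
        (𝓝 ((g.derivative.eval a * h.eval a - g.eval a * h.derivative.eval a) / h.eval a ^ 2)) := by
    intro g h hh
    exact hasDerivAt_iff_tendsto_slope.1
      ((g.hasDerivAt a).div (h.hasDerivAt a) (hh a haa))
  have ball : ∀ᶠ b in 𝓝[≠] a, ‖b - a‖ < ε ∧ b ≠ a := by
    refine (eventually_nhdsWithin_of_eventually_nhds ?_).and eventually_mem_nhdsWithin
    filter_upwards [Metric.ball_mem_nhds a hε] with b hb
    rwa [← dist_eq_norm]
  have sl : ∀ (η : ℝ) (g h : k[X]), 0 < η → (∀ b, ‖b - a‖ < ε → h.eval b ≠ 0) →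
      (∀ b, ‖b - a‖ < ε → ‖f b - g.eval b / h.eval b‖ < η) → ∀ᶠ b in 𝓝[≠] a,
      ‖slope f a b - slope (fun b => g.eval b / h.eval b) a b‖ ≤ 2 * η / ε := by
    intro η g h hη hh H
    filter_upwards [ball] with b hb
    have h0 : 0 < ‖b - a‖ := norm_pos_iff.2 (sub_ne_zero.2 hb.2)
    rw [slope_def_field, slope_def_field, ← sub_div, norm_div, div_le_iff₀ h0]
    exact lip η g h hη hh H b hb.1
  have hc : Cauchy (map (slope f a) (𝓝[≠] a)) := by
    rw [Metric.cauchy_iff]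
    refine ⟨inferInstance, fun δ hδ => ?_⟩
    obtain ⟨g, h, hh, H⟩ := hf (ε * δ / 8) (by positivity)
    have h1 := sl _ g h (by positivity) hh H
    have h2 := Metric.tendsto_nhds.1 (qd g h hh) (δ / 4) (by positivity)
    refine ⟨slope f a '' {b | ‖slope f a b - slope (fun b => g.eval b / h.eval b) a b‖
        ≤ 2 * (ε * δ / 8) / ε ∧ dist (slope (fun b => g.eval b / h.eval b) a b)
          ((g.derivative.eval a * h.eval a - g.eval a * h.derivative.eval a) / h.eval a ^ 2)
          < δ / 4}, image_mem_map (h1.and h2), ?_⟩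
    rintro _ ⟨b, ⟨hb1, hb2⟩, rfl⟩ _ ⟨c, ⟨hc1, hc2⟩, rfl⟩
    rw [← dist_eq_norm] at hb1 hc1
    have e : 2 * (ε * δ / 8) / ε = δ / 4 := by field_simp; norm_num
    rw [e] at hb1 hc1
    have t1 := dist_triangle4 (slope f a b) (slope (fun b => g.eval b / h.eval b) a b)
      (slope (fun b => g.eval b / h.eval b) a c) (slope f a c)
    have t2 := dist_triangle_right (slope (fun b => g.eval b / h.eval b) a b)
      (slope (fun b => g.eval b / h.eval b) a c)
      ((g.derivative.eval a * h.eval a - g.eval a * h.derivative.eval a) / h.eval a ^ 2)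
    rw [dist_comm] at hc1
    linarith
  obtain ⟨f', hf'⟩ := CompleteSpace.complete hc
  refine ⟨f', hasDerivAt_iff_tendsto_slope.2 hf', fun η g h hη hh H => ?_⟩
  exact le_of_tendsto ((Tendsto.sub hf' (qd g h hh)).norm) (sl η g h hη hh H)

end Cauchy

section Derivative

variable {k : Type u} [NontriviallyNormedField k] {D : Disc k}

theorem rat_norm {U : Opens D.Pt} {a : k} (ha : a ∈ rat U) : ‖a - D.center‖ < D.radius := by
  obtain ⟨y, -, e⟩ := ha
  have := y.2
  rw [e, pt_apply] at this
  simpa using this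

theorem pt_mem {a : k} (ha : ‖a - D.center‖ < D.radius) :
    (pt a).1 (X - C D.center) < D.radius := by
  rw [pt_apply]; simpa using ha

theorem poly_lip (P : k[X]) (R : ℝ) : ∃ K : ℝ, 0 ≤ K ∧
    (∀ a : k, ‖a‖ ≤ R → ‖P.eval a‖ ≤ K) ∧
    ∀ a b : k, ‖a‖ ≤ R → ‖b‖ ≤ R → ‖P.eval a - P.eval b‖ ≤ K * ‖a - b‖ := by
  induction P using Polynomial.induction_on' with
  | add P Q hP hQ =>
    obtain ⟨K, hK, h1, h2⟩ := hP
    obtain ⟨L, hL, h3, h4⟩ := hQ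
    refine ⟨K + L, by positivity, fun a ha => ?_, fun a b ha hb => ?_⟩
    · rw [eval_add]
      exact (norm_add_le _ _).trans (add_le_add (h1 a ha) (h3 a ha))
    · rw [eval_add, eval_add, add_sub_add_comm, add_mul]
      exact (norm_add_le _ _).trans (add_le_add (h2 a b ha hb) (h4 a b ha hb))
  | monomial n c =>
    induction n with
    | zero => exact ⟨‖c‖, norm_nonneg _, by simp, fun a b _ _ => by simp; positivity⟩
    | succ n ih =>
      obtain ⟨K, hK, h1, h2⟩ := ih
      have e : ∀ a, (monomial (n + 1) c).eval a = (monomial n c).eval a * a := by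
        intro a; simp [pow_succ, mul_assoc]
      refine ⟨max (K * |R|) (K * |R| + K), by positivity, fun a ha => ?_, fun a b ha hb => ?_⟩
      · rw [e, norm_mul]
        refine le_trans ?_ (le_max_left _ _)
        exact mul_le_mul (h1 a ha) (ha.trans (le_abs_self _)) (norm_nonneg _) hK
      · rw [e, e]
        have : (monomial n c).eval a * a - (monomial n c).eval b * b =
          ((monomial n c).eval a - (monomial n c).eval b) * a + (monomial n c).eval b * (a - b) := by
          ring
        rw [this]
        refine (norm_add_le _ _).trans ?_
        rw [norm_mul, norm_mul]
        have s1 : ‖(monomial n c).eval a - (monomial n c).eval b‖ * ‖a‖ ≤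
            (K * ‖a - b‖) * |R| :=
          mul_le_mul (h2 a b ha hb) (ha.trans (le_abs_self _)) (norm_nonneg _) (by positivity)
        have s2 : ‖(monomial n c).eval b‖ * ‖a - b‖ ≤ K * ‖a - b‖ := by
          gcongr; exact h1 b hb
        calc _ ≤ (K * ‖a - b‖) * |R| + K * ‖a - b‖ := add_le_add s1 s2
          _ = (K * |R| + K) * ‖a - b‖ := by ring
          _ ≤ _ := by gcongr; exact le_max_right _ _

/-- Extension by zero to `k` of a function on `U(k)`. -/
def ext0 {U : Opens D.Pt} (f : rat U → k) : k → k := Function.extend Subtype.val f 0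

theorem ext0_apply {U : Opens D.Pt} (f : rat U → k) (a : rat U) : ext0 f a.1 = f a :=
  Subtype.val_injective.extend_apply _ _ _

variable [IsUltrametricDist k]

/-- A Berkovich point of an open set has a neighbourhood whose rational points are the centres
of discs of a fixed radius inside the open set. -/
theorem exists_uniform_ball {V : Opens D.Pt} {x : D.Pt} (hx : x ∈ V) :
    ∃ W : Opens D.Pt, x ∈ W ∧ W ≤ V ∧ ∃ ε : ℝ, 0 < ε ∧
      ∀ a ∈ rat W, ∀ b : k, ‖b - a‖ < ε → b ∈ rat V := by
  let S : Type u := {a : k // ‖a - D.center‖ < D.radius}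
  let p : S → D.Pt := fun a => ⟨pt a.1, pt_mem a.2⟩
  let L : Filter (S × S) := comap (fun q => p q.1) (𝓝 x) ⊓ uniformity S
  have hL : Tendsto (fun q : S × S => p q.2) L (𝓝 x) := by
    have hind : IsInducing fun y : D.Pt => fun P : k[X] => y.1.1 P :=
      (show IsInducing (fun y : Line k => fun P : k[X] => y.1 P) from ⟨rfl⟩).comp
        IsInducing.subtypeVal
    rw [hind.tendsto_nhds_iff, tendsto_pi_nhds]
    intro P
    have h1 : Tendsto (fun q : S × S => ‖P.eval q.1.1‖) L (𝓝 (x.1.1 P)) := by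
      have : Tendsto (fun y : D.Pt => y.1.1 P) (𝓝 x) (𝓝 (x.1.1 P)) :=
        (Disc.continuous_eval P).tendsto x
      exact (this.comp tendsto_comap).mono_left inf_le_left
    obtain ⟨K, hK, -, HK⟩ := poly_lip P (‖D.center‖ + D.radius)
    have hb : ∀ a : S, ‖a.1‖ ≤ ‖D.center‖ + D.radius := fun a => by
      have := norm_add_le D.center (a.1 - D.center)
      rw [add_sub_cancel] at this
      linarith [a.2]
    have h2 : Tendsto (fun q : S × S => ‖P.eval q.2.1‖ - ‖P.eval q.1.1‖) L (𝓝 0) := by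
      have hd : Tendsto (fun q : S × S => K * dist q.1 q.2) L (𝓝 0) := by
        have : Tendsto (fun q : S × S => dist q.1 q.2) L (𝓝 0) :=
          (tendsto_uniformity_iff_dist_tendsto_zero.1 tendsto_id).mono_left inf_le_right
        simpa using this.const_mul K
      refine squeeze_zero_norm (fun q => ?_) hd
      refine (abs_norm_sub_norm_le _ _).trans ?_
      refine (HK _ _ (hb _) (hb _)).trans (le_of_eq ?_)
      rw [← dist_eq_norm, dist_comm]; rfl
    have h3 := h2.add h1
    simp only [sub_add_cancel, zero_add] at h3
    exact h3
  have hV := hL (V.isOpen.mem_nhds hx)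
  rw [mem_map] at hV
  obtain ⟨A, hA, B, hB, hAB⟩ := mem_inf_iff.1 hV
  obtain ⟨A', hA', hAA'⟩ := hA
  obtain ⟨δ, hδ, hB'⟩ := Metric.mem_uniformity_dist.1 hB
  obtain ⟨W, hWA, hWo, hxW⟩ := mem_nhds_iff.1 hA'
  refine ⟨⟨W, hWo⟩ ⊓ V, ⟨hxW, hx⟩, inf_le_right, min δ D.radius,
    lt_min hδ D.radius_pos, fun a ha b hb => ?_⟩
  have haD := rat_norm ha
  obtain ⟨y, hy, e⟩ := ha
  have hbD : ‖b - D.center‖ < D.radius := by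
    have := IsUltrametricDist.norm_add_le_max (b - a) (a - D.center)
    rw [sub_add_sub_cancel] at this
    exact this.trans_lt (max_lt (hb.trans_le (min_le_right _ _)) haD)
  have hmem : ((⟨a, haD⟩, ⟨b, hbD⟩) : S × S) ∈ A ∩ B := by
    refine ⟨hAA' ?_, hB' ?_⟩
    · have : p ⟨a, haD⟩ = y := Subtype.ext e.symm
      change p ⟨a, haD⟩ ∈ A'
      rw [this]; exact hWA hy.1
    · change dist a b < δ
      rw [dist_comm, dist_eq_norm]
      exact hb.trans_le (min_le_left _ _)
  rw [← hAB] at hmem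
  exact ⟨_, hmem, rfl⟩

theorem isOpen_rat (U : Opens D.Pt) : IsOpen (rat U) := by
  rw [Metric.isOpen_iff]
  intro a ha
  obtain ⟨y, hy, e⟩ := id ha
  obtain ⟨W, hW, -, ε, hε, H⟩ := exists_uniform_ball hy
  exact ⟨ε, hε, fun b hb => H a ⟨y, hW, e⟩ b (by rwa [← dist_eq_norm])⟩

theorem ext0_eventuallyEq {U V : Opens D.Pt} (f : rat U → k) (g : rat V → k)
    (h : ∀ (a : k) (hU : a ∈ rat U) (hV : a ∈ rat V), f ⟨a, hU⟩ = g ⟨a, hV⟩)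
    {a : k} (hU : a ∈ rat U) (hV : a ∈ rat V) : ext0 f =ᶠ[𝓝 a] ext0 g := by
  filter_upwards [(isOpen_rat U).mem_nhds hU, (isOpen_rat V).mem_nhds hV] with b hb hb'
  rw [ext0_apply f ⟨b, hb⟩, ext0_apply g ⟨b, hb'⟩, h]

variable [IsAlgClosed k] [CompleteSpace k]

theorem IsAnalytic.deriv_aux {U : Opens D.Pt} {f : rat U → k} (hf : IsAnalytic U f) {x : D.Pt}
    (hx : x ∈ U) : ∃ W : Opens D.Pt, x ∈ W ∧ W ≤ U ∧
      (∀ a ∈ rat W, DifferentiableAt k (ext0 f) a) ∧ ∀ η : ℝ, 0 < η → ∃ g h : k[X],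
      (∀ y ∈ W, y.1.1 h ≠ 0) ∧ ∀ a ∈ rat W, ‖deriv (ext0 f) a - g.eval a / h.eval a‖ < η := by
  obtain ⟨V, hV, hVU, HV⟩ := hf x hx
  obtain ⟨W, hW, hWV, ε, hε, HW⟩ := exists_uniform_ball hV
  have approx : ∀ η : ℝ, 0 < η → ∃ g h : k[X], (∀ y ∈ W, y.1.1 h ≠ 0) ∧ ∀ a ∈ rat W,
      (∀ b, ‖b - a‖ < ε → h.eval b ≠ 0) ∧
      ∀ b, ‖b - a‖ < ε → ‖ext0 f b - g.eval b / h.eval b‖ < η := by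
    intro η hη
    obtain ⟨g, h, hh, H⟩ := HV η hη
    refine ⟨g, h, fun y hy => hh y (hWV hy), fun a ha => ⟨fun b hb =>
      eval_ne_zero hh (HW a ha b hb), fun b hb => ?_⟩⟩
    rw [ext0_apply f ⟨b, rat_mono hVU (HW a ha b hb)⟩]
    exact H ⟨b, rat_mono hVU (HW a ha b hb)⟩ (HW a ha b hb)
  have main : ∀ a ∈ rat W, _ := fun a ha => limit_hasDerivAt (ext0 f) a hε fun η hη => by
    obtain ⟨g, h, -, H⟩ := approx η hη
    exact ⟨g, h, H a ha⟩
  refine ⟨W, hW, hWV.trans hVU, fun a ha => ?_, fun η hη => ?_⟩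
  · obtain ⟨f', h, -⟩ := main a ha
    exact h.differentiableAt
  · obtain ⟨g, h, hh, H⟩ := approx (η * ε / 4) (by positivity)
    refine ⟨derivative g * h - g * derivative h, h ^ 2, fun y hy => by
      rw [map_pow]; exact pow_ne_zero _ (hh y hy), fun a ha => ?_⟩
    obtain ⟨f', h1, h2⟩ := main a ha
    have := h2 _ g h (by positivity) (H a ha).1 (H a ha).2
    rw [h1.deriv, eval_sub, eval_mul, eval_mul, eval_pow]
    refine this.trans_lt ?_
    have e : 2 * (η * ε / 4) / ε = η / 2 := by field_simp; norm_num
    rw [e]; linarith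

theorem O.differentiableAt {U : Opens D.Pt} (f : O U) {a : k} (ha : a ∈ rat U) :
    DifferentiableAt k (ext0 f.1) a := by
  obtain ⟨y, hy, e⟩ := id ha
  obtain ⟨W, hW, -, H, -⟩ := IsAnalytic.deriv_aux f.2 hy
  exact H a ⟨y, hW, e⟩

theorem IsAnalytic.deriv {U : Opens D.Pt} {f : rat U → k} (hf : IsAnalytic U f) :
    IsAnalytic U fun a => _root_.deriv (ext0 f) a.1 := by
  intro x hx
  obtain ⟨W, hW, hWU, -, H⟩ := hf.deriv_aux hx
  refine ⟨W, hW, hWU, fun η hη => ?_⟩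
  obtain ⟨g, h, hh, H⟩ := H η hη
  exact ⟨g, h, hh, fun a ha => H a.1 ha⟩

/-- The derivation `d/dT` of `𝒪(U)`. -/
def ddT (U : Opens D.Pt) : Derivation k (O U) (O U) where
  toFun f := ⟨fun a => deriv (ext0 f.1) a.1, f.2.deriv⟩
  map_add' f g := Subtype.ext <| funext fun a => by
    have : ext0 (f + g).1 = ext0 f.1 + ext0 g.1 := by
      funext b
      by_cases hb : b ∈ rat U
      · exact (ext0_apply (f + g).1 ⟨b, hb⟩).trans
          (congrArg₂ (· + ·) (ext0_apply f.1 ⟨b, hb⟩).symm (ext0_apply g.1 ⟨b, hb⟩).symm)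
      · have hb' : ¬ ∃ a : rat U, a.1 = b := fun ⟨a, e⟩ => hb (e ▸ a.2)
        simp [ext0, Function.extend_apply' _ _ _ hb']
    change deriv (ext0 (f + g).1) a.1 = deriv (ext0 f.1) a.1 + deriv (ext0 g.1) a.1
    rw [this]
    exact deriv_add (O.differentiableAt f a.2) (O.differentiableAt g a.2)
  map_smul' c f := Subtype.ext <| funext fun a => by
    have : ext0 (c • f).1 =ᶠ[𝓝 a.1] c • ext0 f.1 := by
      filter_upwards [(isOpen_rat U).mem_nhds a.2] with b hb
      exact (ext0_apply (c • f).1 ⟨b, hb⟩).trans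
        (congrArg (c • ·) (ext0_apply f.1 ⟨b, hb⟩).symm)
    change deriv (ext0 (c • f).1) a.1 = c • deriv (ext0 f.1) a.1
    rw [this.deriv_eq]
    exact deriv_const_smul _ (O.differentiableAt f a.2)
  map_one_eq_zero' := Subtype.ext <| funext fun a => by
    have : ext0 (1 : O U).1 =ᶠ[𝓝 a.1] fun _ => 1 := by
      filter_upwards [(isOpen_rat U).mem_nhds a.2] with b hb
      exact ext0_apply (1 : O U).1 ⟨b, hb⟩
    change deriv (ext0 (1 : O U).1) a.1 = 0
    rw [this.deriv_eq, deriv_const]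
  leibniz' f g := Subtype.ext <| funext fun a => by
    have : ext0 (f * g).1 =ᶠ[𝓝 a.1] ext0 f.1 * ext0 g.1 := by
      filter_upwards [(isOpen_rat U).mem_nhds a.2] with b hb
      exact (ext0_apply (f * g).1 ⟨b, hb⟩).trans
        (congrArg₂ (· * ·) (ext0_apply f.1 ⟨b, hb⟩).symm (ext0_apply g.1 ⟨b, hb⟩).symm)
    change deriv (ext0 (f * g).1) a.1 =
      f.1 a * deriv (ext0 g.1) a.1 + g.1 a * deriv (ext0 f.1) a.1
    rw [this.deriv_eq, deriv_mul (O.differentiableAt f a.2) (O.differentiableAt g a.2),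
      ext0_apply, ext0_apply]
    ring

theorem ddT_apply {U : Opens D.Pt} (f : O U) (a : rat U) :
    (ddT U f).1 a = deriv (ext0 f.1) a.1 := rfl

theorem resO_ddT {U V : Opens D.Pt} (h : V ≤ U) (f : O U) :
    resO h (ddT U f) = ddT V (resO h f) := Subtype.ext <| funext fun a => by
  change deriv (ext0 f.1) a.1 = deriv (ext0 (resO h f).1) a.1
  exact (ext0_eventuallyEq f.1 (resO h f).1 (fun _ _ _ => rfl) (rat_mono h a.2) a.2).deriv_eq

theorem ddT_coord (U : Opens D.Pt) : ddT U (coord U) = 1 := Subtype.ext <| funext fun a => by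
  have : ext0 (coord U).1 =ᶠ[𝓝 a.1] id := by
    filter_upwards [(isOpen_rat U).mem_nhds a.2] with b hb
    exact ext0_apply (coord U).1 ⟨b, hb⟩
  change deriv (ext0 (coord U).1) a.1 = 1
  rw [this.deriv_eq, deriv_id]

end Derivative

section Sheaves

variable {k : Type u} [NontriviallyNormedField k]

/-- A sheaf of `𝒪`-modules on a disc `D`. -/
structure ModSheaf (D : Disc k) where
  /-- sections over an open set -/
  Sec : Opens D.Pt → Type v
  [grp : ∀ U, AddCommGroup (Sec U)]
  [mod : ∀ U, Module (O U) (Sec U)]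
  /-- restriction of sections -/
  res : ∀ {U V : Opens D.Pt}, V ≤ U → Sec U →+ Sec V
  res_smul : ∀ {U V : Opens D.Pt} (h : V ≤ U) (f : O U) (e : Sec U),
    res h (f • e) = resO h f • res h e
  res_id : ∀ {U : Opens D.Pt} (e : Sec U), res le_rfl e = e
  res_comp : ∀ {U V W : Opens D.Pt} (h : V ≤ U) (h' : W ≤ V) (e : Sec U),
    res h' (res h e) = res (h'.trans h) e
  glue : ∀ {ι : Type u} (U : ι → Opens D.Pt) (W : Opens D.Pt) (hU : ∀ i, U i ≤ W),
    W ≤ ⨆ i, U i → ∀ s : ∀ i, Sec (U i),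
      (∀ i j, res (inf_le_left : U i ⊓ U j ≤ U i) (s i) =
        res (inf_le_right : U i ⊓ U j ≤ U j) (s j)) →
      ∃! e : Sec W, ∀ i, res (hU i) e = s i

attribute [instance] ModSheaf.grp ModSheaf.mod

variable {D : Disc k}

/-- Sections are `k`-vector spaces through `k → 𝒪(U)`. -/
instance (E : ModSheaf.{u, v} D) (U : Opens D.Pt) : Module k (E.Sec U) :=
  Module.compHom _ (algebraMap k (O U))

theorem ModSheaf.smul_def (E : ModSheaf.{u, v} D) {U : Opens D.Pt} (c : k) (e : E.Sec U) :
    c • e = algebraMap k (O U) c • e := rfl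

/-- The sections `e₁, …, eᵣ` over `U` define an isomorphism `𝒪ʳ → E` over `U`. -/
def ModSheaf.IsBasisOn (E : ModSheaf.{u, v} D) {r : ℕ} (U : Opens D.Pt) (e : Fin r → E.Sec U) :
    Prop :=
  ∀ (V : Opens D.Pt) (h : V ≤ U) (m : E.Sec V),
    ∃! c : Fin r → O V, m = ∑ i, c i • E.res h (e i)

/-- `E` is locally free of rank `r`. -/
def ModSheaf.IsLocallyFree (E : ModSheaf.{u, v} D) (r : ℕ) : Prop :=
  ∀ x : D.Pt, ∃ U : Opens D.Pt, x ∈ U ∧ ∃ e : Fin r → E.Sec U, E.IsBasisOn U e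

theorem mem_rat_inf {U V : Opens D.Pt} {a : k} (hU : a ∈ rat U) (hV : a ∈ rat V) :
    a ∈ rat (U ⊓ V) := by
  obtain ⟨y, hy, e⟩ := hU
  obtain ⟨z, hz, e'⟩ := hV
  have : y = z := Subtype.ext (e.trans e'.symm)
  exact ⟨y, ⟨hy, this ▸ hz⟩, e⟩

theorem mem_rat_iSup {ι : Type*} {U : ι → Opens D.Pt} {W : Opens D.Pt} (hW : W ≤ ⨆ i, U i)
    {a : k} (ha : a ∈ rat W) : ∃ i, a ∈ rat (U i) := by
  obtain ⟨y, hy, e⟩ := ha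
  obtain ⟨i, hi⟩ := Opens.mem_iSup.1 (hW hy)
  exact ⟨i, y, hi, e⟩

/-- The structure sheaf as a sheaf of modules. -/
def structureSheaf (D : Disc k) : ModSheaf.{u, u} D where
  Sec U := O U
  res h := (resO h : O _ →+ O _)
  res_smul h f e := map_mul (resO h) f e
  res_id _ := rfl
  res_comp _ _ _ := rfl
  glue {ι} U W hU hW s hs := by
    have hs' : ∀ (i j : ι) (a : k) (hi : a ∈ rat (U i)) (hj : a ∈ rat (U j)),
        (s i).1 ⟨a, hi⟩ = (s j).1 ⟨a, hj⟩ := fun i j a hi hj =>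
      congrFun (congrArg Subtype.val (hs i j)) ⟨a, mem_rat_inf hi hj⟩
    let F : rat W → k := fun a =>
      (s (mem_rat_iSup hW a.2).choose).1 ⟨a.1, (mem_rat_iSup hW a.2).choose_spec⟩
    have hF : ∀ (i : ι) (a : rat (U i)), F ⟨a.1, rat_mono (hU i) a.2⟩ = (s i).1 a :=
      fun i a => hs' _ i a.1 _ a.2
    refine ⟨⟨F, IsAnalytic.of_local fun x hx => ?_⟩, fun i => Subtype.ext (funext (hF i)),
      fun G hG => Subtype.ext (funext fun a => ?_)⟩
    · obtain ⟨i, hi⟩ := Opens.mem_iSup.1 (hW hx)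
      refine ⟨U i, hU i, hi, ?_⟩
      rw [show (fun a : rat (U i) => F ⟨a.1, rat_mono (hU i) a.2⟩) = (s i).1 from funext (hF i)]
      exact (s i).2
    · obtain ⟨i, hi⟩ := mem_rat_iSup hW a.2
      have := congrFun (congrArg Subtype.val (hG i)) ⟨a.1, hi⟩
      exact this.trans (hF i ⟨a.1, hi⟩).symm

theorem ModSheaf.eq_of_res (E : ModSheaf.{u, v} D) {ι : Type u} (U : ι → Opens D.Pt)
    (W : Opens D.Pt) (hU : ∀ i, U i ≤ W) (hW : W ≤ ⨆ i, U i) {e₁ e₂ : E.Sec W}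
    (H : ∀ i, E.res (hU i) e₁ = E.res (hU i) e₂) : e₁ = e₂ :=
  (E.glue U W hU hW (fun i => E.res (hU i) e₁) fun i j => by
    rw [E.res_comp, E.res_comp]).unique (fun _ => rfl) fun i => (H i).symm

theorem ModSheaf.subsingleton (E : ModSheaf.{u, v} D) {W : Opens D.Pt} (hW : W ≤ ⊥) :
    Subsingleton (E.Sec W) :=
  ⟨fun _ _ => E.eq_of_res (ι := PEmpty) (fun i => i.elim) W (fun i => i.elim)
    (hW.trans bot_le) fun i => i.elim⟩

theorem ModSheaf.res_sum (E : ModSheaf.{u, v} D) {r : ℕ} {U V W : Opens D.Pt} (h : V ≤ U)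
    (h' : W ≤ V) (c : Fin r → O V) (e : Fin r → E.Sec U) :
    E.res h' (∑ i, c i • E.res h (e i)) = ∑ i, resO h' (c i) • E.res (h'.trans h) (e i) := by
  rw [map_sum]
  exact Finset.sum_congr rfl fun i _ => by rw [E.res_smul, E.res_comp]

theorem ModSheaf.IsBasisOn.mono {E : ModSheaf.{u, v} D} {r : ℕ} {U W : Opens D.Pt}
    {e : Fin r → E.Sec U} (he : E.IsBasisOn U e) (h : W ≤ U) :
    E.IsBasisOn W fun i => E.res h (e i) := by
  intro V hV m
  obtain ⟨c, hc, hc'⟩ := he V (hV.trans h) m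
  refine ⟨c, ?_, fun c' h' => hc' c' ?_⟩
  · simpa only [E.res_comp] using hc
  · simpa only [E.res_comp] using h'

theorem ModSheaf.IsBasisOn.of_cover {E : ModSheaf.{u, v} D} {r : ℕ} {ι : Type u}
    {U : ι → Opens D.Pt} {W : Opens D.Pt} (hU : ∀ i, U i ≤ W) (hW : W ≤ ⨆ i, U i)
    {e : Fin r → E.Sec W} (H : ∀ i, E.IsBasisOn (U i) fun j => E.res (hU i) (e j)) :
    E.IsBasisOn W e := by
  intro V hV m
  have hVc : V ≤ ⨆ i, V ⊓ U i := by
    rw [← inf_iSup_eq]; exact le_inf le_rfl (hV.trans hW)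
  have H' : ∀ i (A : Opens D.Pt) (hA : A ≤ U i) (m : E.Sec A),
      ∃! c : Fin r → O A, m = ∑ j, c j • E.res (hA.trans (hU i)) (e j) := fun i A hA m => by
    simpa only [E.res_comp] using H i A hA m
  choose c hc hcu using fun i => H' i (V ⊓ U i) inf_le_right (E.res inf_le_left m)
  have hcomp : ∀ i j l, resO (inf_le_left : (V ⊓ U i) ⊓ (V ⊓ U j) ≤ _) (c i l) =
      resO (inf_le_right : (V ⊓ U i) ⊓ (V ⊓ U j) ≤ _) (c j l) := by
    intro i j l
    have h1 := congrArg (E.res (inf_le_left : (V ⊓ U i) ⊓ (V ⊓ U j) ≤ _)) (hc i)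
    have h2 := congrArg (E.res (inf_le_right : (V ⊓ U i) ⊓ (V ⊓ U j) ≤ _)) (hc j)
    rw [E.res_sum, E.res_comp] at h1 h2
    exact congrFun ((H' i _ (inf_le_left.trans inf_le_right) _).unique h1 h2) l
  have hglue : ∀ l, ∃! g : O V, ∀ i, resO (inf_le_left : V ⊓ U i ≤ V) g = c i l := fun l => (structureSheaf D).glue (fun i => V ⊓ U i) V
    (fun i => inf_le_left) hVc (fun i => c i l) (fun i j => hcomp i j l)
  choose C hC hCu using hglue
  refine ⟨C, ?_, fun C' hC' => ?_⟩
  · refine E.eq_of_res (fun i => V ⊓ U i) V (fun i => inf_le_left) hVc fun i => ?_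
    rw [E.res_sum]
    refine (hc i).trans ?_
    exact Finset.sum_congr rfl fun l _ => by
      have : resO inf_le_left (C l) = c i l := hC l i
      rw [this]
  · funext l
    refine hCu l (C' l) fun i => ?_
    have h1 := congrArg (E.res (inf_le_left : V ⊓ U i ≤ V)) hC'
    rw [E.res_sum] at h1
    exact congrFun (hcu i _ h1) l

end Sheaves

section Morphisms

variable {k : Type u} [NontriviallyNormedField k]

/-- A continuous map between the Berkovich spaces of two discs which sends rational points to
rational points. -/
structure PtMap (D₂ D₁ : Disc k) where
  /-- the map on Berkovich points -/
  toFun : D₂.Pt → D₁.Pt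
  continuous_toFun : Continuous toFun
  /-- the map on rational points -/
  onRat : rat (⊤ : Opens D₂.Pt) → rat (⊤ : Opens D₁.Pt)
  onRat_spec : ∀ (y : D₂.Pt) (a : rat (⊤ : Opens D₂.Pt)), y.1 = pt a.1 →
    (toFun y).1 = pt (onRat a).1

variable {D₂ D₁ : Disc k}

/-- The preimage of an open set. -/
def PtMap.pre (φ : PtMap D₂ D₁) (U : Opens D₁.Pt) : Opens D₂.Pt :=
  ⟨φ.toFun ⁻¹' U, U.isOpen.preimage φ.continuous_toFun⟩

theorem PtMap.pre_mono (φ : PtMap D₂ D₁) {U V : Opens D₁.Pt} (h : V ≤ U) : φ.pre V ≤ φ.pre U :=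
  fun _ hx => h hx

theorem PtMap.onRat_mem (φ : PtMap D₂ D₁) {U : Opens D₁.Pt} {a : k} (ha : a ∈ rat (φ.pre U)) :
    (φ.onRat ⟨a, rat_mono le_top ha⟩).1 ∈ rat U := by
  obtain ⟨y, hy, e⟩ := id ha
  exact ⟨φ.toFun y, hy, φ.onRat_spec y ⟨a, rat_mono le_top ha⟩ e⟩

/-- A morphism `D₂ → D₁` of discs: a continuous map of the underlying Berkovich spaces which
sends rational points to rational points and pulls analytic functions back to analytic
functions. -/
structure Mor (D₂ D₁ : Disc k) extends PtMap D₂ D₁ where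
  analytic : ∀ (U : Opens D₁.Pt) (f : O U),
    IsAnalytic (toPtMap.pre U) fun a => f.1 ⟨_, toPtMap.onRat_mem a.2⟩

variable (φ : Mor D₂ D₁)

/-- The pullback of functions `𝒪(U) → 𝒪(φ⁻¹(U))`, `f ↦ f ∘ φ`. -/
def Mor.comap (U : Opens D₁.Pt) : O U →ₐ[k] O (φ.pre U) where
  toFun f := ⟨fun a => f.1 ⟨_, φ.onRat_mem a.2⟩, φ.analytic U f⟩
  map_one' := rfl
  map_mul' _ _ := rfl
  map_zero' := rfl
  map_add' _ _ := rfl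
  commutes' _ := rfl

/-- The direct image `φ_* E` of a sheaf of modules: `(φ_* E)(U) = E(φ⁻¹(U))`. -/
def ModSheaf.push (E : ModSheaf.{u, v} D₂) : ModSheaf.{u, v} D₁ where
  Sec U := E.Sec (φ.pre U)
  grp U := E.grp (φ.pre U)
  mod U := Module.compHom _ (φ.comap U).toRingHom
  res h := E.res (φ.pre_mono h)
  res_smul h f e := E.res_smul (φ.pre_mono h) (φ.comap _ f) e
  res_id e := E.res_id e
  res_comp h h' e := E.res_comp _ _ e
  glue U W hU hW s hs :=
    E.glue (fun i => φ.pre (U i)) (φ.pre W) (fun i => φ.pre_mono (hU i))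
      (fun x hx => by
        obtain ⟨i, hi⟩ := Opens.mem_iSup.1 (hW hx)
        exact Opens.mem_iSup.2 ⟨i, hi⟩) s hs

/-- `φ` is a finite étale morphism of degree `d`: it is closed with finite fibres, `φ_* 𝒪` is
locally free of rank `d`, and, locally on the target, `𝒪(φ⁻¹(V))` is an étale `𝒪(V)`-algebra. -/
structure Mor.IsFiniteEtale (d : ℕ) : Prop where
  closed : IsClosedMap φ.toFun
  finite_fibres : ∀ x, (φ.toFun ⁻¹' {x}).Finite
  locallyFree : (ModSheaf.push φ (structureSheaf D₂)).IsLocallyFree d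
  etale : ∀ x : D₁.Pt, ∃ U : Opens D₁.Pt, x ∈ U ∧ ∀ V ≤ U, (φ.comap V).toRingHom.Etale

end Morphisms

section Jacobian

variable {k : Type u} [NontriviallyNormedField k] [IsUltrametricDist k] [IsAlgClosed k]
  [CompleteSpace k] {D₂ D₁ : Disc k} (φ : Mor D₂ D₁)

/-- The derivative of `φ` with respect to the coordinates: `φ^* dT₁ = (jac φ) dT₂`. -/
def Mor.jac (U : Opens D₁.Pt) : O (φ.pre U) := ddT (φ.pre U) (φ.comap U (coord U))

theorem Mor.chain_rule (U : Opens D₁.Pt) (f : O U) :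
    ddT (φ.pre U) (φ.comap U f) = φ.comap U (ddT U f) * φ.jac U := Subtype.ext <| funext fun a => by
  have h1 : ext0 (φ.comap U f).1 =ᶠ[𝓝 a.1] ext0 f.1 ∘ ext0 (φ.comap U (coord U)).1 := by
    filter_upwards [(isOpen_rat (φ.pre U)).mem_nhds a.2] with b hb
    have e1 := ext0_apply (φ.comap U f).1 ⟨b, hb⟩
    have e2 := ext0_apply (φ.comap U (coord U)).1 ⟨b, hb⟩
    rw [Function.comp_apply]
    simp only at e1 e2
    rw [e1, e2]
    exact (ext0_apply f.1 ⟨_, φ.onRat_mem hb⟩).symm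
  have e3 : ext0 (φ.comap U (coord U)).1 a.1 = (φ.onRat ⟨a.1, rat_mono le_top a.2⟩).1 :=
    ext0_apply (φ.comap U (coord U)).1 a
  have h2 : DifferentiableAt k (ext0 f.1) (ext0 (φ.comap U (coord U)).1 a.1) := by
    rw [e3]; exact O.differentiableAt f (φ.onRat_mem a.2)
  have h3 := O.differentiableAt (φ.comap U (coord U)) a.2
  change deriv (ext0 (φ.comap U f).1) a.1 = deriv (ext0 f.1) _ *
    deriv (ext0 (φ.comap U (coord U)).1) a.1
  rw [h1.deriv_eq, deriv_comp _ h2 h3, e3]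

theorem isUnit_of_etale {k A B : Type*} [CommRing k] [CommRing A] [CommRing B] [Algebra k A]
    [Algebra k B] (f : A →ₐ[k] B) (hf : f.toRingHom.Etale) (d₁ : Derivation k A A)
    (d₂ : Derivation k B B) (j t : B) (ht : d₂ t = 1) (h : ∀ a, d₂ (f a) = f (d₁ a) * j) :
    IsUnit j := by
  let _ : Algebra A B := f.toRingHom.toAlgebra
  have : IsScalarTower k A B := IsScalarTower.of_algebraMap_eq fun c => (f.commutes c).symm
  have : Algebra.Etale A B := hf
  have hb := KaehlerDifferential.isBaseChange_of_formallyEtale k A B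
  let l₁ : Ω[A⁄k] →ₗ[A] B := (Algebra.linearMap A B).comp d₁.liftKaehlerDifferential
  let δ : Ω[B⁄k] →ₗ[B] B := hb.lift l₁
  have hδ : ∀ a, δ (KaehlerDifferential.D k B (f a)) = f (d₁ a) := by
    intro a
    have := hb.lift_eq l₁ (KaehlerDifferential.D k A a)
    rw [KaehlerDifferential.map_D] at this
    refine Eq.trans this ?_
    simp only [l₁, LinearMap.comp_apply, Derivation.liftKaehlerDifferential_comp_D]
    rfl
  have key : d₂.liftKaehlerDifferential = j • δ := by
    have e : (d₂.liftKaehlerDifferential.restrictScalars A).comp (KaehlerDifferential.map k k A B) =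
        ((j • δ).restrictScalars A).comp (KaehlerDifferential.map k k A B) := by
      refine Derivation.liftKaehlerDifferential_unique _ _ (Derivation.ext fun a => ?_)
      change d₂.liftKaehlerDifferential (KaehlerDifferential.map k k A B (KaehlerDifferential.D k A a))
        = j • δ (KaehlerDifferential.map k k A B (KaehlerDifferential.D k A a))
      rw [KaehlerDifferential.map_D, Derivation.liftKaehlerDifferential_comp_D]
      change d₂ (f a) = j • δ (KaehlerDifferential.D k B (f a))
      rw [hδ, h, smul_eq_mul, mul_comm]
    exact hb.algHom_ext _ _ (LinearMap.congr_fun e)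
  have := LinearMap.congr_fun key (KaehlerDifferential.D k B t)
  rw [Derivation.liftKaehlerDifferential_comp_D, ht] at this
  exact IsUnit.of_mul_eq_one _ this.symm

theorem Mor.isUnit_jac {U : Opens D₁.Pt} (h : (φ.comap U).toRingHom.Etale) :
    IsUnit (φ.jac U) :=
  isUnit_of_etale (φ.comap U) h (ddT U) (ddT (φ.pre U)) _ (coord (φ.pre U)) (ddT_coord _)
    (φ.chain_rule U)

theorem Mor.jac_res {U V : Opens D₁.Pt} (h : V ≤ U) :
    resO (φ.pre_mono h) (φ.jac U) = φ.jac V :=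
  resO_ddT (φ.pre_mono h) (φ.comap U (coord U))

variable {φ} {d : ℕ}

theorem Mor.IsFiniteEtale.exists_inv (hφ : φ.IsFiniteEtale d) {U : Opens D₁.Pt} {x : D₂.Pt}
    (hx : x ∈ φ.pre U) : ∃ V : Opens D₁.Pt, ∃ _ : V ≤ U, x ∈ φ.pre V ∧ IsUnit (φ.jac V) := by
  obtain ⟨V, hV, H⟩ := hφ.etale (φ.toFun x)
  exact ⟨V ⊓ U, inf_le_right, ⟨hV, hx⟩, φ.isUnit_jac (H _ inf_le_left)⟩

/-- The inverse of the derivative of a finite étale morphism. -/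
def Mor.IsFiniteEtale.invJac (hφ : φ.IsFiniteEtale d) (U : Opens D₁.Pt) : O (φ.pre U) :=
  ⟨fun a => ((φ.jac U).1 a)⁻¹, IsAnalytic.of_local fun x hx => by
    obtain ⟨V, hVU, hxV, u, hu⟩ := hφ.exists_inv hx
    refine ⟨φ.pre V, φ.pre_mono hVU, hxV, ?_⟩
    refine Eq.mpr (congrArg _ (funext fun a => ?_)) (show IsAnalytic _ (u⁻¹.1).1 from (u⁻¹.1).2)
    have e1 : (φ.jac U).1 ⟨a.1, rat_mono (φ.pre_mono hVU) a.2⟩ = u.1.1 a := by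
      rw [hu, ← φ.jac_res hVU]; rfl
    rw [e1]
    exact inv_eq_of_mul_eq_one_right (congrFun (congrArg Subtype.val u.mul_inv) a)⟩

theorem Mor.IsFiniteEtale.jac_mul_invJac (hφ : φ.IsFiniteEtale d) (U : Opens D₁.Pt) :
    hφ.invJac U * φ.jac U = 1 := Subtype.ext <| funext fun a => by
  obtain ⟨y, hy, e⟩ := id a.2
  obtain ⟨V, hVU, hyV, u, hu⟩ := hφ.exists_inv hy
  have ha : a.1 ∈ rat (φ.pre V) := ⟨y, hyV, e⟩
  have e1 : (φ.jac U).1 a = u.1.1 ⟨a.1, ha⟩ := by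
    rw [hu, ← φ.jac_res hVU]; rfl
  have h1 : u.1.1 ⟨a.1, ha⟩ * (u⁻¹.1).1 ⟨a.1, ha⟩ = 1 :=
    congrFun (congrArg Subtype.val u.mul_inv) ⟨a.1, ha⟩
  change ((φ.jac U).1 a)⁻¹ * (φ.jac U).1 a = 1
  rw [e1]
  exact inv_mul_cancel₀ (left_ne_zero_of_mul_eq_one h1)

theorem Mor.IsFiniteEtale.invJac_res (hφ : φ.IsFiniteEtale d) {U V : Opens D₁.Pt} (h : V ≤ U) :
    resO (φ.pre_mono h) (hφ.invJac U) = hφ.invJac V := Subtype.ext <| funext fun a => by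
  change ((φ.jac U).1 _)⁻¹ = ((φ.jac V).1 a)⁻¹
  rw [← φ.jac_res h]; rfl

end Jacobian

section Push

variable {k : Type u} [NontriviallyNormedField k] {D₂ D₁ : Disc k} {φ : Mor D₂ D₁} {r d : ℕ}

instance (D : Disc k) : T2Space D.Pt := by
  have hind : Function.Injective fun y : D.Pt => fun P : k[X] => y.1.1 P := by
    intro x y h
    refine Subtype.ext (Subtype.ext (MulRingSeminorm.ext fun P => congrFun h P))
  refine T2Space.of_injective_continuous hind ?_
  exact continuous_pi fun P => Disc.continuous_eval P

/-- The direct image of a locally free sheaf under a finite étale morphism is locally free. -/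
theorem ModSheaf.push_locallyFree (hφ : φ.IsFiniteEtale d) {E : ModSheaf.{u, v} D₂}
    (hE : E.IsLocallyFree r) : (ModSheaf.push φ E).IsLocallyFree (r * d) := by
  intro x
  obtain ⟨A, hA, hAd⟩ := (hφ.finite_fibres x).t2_separation
  choose B hB e he using hE
  let ι : Type u := φ.toFun ⁻¹' {x}
  let P : ι → Opens D₂.Pt := fun y => ⟨A y.1, (hA y.1).2⟩ ⊓ B y.1
  have hyP : ∀ y : ι, y.1 ∈ P y := fun y => ⟨(hA y.1).1, hB y.1⟩
  obtain ⟨U, hxU, b, hb⟩ := hφ.locallyFree x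
  -- a neighbourhood of `x` whose preimage is covered by the `P y`
  let N : Opens D₁.Pt := ⟨(φ.toFun '' ((⨆ y, P y : Opens D₂.Pt) : Set D₂.Pt)ᶜ)ᶜ,
    (hφ.closed _ (⨆ y, P y).isOpen.isClosed_compl).isOpen_compl⟩ ⊓ U
  have hxN : x ∈ N := by
    refine ⟨?_, hxU⟩
    rintro ⟨y, hy, hyx⟩
    exact hy (Opens.mem_iSup.2 ⟨⟨y, hyx⟩, hyP _⟩)
  have hNP : φ.pre N ≤ ⨆ y, P y := by
    intro y hy
    by_contra h
    exact hy.1 ⟨y, h, rfl⟩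
  let Q : ι → Opens D₂.Pt := fun y => φ.pre N ⊓ P y
  have hQN : ∀ y, Q y ≤ φ.pre N := fun y => inf_le_left
  have hQB : ∀ y, Q y ≤ B y.1 := fun y => inf_le_right.trans inf_le_right
  have hNQ : φ.pre N ≤ ⨆ y, Q y := by
    simp only [Q]; rw [← inf_iSup_eq]; exact le_inf le_rfl hNP
  have hdis : ∀ y z : ι, y ≠ z → Q y ⊓ Q z ≤ ⊥ := by
    intro y z hyz w hw
    have := Set.disjoint_left.1 (hAd y.2 z.2 fun h => hyz (Subtype.ext h))
    exact this hw.1.2.1 hw.2.2.1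
  -- a basis of `E` over the preimage of `N`
  have hex : ∀ j : Fin r, ∃ s : E.Sec (φ.pre N), ∀ y, E.res (hQN y) s = E.res (hQB y) (e y.1 j) := by
    intro j
    refine (E.glue Q (φ.pre N) hQN hNQ (fun y => E.res (hQB y) (e y.1 j)) fun y z => ?_).exists
    by_cases hyz : y = z
    · subst hyz; rfl
    · have := E.subsingleton (hdis y z hyz)
      exact Subsingleton.elim _ _
  choose s hs using hex
  have hsb : E.IsBasisOn (φ.pre N) s := ModSheaf.IsBasisOn.of_cover hQN hNQ fun y => by
    have : (fun j => E.res (hQN y) (s j)) = fun j => E.res (hQB y) (e y.1 j) :=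
      funext fun j => hs j y
    rw [this]
    exact (he y.1).mono (hQB y)
  have hNU : N ≤ U := inf_le_right
  -- the products of the two bases
  refine ⟨N, hxN, fun l => (show E.Sec (φ.pre N) from
    resO (φ.pre_mono hNU) (show O (φ.pre U) from b (finProdFinEquiv.symm l).2) •
      s (finProdFinEquiv.symm l).1), fun V hV m => ?_⟩
  have hbV : ∀ g : O (φ.pre V), ∃! c : Fin d → O V,
      g = ∑ i, φ.comap V (c i) * resO (φ.pre_mono (hV.trans hNU)) (b i) :=
    fun g => hb V (hV.trans hNU) g
  obtain ⟨g, hg, hgu⟩ := hsb (φ.pre V) (φ.pre_mono hV) m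
  choose c hc hcu using fun j => hbV (g j)
  have expand : ∀ c : Fin (r * d) → O V,
      (∑ l, (show E.Sec (φ.pre V) from φ.comap V (c l) • E.res (φ.pre_mono hV)
        (resO (φ.pre_mono hNU) (show O (φ.pre U) from b (finProdFinEquiv.symm l).2) •
      s (finProdFinEquiv.symm l).1)) : E.Sec (φ.pre V)) =
      ∑ j, (∑ i, φ.comap V (c (finProdFinEquiv (j, i))) *
        resO (φ.pre_mono (hV.trans hNU)) (b i)) • E.res (φ.pre_mono hV) (s j) := by
    intro c
    rw [← finProdFinEquiv.sum_comp, Fintype.sum_prod_type]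
    refine Finset.sum_congr rfl fun j _ => ?_
    rw [Finset.sum_smul]
    refine Finset.sum_congr rfl fun i _ => ?_
    simp only [Equiv.symm_apply_apply]
    rw [E.res_smul, mul_smul]
    rfl
  refine ⟨fun l => c (finProdFinEquiv.symm l).1 (finProdFinEquiv.symm l).2, ?_, fun c' hc' => ?_⟩
  · refine Eq.trans ?_ (expand _).symm
    refine hg.trans (Finset.sum_congr rfl fun j _ => ?_)
    congr 1
    simp only [Equiv.symm_apply_apply]
    exact hc j
  · have h1 := hgu _ (Eq.trans hc' (expand c'))
    funext l
    have h2 := hcu (finProdFinEquiv.symm l).1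
      (fun i => c' (finProdFinEquiv ((finProdFinEquiv.symm l).1, i)))
      (congrFun h1 (finProdFinEquiv.symm l).1).symm
    have := congrFun h2 (finProdFinEquiv.symm l).2
    simpa only [Prod.mk.eta, Equiv.apply_symm_apply] using this

end Push

section DiffEq

variable {k : Type u} [NontriviallyNormedField k] [IsUltrametricDist k] [IsAlgClosed k]
  [CompleteSpace k]

/-- A differential equation `(E, ∇)` of rank `r` on a disc `D`: a locally free `𝒪`-module of rank
`r` with a connection. Since `Ω¹` is free on `dT`, the connection is given by
`∇ = dT ⊗ ∇_{d/dT}`, and `conn` is `∇_{d/dT}`. -/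
structure DiffEq (D : Disc k) (r : ℕ) where
  /-- the underlying sheaf of modules -/
  sheaf : ModSheaf.{u, v} D
  locallyFree : sheaf.IsLocallyFree r
  /-- the operator `∇_{d/dT}` on sections -/
  conn : ∀ U, sheaf.Sec U →ₗ[k] sheaf.Sec U
  conn_res : ∀ {U V : Opens D.Pt} (h : V ≤ U) (e : sheaf.Sec U),
    sheaf.res h (conn U e) = conn V (sheaf.res h e)
  leibniz : ∀ (U : Opens D.Pt) (f : O U) (e : sheaf.Sec U),
    conn U (f • e) = ddT U f • e + f • conn U e

variable {D D₂ D₁ : Disc k} {φ : Mor D₂ D₁} {r d : ℕ}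

/-- The space `H⁰(U, (E, ∇))` of horizontal sections over `U`. -/
def DiffEq.H0 (E : DiffEq.{u, v} D r) (U : Opens D.Pt) : Submodule k (E.sheaf.Sec U) :=
  LinearMap.ker (E.conn U)

/-- The `i`-th radius of convergence, `1 ≤ i ≤ r`, at a rational point `x` of `D`. -/
def DiffEq.radius (E : DiffEq.{u, v} D r) (x : k) (i : ℕ) : ℝ :=
  sSup {s : ℝ | s ∈ Set.Ioo 0 1 ∧ r - i + 1 ≤ Module.finrank k (E.H0 (D.sub x s))}

/-- The operator `(jac φ)⁻¹ ∇_{d/dT₂}` on the sections over `φ⁻¹(U)`. As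
`φ^* dT₁ = (jac φ) dT₂`, it is the operator `∇_{d/dT₁}` of the direct image. -/
def DiffEq.pushConn (E : DiffEq.{u, v} D₂ r) (hφ : φ.IsFiniteEtale d) (U : Opens D₁.Pt) :
    E.sheaf.Sec (φ.pre U) →ₗ[k] E.sheaf.Sec (φ.pre U) where
  toFun e := hφ.invJac U • E.conn (φ.pre U) e
  map_add' e₁ e₂ := by rw [map_add, smul_add]
  map_smul' c e := by
    rw [map_smul, RingHom.id_apply, ModSheaf.smul_def, ModSheaf.smul_def, smul_comm]

theorem DiffEq.pushConn_apply (E : DiffEq.{u, v} D₂ r) (hφ : φ.IsFiniteEtale d)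
    (U : Opens D₁.Pt) (e : E.sheaf.Sec (φ.pre U)) :
    E.pushConn hφ U e = hφ.invJac U • E.conn (φ.pre U) e := rfl

theorem DiffEq.pushConn_res (E : DiffEq.{u, v} D₂ r) (hφ : φ.IsFiniteEtale d)
    {U V : Opens D₁.Pt} (h : V ≤ U) (e : E.sheaf.Sec (φ.pre U)) :
    E.sheaf.res (φ.pre_mono h) (E.pushConn hφ U e) =
      E.pushConn hφ V (E.sheaf.res (φ.pre_mono h) e) := by
  rw [pushConn_apply, pushConn_apply, E.sheaf.res_smul, E.conn_res, hφ.invJac_res h]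

theorem DiffEq.pushConn_leibniz (E : DiffEq.{u, v} D₂ r) (hφ : φ.IsFiniteEtale d)
    (U : Opens D₁.Pt) (f : O U) (e : E.sheaf.Sec (φ.pre U)) :
    E.pushConn hφ U (φ.comap U f • e) =
      φ.comap U (ddT U f) • e + φ.comap U f • E.pushConn hφ U e := by
  rw [pushConn_apply, pushConn_apply, E.leibniz, φ.chain_rule, smul_add, smul_smul,
    smul_comm (φ.comap U f), mul_left_comm, hφ.jac_mul_invJac, mul_one]

/-- The direct image `φ_* (E, ∇)` under a finite étale morphism of degree `d`. -/
def DiffEq.push (E : DiffEq.{u, v} D₂ r) (hφ : φ.IsFiniteEtale d) : DiffEq.{u, v} D₁ (r * d) where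
  sheaf := ModSheaf.push φ E.sheaf
  locallyFree := ModSheaf.push_locallyFree hφ E.locallyFree
  conn U :=
    { toFun := E.pushConn hφ U
      map_add' := (E.pushConn hφ U).map_add
      map_smul' := (E.pushConn hφ U).map_smul }
  conn_res h e := E.pushConn_res hφ h e
  leibniz U f e := E.pushConn_leibniz hφ U f e

/-- The function `Φₓ(s) = dim_k H⁰(φ⁻¹(D(x, s⁻)), (E, ∇))`. -/
def Phi (φ : Mor D₂ D₁) (E : DiffEq.{u, v} D₂ r) (x : k) (s : ℝ) : ℕ :=
  Module.finrank k (E.H0 (φ.pre (D₁.sub x s)))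

end DiffEq

end

end Berk

open Berk

/-!
The connection of a direct image `φ_* (E, ∇)` is that of `E` times an invertible function, so its
horizontal sections over `U` are those of `E` over `φ⁻¹(U)` (`DiffEq.pushH0Equiv`). Hence `Φₓ(s)`
is the dimension `h(s)` of the space of horizontal sections over `D(x, s⁻)` of a single
differential equation `F` of rank `N = r d` on `D₁`, and everything follows from four properties
of `h` on `(0, 1]`: it is at most `N`, nonincreasing, left continuous, and equal to `N` for small
`s` (`IsDimFun`). By them, the radius `𝓡ᵢ` equals `R < 1` exactly when
`h(R⁺) < N - i + 1 ≤ h(R)`, and equals `1` exactly when `N - i + 1 ≤ h(1)`; it remains to count.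

* Monotonicity and the bound by `N` come from the identity principle
  (`eq_zero_of_germZero_center`): a section over a disc whose germ at the centre is zero is zero.
  It is proved by continuation along the paths `t ↦ η_{a,t}` of Gauss points. The local step is
  `circ_zero_of_frequently`: near `η_{a,t}` an analytic function is a uniform limit of rational
  functions, and the three circles theorem transports the smallness of their Gauss norms across
  `t`. No structure theory of affinoid domains is needed, because only the rational points on
  circles close to, but different from, the one of radius `t` are considered: these lie in every
  neighbourhood of `η_{a,t}`.
* A horizontal section is determined by its value at the centre (`ode_unique`), and near the
  centre any value is attained (`ode_exists`), by the horizontal section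
  `∑ (-1)^m (T - x)^m / m! ∇^m e`. It converges since `|1 / m!|` grows at most geometrically in
  characteristic `0`.
* Left continuity is the sheaf property (`DiffEq.exists_finrank_H0_left`).
-/

namespace Berk

noncomputable section

/-! ### Gauss points and the filter of rational points near a circle -/

section Gauss

variable {k : Type u} [NontriviallyNormedField k]

/-- The Gauss value `|P|_{a,t}` of a polynomial with respect to the disc of centre `a` and radius
`t`, written through the roots of `P`. For `t ≤ 0` this is `|P(a)|`. -/
def gaussVal (a : k) (t : ℝ) (P : k[X]) : ℝ :=
  ‖P.leadingCoeff‖ * (P.roots.map fun α => max ‖α - a‖ t).prod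

/-- The filter of the rational points whose distance to `a` tends to `t` without being equal
to `t`. Along it, every polynomial has the absolute value given by the Gauss point of `D(a, t)`. -/
def circ (a : k) (t : ℝ) : Filter k := comap (fun b => ‖b - a‖) (𝓝[≠] t)

theorem eventually_circ {a : k} {t : ℝ} {p : k → Prop} :
    (∀ᶠ b in circ a t, p b) ↔ ∀ᶠ s in 𝓝 t, s ≠ t → ∀ b, ‖b - a‖ = s → p b := by
  rw [circ, eventually_comap, eventually_nhdsWithin_iff]
  rfl

theorem eventually_circ_of_nhds {a : k} {t : ℝ} {p : ℝ → Prop} (h : ∀ᶠ s in 𝓝 t, p s) :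
    ∀ᶠ b in circ a t, p ‖b - a‖ :=
  eventually_circ.2 (h.mono fun _ hs _ _ e => e ▸ hs)

theorem tendsto_norm_circ (a : k) (t : ℝ) : Tendsto (fun b => ‖b - a‖) (circ a t) (𝓝 t) :=
  tendsto_comap.mono_right nhdsWithin_le_nhds

theorem circ_neBot [IsAlgClosed k] (a : k) {t : ℝ} (ht : 0 < t) : (circ a t).NeBot := by
  rw [circ, comap_neBot_iff]
  intro s hs
  obtain ⟨u, hu, H⟩ := (mem_nhdsGT_iff_exists_Ioo_subset' (lt_add_one t)).1
    (nhdsGT_le_nhdsNE t hs)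
  obtain ⟨b, hb, hb'⟩ := exists_norm_between (k := k) ht hu
  exact ⟨a + b, H (by simpa using ⟨hb, hb'⟩)⟩

theorem gaussVal_continuous (a : k) (P : k[X]) : Continuous fun t => gaussVal a t P := by
  refine continuous_const.mul ?_
  exact continuous_multiset_prod _ fun α _ => continuous_const.max continuous_id

theorem gaussVal_nonneg (a : k) (t : ℝ) (P : k[X]) : 0 ≤ gaussVal a t P := by
  refine mul_nonneg (norm_nonneg _) (Multiset.prod_nonneg fun x hx => ?_)
  obtain ⟨α, -, rfl⟩ := Multiset.mem_map.1 hx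
  exact (norm_nonneg _).trans (le_max_left _ _)

theorem norm_eval_eq_prod [IsAlgClosed k] (P : k[X]) (b : k) :
    ‖P.eval b‖ = ‖P.leadingCoeff‖ * (P.roots.map fun α => ‖b - α‖).prod := by
  conv_lhs => rw [poly_eq P]
  rw [eval_mul, norm_mul, eval_C, eval_multiset_prod, Multiset.map_map]
  congr 1
  rw [← normHom_apply, map_multiset_prod, Multiset.map_map]
  exact congrArg _ (Multiset.map_congr rfl fun α _ => by simp)

theorem gaussVal_of_nonpos [IsAlgClosed k] (a : k) {t : ℝ} (ht : t ≤ 0) (P : k[X]) :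
    gaussVal a t P = ‖P.eval a‖ := by
  rw [norm_eval_eq_prod, gaussVal]
  congr 2
  refine Multiset.map_congr rfl fun α _ => ?_
  rw [max_eq_left (ht.trans (norm_nonneg _)), norm_sub_rev]

theorem line_isInducing : IsInducing (fun y : Line k => fun P : k[X] => y.1 P) := ⟨rfl⟩

/-- An open subset of the disc, as a neighbourhood in the affine line of each of its points. -/
theorem image_mem_nhds {D : Disc k} (U : Opens D.Pt) {y : D.Pt} (hy : y ∈ U) :
    {z : Line k | ∃ w ∈ U, w.1 = z} ∈ 𝓝 y.1 := by
  have ho : IsOpen {z : Line k | z.1 (X - C D.center) < D.radius} :=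
    isOpen_lt (continuous_eval _) continuous_const
  have := (ho.isOpenMap_subtype_val _ U.isOpen).mem_nhds (Set.mem_image_of_mem _ hy)
  exact this

/-! ### Three circles -/

theorem max_sq_le {A s s₁ s₂ : ℝ} (hA : 0 ≤ A) (h1 : 0 < s₁) (h2 : 0 < s₂) (hs : s ^ 2 = s₁ * s₂) :
    max A s ^ 2 ≤ max A s₁ * max A s₂ := by
  rcases le_total A s with h | h
  · rw [max_eq_right h, hs]
    exact mul_le_mul (le_max_right _ _) (le_max_right _ _) h2.le (h1.le.trans (le_max_right _ _))
  · rw [max_eq_left h, sq]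
    exact mul_le_mul (le_max_left _ _) (le_max_left _ _) hA (hA.trans (le_max_left _ _))

theorem max_sq_eq {A s s₁ s₂ : ℝ} (h1 : 0 < s₁) (h0 : 0 < s)
    (hs : s ^ 2 = s₁ * s₂) (h12 : s₁ ≤ s₂) (h : A ≤ s₁ ∨ s₂ ≤ A) :
    max A s ^ 2 = max A s₁ * max A s₂ := by
  have hs1 : s₁ ≤ s := by nlinarith
  have hs2 : s ≤ s₂ := by nlinarith
  rcases h with h | h
  · rw [max_eq_right h, max_eq_right (h.trans hs1), max_eq_right (h.trans h12), hs]
  · rw [max_eq_left h, max_eq_left (hs2.trans h), max_eq_left (h12.trans h), sq]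

theorem gaussVal_sq_le (a : k) {s s₁ s₂ : ℝ} (h1 : 0 < s₁) (h2 : 0 < s₂) (h0 : 0 < s)
    (hs : s ^ 2 = s₁ * s₂) (P : k[X]) :
    gaussVal a s P ^ 2 ≤ gaussVal a s₁ P * gaussVal a s₂ P := by
  simp only [gaussVal]
  rw [mul_pow, mul_mul_mul_comm, ← sq, ← Multiset.prod_map_pow, ← Multiset.prod_map_mul]
  refine mul_le_mul_of_nonneg_left ?_ (by positivity)
  exact Multiset.prod_map_le_prod_map₀ _ _ (fun _ _ => by positivity)
    fun α _ => max_sq_le (norm_nonneg _) h1 h2 hs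

theorem gaussVal_sq_eq (a : k) {s s₁ s₂ : ℝ} (h1 : 0 < s₁) (h0 : 0 < s)
    (hs : s ^ 2 = s₁ * s₂) (h12 : s₁ ≤ s₂) {P : k[X]}
    (hP : ∀ α ∈ P.roots, ‖α - a‖ ≤ s₁ ∨ s₂ ≤ ‖α - a‖) :
    gaussVal a s P ^ 2 = gaussVal a s₁ P * gaussVal a s₂ P := by
  simp only [gaussVal]
  rw [mul_pow, mul_mul_mul_comm, ← sq, ← Multiset.prod_map_pow, ← Multiset.prod_map_mul]
  congr 2
  exact Multiset.map_congr rfl fun α hα => max_sq_eq h1 h0 hs h12 (hP α hα)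

/-- Hadamard's three circles theorem for a rational function without poles in the open annulus
`s₁ < |T - a| < s₂`: its Gauss norm is logarithmically convex. -/
theorem three_circles (a : k) {s s₁ s₂ : ℝ} (h1 : 0 < s₁) (h2 : 0 < s₂) (h0 : 0 < s)
    (hs : s ^ 2 = s₁ * s₂) (h12 : s₁ ≤ s₂) (g : k[X]) {h : k[X]}
    (hP : ∀ b, s₁ < ‖b - a‖ → ‖b - a‖ < s₂ → h.eval b ≠ 0) :
    (gaussVal a s g / gaussVal a s h) ^ 2 ≤
      gaussVal a s₁ g / gaussVal a s₁ h * (gaussVal a s₂ g / gaussVal a s₂ h) := by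
  rw [div_pow, div_mul_div_comm, gaussVal_sq_eq (P := h) a h1 h0 hs h12 ?_]
  · exact div_le_div_of_nonneg_right (gaussVal_sq_le a h1 h2 h0 hs g)
      (mul_nonneg (gaussVal_nonneg _ _ _) (gaussVal_nonneg _ _ _))
  · intro α hα
    by_contra! hc
    exact hP α hc.1 hc.2 (isRoot_of_mem_roots hα)

/-! ### Gauss points as limits of rational points -/

variable [IsUltrametricDist k]

theorem norm_sub_eq_max {a α b : k} (h : ‖α - a‖ ≠ ‖b - a‖) :
    ‖b - α‖ = max ‖α - a‖ ‖b - a‖ := by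
  have := IsUltrametricDist.norm_add_eq_max_of_norm_ne_norm (x := -(α - a)) (y := b - a)
    (by rwa [norm_neg])
  rw [norm_neg] at this
  rw [← this]
  congr 1
  ring

theorem norm_sub_le_max' (a α b : k) : ‖b - α‖ ≤ max ‖α - a‖ ‖b - a‖ := by
  have := IsUltrametricDist.norm_add_le_max (-(α - a)) (b - a)
  rw [norm_neg] at this
  refine le_trans (le_of_eq ?_) this
  congr 1
  ring

variable [IsAlgClosed k]

theorem norm_eval_eq_gaussVal {a b : k} {P : k[X]} (h : ∀ α ∈ P.roots, ‖α - a‖ ≠ ‖b - a‖) :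
    ‖P.eval b‖ = gaussVal a ‖b - a‖ P := by
  rw [norm_eval_eq_prod, gaussVal]
  congr 2
  exact Multiset.map_congr rfl fun α hα => norm_sub_eq_max (h α hα)

theorem norm_eval_le_gaussVal {a b : k} {t : ℝ} (h : ‖b - a‖ ≤ t) (P : k[X]) :
    ‖P.eval b‖ ≤ gaussVal a t P := by
  rw [norm_eval_eq_prod, gaussVal]
  refine mul_le_mul_of_nonneg_left ?_ (norm_nonneg _)
  refine Multiset.prod_map_le_prod_map₀ _ _ (fun _ _ => norm_nonneg _) fun α _ => ?_
  exact (norm_sub_le_max' a α b).trans (max_le_max le_rfl h)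

theorem tendsto_norm_eval (a : k) (t : ℝ) (P : k[X]) :
    Tendsto (fun b => ‖P.eval b‖) (circ a t) (𝓝 (gaussVal a t P)) := by
  have h1 : Tendsto (fun b => gaussVal a ‖b - a‖ P) (circ a t) (𝓝 (gaussVal a t P)) :=
    ((gaussVal_continuous a P).tendsto t).comp (tendsto_norm_circ a t)
  refine h1.congr' ?_
  classical
  let S : Set ℝ := (fun α => ‖α - a‖) '' {α | α ∈ P.roots} \ {t}
  have hS : S.Finite := by
    refine (Set.Finite.image _ ?_).subset Set.sdiff_subset
    exact P.roots.toFinset.finite_toSet.subset fun α hα => by simpa using hα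
  have hSt : ∀ᶠ s in 𝓝 t, s ∉ S := hS.isClosed.isOpen_compl.mem_nhds fun h => h.2 rfl
  refine eventually_circ.2 (hSt.mono fun s hs hst b hb => ?_)
  refine (norm_eval_eq_gaussVal fun α hα e => hs ⟨⟨α, hα, e.trans hb⟩, hst⟩).symm

/-- The Gauss point `η_{a,t}` of the disc of centre `a` and radius `t`. For `t ≤ 0` it is the
rational point `a`. -/
def gaussPt (a : k) (t : ℝ) : Line k :=
  ⟨{ toFun := gaussVal a t
     map_zero' := by simp [gaussVal]
     add_le' := fun P Q => by
       rcases le_or_gt t 0 with ht | ht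
       · simpa only [gaussVal_of_nonpos a ht, eval_add] using norm_add_le _ _
       · have := circ_neBot a ht
         refine le_of_tendsto_of_tendsto (tendsto_norm_eval a t (P + Q))
           ((tendsto_norm_eval a t P).add (tendsto_norm_eval a t Q))
           (Eventually.of_forall fun b => ?_)
         simpa only [eval_add] using norm_add_le _ _
     neg' := fun P => by simp [gaussVal]
     map_one' := by simp [gaussVal]
     map_mul' := fun P Q => by
       rcases le_or_gt t 0 with ht | ht
       · simp only [gaussVal_of_nonpos a ht, eval_mul, norm_mul]
       · have := circ_neBot a ht
         refine tendsto_nhds_unique (tendsto_norm_eval a t (P * Q)) ?_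
         simpa only [eval_mul, norm_mul] using
           (tendsto_norm_eval a t P).mul (tendsto_norm_eval a t Q) }, fun c => by
      change gaussVal a t (C c) = ‖c‖
      simp [gaussVal]⟩

theorem gaussPt_apply (a : k) (t : ℝ) (P : k[X]) : (gaussPt a t).1 P = gaussVal a t P := rfl

theorem gaussPt_X_sub_C (a c : k) (t : ℝ) : (gaussPt a t).1 (X - C c) = max ‖c - a‖ t := by
  simp [gaussPt_apply, gaussVal]

theorem tendsto_pt_circ (a : k) (t : ℝ) : Tendsto pt (circ a t) (𝓝 (gaussPt a t)) := by
  rw [line_isInducing.tendsto_nhds_iff, tendsto_pi_nhds]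
  exact fun P => tendsto_norm_eval a t P

theorem continuous_gaussPt (a : k) : Continuous (gaussPt a) := by
  rw [line_isInducing.continuous_iff, continuous_pi_iff]
  exact fun P => gaussVal_continuous a P

variable {D : Disc k}

theorem eventually_mem_rat {U : Opens D.Pt} {y : D.Pt} (hy : y ∈ U) {a : k} {t : ℝ}
    (e : y.1 = gaussPt a t) : ∀ᶠ b in circ a t, b ∈ rat U := by
  have := image_mem_nhds U hy
  rw [e] at this
  exact (tendsto_pt_circ a t).eventually this

theorem eventually_gaussPt_mem {U : Opens D.Pt} {y : D.Pt} (hy : y ∈ U) {a : k} {t : ℝ}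
    (e : y.1 = gaussPt a t) : ∀ᶠ s in 𝓝 t, ∃ w ∈ U, w.1 = gaussPt a s := by
  have := image_mem_nhds U hy
  rw [e] at this
  exact ((continuous_gaussPt a).tendsto t).eventually this

end Gauss

/-! ### The identity principle for analytic functions -/

section Identity

variable {k : Type u} [NontriviallyNormedField k] [IsUltrametricDist k] [IsAlgClosed k]
  {D : Disc k}

theorem norm_div_le_gaussVal {a b : k} (g : k[X]) {h : k[X]}
    (hb : ∀ c, ‖c - a‖ = ‖b - a‖ → h.eval c ≠ 0) :
    ‖g.eval b / h.eval b‖ ≤ gaussVal a ‖b - a‖ g / gaussVal a ‖b - a‖ h := by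
  rw [norm_div, norm_eval_eq_gaussVal (P := h) (a := a) fun α hα e =>
    hb α e (isRoot_of_mem_roots hα)]
  exact div_le_div_of_nonneg_right (norm_eval_le_gaussVal le_rfl g) (gaussVal_nonneg _ _ _)

theorem gaussVal_div_le (a : k) {s ε : ℝ} (hs : 0 < s) (g : k[X]) {h : k[X]}
    (hh : gaussVal a s h ≠ 0) (H : ∀ᶠ b in circ a s, ‖g.eval b / h.eval b‖ ≤ ε) :
    gaussVal a s g / gaussVal a s h ≤ ε := by
  have := circ_neBot a hs
  refine le_of_tendsto ?_ H
  simp only [norm_div]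
  exact (tendsto_norm_eval a s g).div (tendsto_norm_eval a s h) hh

/-- If an analytic function vanishes at the rational points close to circles of radii
accumulating at `t`, then it vanishes at the rational points close to the circle of radius `t`.
Approximating rational functions `q` have small Gauss norm at `η_{a,t}` by continuity, hence also
at the neighbouring `η_{a,s}` by the three circles theorem, as they are uniformly bounded. -/
theorem circ_zero_of_frequently {U : Opens D.Pt} (f : O U) {y : D.Pt} (hy : y ∈ U) {a : k}
    {t : ℝ} (e : y.1 = gaussPt a t) (ht : 0 < t)
    (hf : ∃ᶠ s in 𝓝 t, ∀ᶠ b in circ a s, ext0 f.1 b = 0) :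
    ∀ᶠ b in circ a t, ext0 f.1 b = 0 := by
  obtain ⟨V, hV, hVU, HV⟩ := f.2 y hy
  obtain ⟨g₀, h₀, hh₀, H₀⟩ := HV 1 one_pos
  obtain ⟨W, hyW, hWV, M, hM, HM⟩ := bdd_rational (g := g₀) hh₀ hV
  have hfM : ∀ b ∈ rat W, ‖ext0 f.1 b‖ ≤ M + 1 := by
    intro b hb
    have hbU := rat_mono (hWV.trans hVU) hb
    rw [ext0_apply f.1 ⟨b, hbU⟩]
    have h1 := H₀ ⟨b, hbU⟩ (rat_mono hWV hb)
    have h2 := HM b hb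
    have h3 := norm_le_norm_sub_add (f.1 ⟨b, hbU⟩) (g₀.eval b / h₀.eval b)
    linarith
  obtain ⟨l', u, ⟨hl't, htu⟩, hlu⟩ := mem_nhds_iff_exists_Ioo_subset.1
    ((eventually_circ.1 (eventually_mem_rat hyW e)).and (eventually_gaussPt_mem hyW e))
  set l := max l' (t / 2) with hl
  have hlt : l < t := max_lt hl't (by linarith)
  have hl0 : 0 < l := lt_of_lt_of_le (by linarith) (le_max_right _ _)
  have hrat : ∀ b, l < ‖b - a‖ → ‖b - a‖ < u → ‖b - a‖ ≠ t → b ∈ rat W := fun b h1 h2 h3 =>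
    (hlu ⟨(le_max_left _ _).trans_lt h1, h2⟩).1 h3 b rfl
  have hpt : ∀ s, l < s → s < u → ∃ w ∈ W, w.1 = gaussPt a s := fun s h1 h2 =>
    (hlu ⟨(le_max_left _ _).trans_lt h1, h2⟩).2
  have hev : ∀ᶠ s in 𝓝 t, l < s ∧ s < u ∧ l * t < s ^ 2 ∧ s ^ 2 < t * u := by
    have hc : Tendsto (fun s : ℝ => s ^ 2) (𝓝 t) (𝓝 (t ^ 2)) := (continuous_pow 2).tendsto t
    refine (eventually_gt_nhds hlt).and ((eventually_lt_nhds htu).and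
      ((hc.eventually_const_lt ?_).and (hc.eventually_lt_const ?_))) <;> nlinarith
  refine eventually_circ.2 (hev.mono fun s hs hst b hb => ?_)
  obtain ⟨hls, hsu, hs1, hs2⟩ := hs
  have hs0 : 0 < s := hl0.trans hls
  have hbW : b ∈ rat W := hrat b (hb ▸ hls) (hb ▸ hsu) (hb ▸ hst)
  have hbU := rat_mono (hWV.trans hVU) hbW
  refine norm_eq_zero.1 (le_antisymm (le_of_forall_pos_le_add fun η hη => ?_) (norm_nonneg _))
  set ε := min 1 (min (η / 2) ((η / 2) ^ 2 / (M + 2))) with hε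
  have hε0 : 0 < ε := by positivity
  obtain ⟨g, h, hh, H⟩ := HV ε hε0
  set Q : ℝ → ℝ := fun s => gaussVal a s g / gaussVal a s h with hQ
  have hh0 : ∀ s, l < s → s < u → gaussVal a s h ≠ 0 := by
    intro s h1 h2
    obtain ⟨w, hw, ew⟩ := hpt s h1 h2
    have := hh w (hWV hw)
    rwa [ew, gaussPt_apply] at this
  have Hq : ∀ b (hb : b ∈ rat W), ‖ext0 f.1 b - g.eval b / h.eval b‖ < ε := by
    intro b hb
    have hbU := rat_mono (hWV.trans hVU) hb
    rw [ext0_apply f.1 ⟨b, hbU⟩]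
    exact H ⟨b, hbU⟩ (rat_mono hWV hb)
  have hQM : ∀ s, l < s → s < u → Q s ≤ M + 2 := by
    intro s h1 h2
    obtain ⟨w, hw, ew⟩ := hpt s h1 h2
    refine gaussVal_div_le a (hl0.trans h1) g (hh0 s h1 h2) ?_
    filter_upwards [eventually_mem_rat hw ew] with b hb
    have h3 := norm_le_norm_sub_add (g.eval b / h.eval b) (ext0 f.1 b)
    rw [norm_sub_rev] at h3
    linarith [Hq b hb, hfM b hb, min_le_left 1 (min (η / 2) ((η / 2) ^ 2 / (M + 2)))]
  have hQt : Q t ≤ ε := by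
    by_contra! hc
    have hcont : Tendsto Q (𝓝 t) (𝓝 (Q t)) := ((gaussVal_continuous a g).tendsto t).div
      ((gaussVal_continuous a h).tendsto t) (hh0 t hlt htu)
    obtain ⟨s, h1, h2, h3, h4, -⟩ := (hf.and_eventually
      ((hcont.eventually_const_lt hc).and hev)).exists
    obtain ⟨w, hw, ew⟩ := hpt s h3 h4
    refine absurd (gaussVal_div_le a (hl0.trans h3) g (hh0 s h3 h4) ?_) (not_le.2 h2)
    filter_upwards [eventually_mem_rat hw ew, h1] with b hb hb0
    have := Hq b hb
    rw [hb0, zero_sub, norm_neg] at this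
    exact this.le
  have hQ0 : ∀ s, 0 ≤ Q s := fun s => div_nonneg (gaussVal_nonneg _ _ _) (gaussVal_nonneg _ _ _)
  -- the third circle has radius `s ^ 2 / t`, so that `s` is the geometric mean of it and `t`
  have hs' : l < s ^ 2 / t ∧ s ^ 2 / t < u := by
    rw [lt_div_iff₀ ht, div_lt_iff₀ ht]
    exact ⟨hs1, by rwa [mul_comm] at hs2⟩
  have hpole : ∀ b, l < ‖b - a‖ → ‖b - a‖ < u → ‖b - a‖ ≠ t → h.eval b ≠ 0 :=
    fun b h1 h2 h3 => eval_ne_zero hh (rat_mono hWV (hrat b h1 h2 h3))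
  have hQs : Q s ^ 2 ≤ (M + 2) * ε := by
    have hQ' := hQM _ hs'.1 hs'.2
    rcases lt_or_gt_of_ne hst with h1 | h1
    · refine (three_circles a (s₁ := s ^ 2 / t) (s₂ := t) (by positivity) ht hs0 (by field_simp)
        ?_ g fun c hc1 hc2 => hpole c (hs'.1.trans hc1) (hc2.trans htu) hc2.ne).trans ?_
      · rw [div_le_iff₀ ht]; nlinarith
      · exact mul_le_mul hQ' hQt (hQ0 t) (by positivity)
    · refine (three_circles a (s₁ := t) (s₂ := s ^ 2 / t) ht (by positivity) hs0 (by field_simp)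
        ?_ g fun c hc1 hc2 => hpole c (hlt.trans hc1) (hc2.trans hs'.2) hc1.ne').trans ?_
      · rw [le_div_iff₀ ht]; nlinarith
      · rw [mul_comm]
        exact mul_le_mul hQ' hQt (hQ0 t) (by positivity)
  have hQη : Q s ≤ η / 2 := by
    refine (pow_le_pow_iff_left₀ (hQ0 s) (by positivity) two_ne_zero).1 (hQs.trans ?_)
    have : ε ≤ (η / 2) ^ 2 / (M + 2) := (min_le_right _ _).trans (min_le_right _ _)
    rwa [le_div_iff₀ (by positivity), mul_comm] at this
  have hqb : ‖g.eval b / h.eval b‖ ≤ Q s := by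
    have := norm_div_le_gaussVal (a := a) (b := b) g (h := h) fun c hc => by
      rw [hb] at hc
      exact hpole c (hc ▸ hls) (hc ▸ hsu) (hc ▸ hst)
    rwa [hb] at this
  have h3 := norm_le_norm_sub_add (ext0 f.1 b) (g.eval b / h.eval b)
  have : ε ≤ η / 2 := (min_le_right _ _).trans (min_le_left _ _)
  linarith [Hq b hbW]

end Identity

/-! ### Uniform limits of rational functions on a disc -/

section Uniform

variable {k : Type u} [NontriviallyNormedField k]

/-- `f` is, on the rational points of the open disc `D(a, ε⁻)`, a uniform limit of rational
functions without poles there. -/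
def UnifRational (a : k) (ε : ℝ) (f : k → k) : Prop :=
  ∀ η : ℝ, 0 < η → ∃ g h : k[X], (∀ b, ‖b - a‖ < ε → h.eval b ≠ 0) ∧
    ∀ b, ‖b - a‖ < ε → ‖f b - g.eval b / h.eval b‖ < η

variable {a : k} {ε : ℝ} {f f₁ f₂ : k → k}

theorem UnifRational.mono (hf : UnifRational a ε f) {ε' : ℝ} (h : ε' ≤ ε) :
    UnifRational a ε' f := fun η hη => by
  obtain ⟨g, q, h1, h2⟩ := hf η hη
  exact ⟨g, q, fun b hb => h1 b (hb.trans_le h), fun b hb => h2 b (hb.trans_le h)⟩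

theorem UnifRational.congr (hf : UnifRational a ε f₁) (h : ∀ b, ‖b - a‖ < ε → f₁ b = f₂ b) :
    UnifRational a ε f₂ := fun η hη => by
  obtain ⟨g, q, h1, h2⟩ := hf η hη
  exact ⟨g, q, h1, fun b hb => h b hb ▸ h2 b hb⟩

theorem UnifRational.eval (P : k[X]) : UnifRational a ε fun b => P.eval b := fun η hη =>
  ⟨P, 1, by simp, by simpa using fun _ _ => hη⟩

theorem UnifRational.const (c : k) : UnifRational a ε fun _ => c := by
  simpa using UnifRational.eval (a := a) (ε := ε) (C c)

theorem UnifRational.add (h₁ : UnifRational a ε f₁) (h₂ : UnifRational a ε f₂) :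
    UnifRational a ε fun b => f₁ b + f₂ b := fun η hη => by
  obtain ⟨g, h, hh, H⟩ := h₁ (η / 2) (by positivity)
  obtain ⟨g', h', hh', H'⟩ := h₂ (η / 2) (by positivity)
  refine ⟨g * h' + g' * h, h * h', fun b hb => ?_, fun b hb => ?_⟩
  · rw [eval_mul]; exact mul_ne_zero (hh b hb) (hh' b hb)
  · have e1 := hh b hb
    have e2 := hh' b hb
    have : f₁ b + f₂ b - (g * h' + g' * h).eval b / (h * h').eval b
        = (f₁ b - g.eval b / h.eval b) + (f₂ b - g'.eval b / h'.eval b) := by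
      simp only [eval_add, eval_mul]
      field_simp
      ring
    rw [this]
    refine (norm_add_le _ _).trans_lt ?_
    linarith [H b hb, H' b hb]

/-- The uniform limits of rational functions are stable under uniform limits. -/
theorem UnifRational.of_approx
    (H : ∀ η : ℝ, 0 < η → ∃ g, UnifRational a ε g ∧ ∀ b, ‖b - a‖ < ε → ‖f b - g b‖ < η) :
    UnifRational a ε f := fun η hη => by
  obtain ⟨g, hg, h1⟩ := H (η / 2) (by positivity)
  obtain ⟨p, q, hq, h2⟩ := hg (η / 2) (by positivity)
  refine ⟨p, q, hq, fun b hb => ?_⟩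
  have := norm_sub_le_norm_sub_add_norm_sub (f b) (g b) (p.eval b / q.eval b)
  linarith [h1 b hb, h2 b hb]

theorem UnifRational.sum {ι : Type*} (s : Finset ι) {F : ι → k → k}
    (h : ∀ i ∈ s, UnifRational a ε (F i)) : UnifRational a ε fun b => ∑ i ∈ s, F i b := by
  classical
  induction s using Finset.induction_on with
  | empty => simpa using UnifRational.const (a := a) (ε := ε) 0
  | insert i s hi ih =>
    simp only [Finset.sum_insert hi]
    exact (h i (Finset.mem_insert_self _ _)).add
      (ih fun j hj => h j (Finset.mem_insert_of_mem hj))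

/-- Uniform limits of rational functions are analytic. -/
theorem UnifRational.isAnalytic {D : Disc k} (hf : UnifRational a ε f) {U : Opens D.Pt}
    (hU : ∀ y ∈ U, y.1.1 (X - C a) < ε) (hUr : ∀ b ∈ rat U, ‖b - a‖ < ε)
    [IsAlgClosed k] : IsAnalytic U fun b => f b.1 := by
  refine fun x hx => ⟨U, hx, le_rfl, fun η hη => ?_⟩
  obtain ⟨g, h, hh, H⟩ := hf η hη
  refine ⟨g, h, fun y hy h0 => ?_, fun b _ => H b.1 (hUr b.1 b.2)⟩
  rcases eq_or_ne h 0 with rfl | hne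
  · exact hh a (by simpa using (apply_nonneg _ _).trans_lt (hU y hy)) (by simp)
  -- a zero of `h` in the Berkovich disc comes from a root of `h` in the disc
  rw [poly_eq h, map_mul, y.1.2, mul_eq_zero, norm_eq_zero, leadingCoeff_eq_zero,
    or_iff_right hne, map_multiset_prod, Multiset.prod_eq_zero_iff] at h0
  obtain ⟨P, hP, h0⟩ := Multiset.mem_map.1 h0
  obtain ⟨α, hα, rfl⟩ := Multiset.mem_map.1 hP
  refine hh α ?_ (isRoot_of_mem_roots hα)
  have h1 : y.1.1 (C (α - a)) = ‖α - a‖ := y.1.2 _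
  have h2 : (C (α - a) : k[X]) = (X - C a) - (X - C α) := by rw [C_sub]; ring
  rw [← h1, h2]
  exact (map_sub_le_add _ _ _).trans_lt (by rw [h0, add_zero]; exact hU y hy)

variable [IsUltrametricDist k]

theorem norm_sub_lt_iff {a b c : k} {ε : ℝ} (hb : ‖b - a‖ < ε) : ‖c - b‖ < ε ↔ ‖c - a‖ < ε := by
  have h1 := norm_sub_le_max' a b c
  have h2 := norm_sub_le_max' b a c
  rw [norm_sub_rev a b] at h2
  exact ⟨fun h => h2.trans_lt (max_lt hb h), fun h => h1.trans_lt (max_lt hb h)⟩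

theorem UnifRational.recenter (hf : UnifRational a ε f) {b : k} (hb : ‖b - a‖ < ε) :
    UnifRational b ε f := fun η hη => by
  obtain ⟨g, q, h1, h2⟩ := hf η hη
  exact ⟨g, q, fun c hc => h1 c ((norm_sub_lt_iff hb).1 hc),
    fun c hc => h2 c ((norm_sub_lt_iff hb).1 hc)⟩

variable [IsAlgClosed k]

theorem UnifRational.bounded (hf : UnifRational a ε f) (hε : 0 < ε) :
    ∃ M : ℝ, 0 < M ∧ ∀ b, ‖b - a‖ < ε → ‖f b‖ ≤ M := by
  obtain ⟨g, h, hh, H⟩ := hf 1 one_pos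
  have h0 : 0 < ‖h.eval a‖ := norm_pos_iff.2 (hh a (by simpa using hε))
  have hg := gaussVal_nonneg a ε g
  refine ⟨gaussVal a ε g / ‖h.eval a‖ + 1, by positivity, fun b hb => ?_⟩
  have h1 : ‖g.eval b / h.eval b‖ ≤ gaussVal a ε g / ‖h.eval a‖ := by
    rw [norm_div, norm_eval_eq h a hh hb]
    gcongr
    exact norm_eval_le_gaussVal hb.le g
  have h2 := norm_le_norm_sub_add (f b) (g.eval b / h.eval b)
  linarith [H b hb]

theorem UnifRational.mul (hε : 0 < ε) (h₁ : UnifRational a ε f₁) (h₂ : UnifRational a ε f₂) :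
    UnifRational a ε fun b => f₁ b * f₂ b := fun η hη => by
  obtain ⟨M, hM, HM⟩ := h₁.bounded hε
  obtain ⟨N, hN, HN⟩ := h₂.bounded hε
  obtain ⟨g', h', hh', H'⟩ := h₂ (η / (2 * M)) (by positivity)
  obtain ⟨N', hN', HN'⟩ : ∃ M : ℝ, 0 < M ∧ ∀ b, ‖b - a‖ < ε → ‖g'.eval b / h'.eval b‖ ≤ M := by
    refine ⟨N + η / (2 * M), by positivity, fun b hb => ?_⟩
    have := norm_le_norm_sub_add (g'.eval b / h'.eval b) (f₂ b)
    rw [norm_sub_rev] at this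
    linarith [H' b hb, HN b hb]
  obtain ⟨g, h, hh, H⟩ := h₁ (η / (2 * N')) (by positivity)
  refine ⟨g * g', h * h', fun b hb => ?_, fun b hb => ?_⟩
  · rw [eval_mul]; exact mul_ne_zero (hh b hb) (hh' b hb)
  · have : f₁ b * f₂ b - (g * g').eval b / (h * h').eval b =
        f₁ b * (f₂ b - g'.eval b / h'.eval b) +
          (f₁ b - g.eval b / h.eval b) * (g'.eval b / h'.eval b) := by
      simp only [eval_mul, mul_div_mul_comm]
      ring
    rw [this]
    refine (norm_add_le _ _).trans_lt ?_
    rw [norm_mul, norm_mul]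
    have s1 : ‖f₁ b‖ * ‖f₂ b - g'.eval b / h'.eval b‖ ≤ M * ‖f₂ b - g'.eval b / h'.eval b‖ := by
      gcongr; exact HM b hb
    have s2 : M * ‖f₂ b - g'.eval b / h'.eval b‖ < M * (η / (2 * M)) := by
      gcongr; exact H' b hb
    have s3 : ‖f₁ b - g.eval b / h.eval b‖ * ‖g'.eval b / h'.eval b‖ ≤ η / (2 * N') * N' :=
      mul_le_mul (H b hb).le (HN' b hb) (norm_nonneg _) (by positivity)
    have e1 : M * (η / (2 * M)) = η / 2 := by field_simp
    have e2 : η / (2 * N') * N' = η / 2 := by field_simp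
    linarith

/-- Schwarz lemma: if `f` is close to the rational function `g / h` on a disc, then the divided
differences of `f` and of `g / h` are close. -/
theorem UnifRational.lipschitz (hε : 0 < ε) (hf : UnifRational a ε f) {η : ℝ} {g h : k[X]}
    (hh : ∀ b, ‖b - a‖ < ε → h.eval b ≠ 0)
    (H : ∀ b, ‖b - a‖ < ε → ‖f b - g.eval b / h.eval b‖ < η) {b : k} (hb : ‖b - a‖ < ε) :
    ‖(f b - f a) - (g.eval b / h.eval b - g.eval a / h.eval a)‖ ≤ 2 * η / ε * ‖b - a‖ := by
  have haa : ‖a - a‖ < ε := by simpa using hε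
  have hη : 0 < η := (norm_nonneg _).trans_lt (H a haa)
  refine le_of_forall_pos_le_add fun δ hδ => ?_
  obtain ⟨g', h', hh', H'⟩ := hf (min η δ) (lt_min hη hδ)
  have key := rational_lipschitz (g' * h - g * h') (h' * h) a (M := η) hε
    (fun b hb => by rw [eval_mul]; exact mul_ne_zero (hh' b hb) (hh b hb))
    (fun b hb => by
      have e1 := hh b hb
      have e2 := hh' b hb
      have : (g' * h - g * h').eval b / (h' * h).eval b
          = (f b - g.eval b / h.eval b) + -(f b - g'.eval b / h'.eval b) := by
        simp only [eval_sub, eval_mul]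
        field_simp
        ring
      rw [this]
      refine (IsUltrametricDist.norm_add_le_max _ _).trans (max_le (H b hb).le ?_)
      rw [norm_neg]
      exact (H' b hb).le.trans (min_le_left _ _)) hb
  have e1 := hh b hb
  have e2 := hh' b hb
  have e3 := hh a haa
  have e4 := hh' a haa
  have : (f b - f a) - (g.eval b / h.eval b - g.eval a / h.eval a) =
    ((g' * h - g * h').eval b / (h' * h).eval b - (g' * h - g * h').eval a / (h' * h).eval a)
    + ((f b - g'.eval b / h'.eval b) + -(f a - g'.eval a / h'.eval a)) := by
    simp only [eval_sub, eval_mul]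
    field_simp
    ring
  rw [this]
  refine (norm_add_le _ _).trans (add_le_add key ?_)
  refine (IsUltrametricDist.norm_add_le_max _ _).trans (max_le ?_ ?_)
  · exact (H' b hb).le.trans (min_le_right _ _)
  · rw [norm_neg]; exact (H' a haa).le.trans (min_le_right _ _)

variable [CompleteSpace k]

theorem UnifRational.hasDerivAt (hε : 0 < ε) (hf : UnifRational a ε f) {b : k}
    (hb : ‖b - a‖ < ε) : HasDerivAt f (deriv f b) b := by
  obtain ⟨f', h, -⟩ := limit_hasDerivAt f b hε (hf.recenter hb)
  exact h.differentiableAt.hasDerivAt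

theorem UnifRational.norm_deriv_sub_le (hε : 0 < ε) (hf : UnifRational a ε f) {η : ℝ}
    {g h : k[X]} (hh : ∀ b, ‖b - a‖ < ε → h.eval b ≠ 0)
    (H : ∀ b, ‖b - a‖ < ε → ‖f b - g.eval b / h.eval b‖ < η) {b : k} (hb : ‖b - a‖ < ε) :
    ‖deriv f b - (g.derivative.eval b * h.eval b - g.eval b * h.derivative.eval b) /
      h.eval b ^ 2‖ ≤ 2 * η / ε := by
  obtain ⟨f', h1, h2⟩ := limit_hasDerivAt f b hε (hf.recenter hb)
  rw [h1.deriv]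
  exact h2 η g h ((norm_nonneg _).trans_lt (H b hb))
    (fun c hc => hh c ((norm_sub_lt_iff hb).1 hc)) fun c hc => H c ((norm_sub_lt_iff hb).1 hc)

theorem UnifRational.deriv (hε : 0 < ε) (hf : UnifRational a ε f) :
    UnifRational a ε (deriv f) := fun η hη => by
  obtain ⟨g, h, hh, H⟩ := hf (η * ε / 4) (by positivity)
  refine ⟨derivative g * h - g * derivative h, h ^ 2, fun b hb => ?_, fun b hb => ?_⟩
  · rw [eval_pow]; exact pow_ne_zero _ (hh b hb)
  · rw [eval_sub, eval_mul, eval_mul, eval_pow]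
    refine (hf.norm_deriv_sub_le hε hh H hb).trans_lt ?_
    have e : 2 * (η * ε / 4) / ε = η / 2 := by field_simp; norm_num
    rw [e]; linarith

/-- Cauchy's estimate (with a factor `2`). -/
theorem UnifRational.norm_deriv_le (hε : 0 < ε) (hf : UnifRational a ε f) {M : ℝ}
    (hM : ∀ b, ‖b - a‖ < ε → ‖f b‖ ≤ M) {b : k} (hb : ‖b - a‖ < ε) :
    ‖_root_.deriv f b‖ ≤ 2 / ε * M := by
  refine le_of_forall_pos_le_add fun δ hδ => ?_
  have := hf.norm_deriv_sub_le hε (g := 0) (h := 1) (η := M + δ * ε / 2) (by simp)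
    (fun b hb => by simpa using (hM b hb).trans_lt (by linarith [mul_pos hδ hε])) hb
  simp only [derivative_zero, eval_zero, zero_mul, derivative_one, mul_zero, sub_zero,
    zero_div] at this
  refine this.trans (le_of_eq ?_)
  field_simp

/-- A function vanishing at the centre is divisible by the coordinate. -/
theorem UnifRational.exists_mul (hε : 0 < ε) (hf : UnifRational a ε f) (h0 : f a = 0) {M : ℝ}
    (hM : ∀ b, ‖b - a‖ < ε → ‖f b‖ ≤ M) : ∃ f' : k → k, UnifRational a ε f' ∧
      (∀ b, f b = (b - a) * f' b) ∧ ∀ b, ‖b - a‖ < ε → ‖f' b‖ ≤ 2 / ε * M := by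
  have haa : ‖a - a‖ < ε := by simpa using hε
  have hM0 : 0 ≤ M := (norm_nonneg _).trans (hM a haa)
  classical
  refine ⟨fun b => if b = a then _root_.deriv f a else f b / (b - a), fun η hη => ?_,
    fun b => ?_, fun b hb => ?_⟩
  · obtain ⟨g, h, hh, H⟩ := hf (η * ε / 4) (by positivity)
    have hha := hh a haa
    have hdvd : (X - C a) ∣ g - C (g.eval a / h.eval a) * h := dvd_iff_isRoot.2 (by
      simp only [IsRoot, eval_sub, eval_mul, eval_C]
      field_simp
      ring)
    obtain ⟨N, hN⟩ := hdvd
    have hNe : ∀ b, (b - a) * N.eval b = g.eval b - g.eval a / h.eval a * h.eval b := by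
      intro b
      have := congrArg (Polynomial.eval b) hN
      simpa using this.symm
    have e : 2 * (η * ε / 4) / ε = η / 2 := by field_simp; norm_num
    refine ⟨N, h, hh, fun b hb => ?_⟩
    have hhb := hh b hb
    dsimp only
    by_cases hba : b = a
    · subst hba
      have h1 := hf.norm_deriv_sub_le hε hh H hb
      rw [e] at h1
      have h2 : N.eval b = g.derivative.eval b - g.eval b / h.eval b * h.derivative.eval b := by
        have := congrArg (fun P => P.derivative.eval b) hN
        simpa using this.symm
      have h3 : N.eval b / h.eval b =
          (g.derivative.eval b * h.eval b - g.eval b * h.derivative.eval b) / h.eval b ^ 2 := by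
        rw [h2]; field_simp
      rw [if_pos rfl, h3]
      exact h1.trans_lt (by linarith)
    · have hba' : b - a ≠ 0 := sub_ne_zero.2 hba
      have h1 := hf.lipschitz hε hh H hb
      rw [e, h0, sub_zero] at h1
      have h2 : f b / (b - a) - N.eval b / h.eval b =
          (f b - (g.eval b / h.eval b - g.eval a / h.eval a)) / (b - a) := by
        have := hNe b
        field_simp at this ⊢
        linear_combination -this
      rw [if_neg hba, h2, norm_div, div_lt_iff₀ (norm_pos_iff.2 hba')]
      refine h1.trans_lt (mul_lt_mul_of_pos_right (by linarith) (norm_pos_iff.2 hba'))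
  · dsimp only
    split_ifs with h
    · rw [h, h0, sub_self, zero_mul]
    · rw [mul_div_cancel₀ _ (sub_ne_zero.2 h)]
  · dsimp only
    split_ifs with h
    · exact hf.norm_deriv_le hε hM haa
    · rw [norm_div, div_le_iff₀ (norm_pos_iff.2 (sub_ne_zero.2 h))]
      refine le_of_forall_pos_le_add fun δ hδ => ?_
      have := hf.lipschitz hε (g := 0) (h := 1) (η := M + δ / 2) (by simp)
        (fun b hb => by simpa using (hM b hb).trans_lt (by linarith)) hb
      simp only [eval_zero, zero_div, sub_self, sub_zero, h0] at this
      refine this.trans ?_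
      have h2 : δ / ε * ‖b - a‖ ≤ δ := by
        rw [div_mul_eq_mul_div, div_le_iff₀ hε]
        exact mul_le_mul_of_nonneg_left hb.le hδ.le
      have h3 : 2 * (M + δ / 2) / ε * ‖b - a‖ = 2 / ε * M * ‖b - a‖ + δ / ε * ‖b - a‖ := by
        ring
      linarith

end Uniform

/-! ### Linear differential systems on a disc -/

section Factorial

/-- In characteristic `0` the factorials decrease at most geometrically: if the residue
characteristic is `p`, then `|n!| = |p|^v` for some `v ≤ n`, and otherwise `|n!| = 1`. -/
theorem exists_norm_inv_factorial_le (k : Type u) [NontriviallyNormedField k]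
    [IsUltrametricDist k] [CharZero k] :
    ∃ C : ℝ, 0 < C ∧ ∀ n : ℕ, ‖((n.factorial : k))⁻¹‖ ≤ C ^ n := by
  by_cases H : ∀ p : ℕ, p.Prime → ‖(p : k)‖ = 1
  · refine ⟨1, one_pos, fun n => ?_⟩
    have key : ∀ m : ℕ, m ≠ 0 → ‖(m : k)‖ = 1 := by
      intro m
      induction m using Nat.recOnMul with
      | zero => simp
      | one => simp
      | prime p hp => exact fun _ => H p hp
      | mul a b ha hb =>
        intro hab
        rw [Nat.cast_mul, norm_mul, ha (left_ne_zero_of_mul hab), hb (right_ne_zero_of_mul hab),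
          one_mul]
    rw [norm_inv, key _ n.factorial_ne_zero]
    simp
  · push Not at H
    obtain ⟨p, hp, hp1⟩ := H
    have hlt : ‖(p : k)‖ < 1 := lt_of_le_of_ne (IsUltrametricDist.norm_natCast_le_one k p) hp1
    have hp0 : 0 < ‖(p : k)‖ := norm_pos_iff.2 (Nat.cast_ne_zero.2 hp.ne_zero)
    have cop : ∀ q : ℕ, ¬ p ∣ q → ‖(q : k)‖ = 1 := by
      intro q hq
      refine le_antisymm (IsUltrametricDist.norm_natCast_le_one k q) (not_lt.1 fun hq1 => ?_)
      have hb := Nat.gcd_eq_gcd_ab p q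
      rw [(hp.coprime_iff_not_dvd.2 hq).gcd_eq_one] at hb
      have hb' : (1 : k) = p * ((p.gcdA q : ℤ) : k) + q * ((p.gcdB q : ℤ) : k) := by
        exact_mod_cast congrArg (Int.cast : ℤ → k) hb
      have h1 := IsUltrametricDist.norm_add_le_max ((p : k) * ((p.gcdA q : ℤ) : k))
        ((q : k) * ((p.gcdB q : ℤ) : k))
      rw [← hb', norm_one, norm_mul, norm_mul] at h1
      have h2 := IsUltrametricDist.norm_intCast_le_one k (p.gcdA q)
      have h3 := IsUltrametricDist.norm_intCast_le_one k (p.gcdB q)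
      refine absurd h1 (not_le.2 (max_lt ?_ ?_))
      · exact (mul_le_of_le_one_right (norm_nonneg _) h2).trans_lt hlt
      · exact (mul_le_of_le_one_right (norm_nonneg _) h3).trans_lt hq1
    refine ⟨‖(p : k)‖⁻¹, by positivity, fun n => ?_⟩
    have : Fact p.Prime := ⟨hp⟩
    obtain ⟨m, q, hq, e⟩ := Nat.exists_eq_pow_mul_and_not_dvd n.factorial_ne_zero p hp.ne_one
    have hmn : m ≤ n := by
      refine le_trans ?_ (padicValNat_factorial_le p n)
      exact (padicValNat_dvd_iff_le n.factorial_ne_zero).1 (Dvd.intro _ e.symm)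
    rw [e, Nat.cast_mul, Nat.cast_pow, norm_inv, norm_mul, norm_pow, cop q hq, mul_one,
      ← inv_pow]
    exact pow_le_pow_right₀ ((one_le_inv₀ hp0).2 hlt.le) hmn

end Factorial

section ODE

variable {k : Type u} [NontriviallyNormedField k] {a : k} {ε : ℝ} {n : ℕ}
  {G : Fin n → Fin n → k → k}

/-- The coefficient `(-1)^m (b - a)^m / m!` of the Taylor formula. -/
def taylorCoeff (a : k) (m : ℕ) (b : k) : k := (-(b - a)) ^ m * ((m.factorial : k))⁻¹

theorem taylorCoeff_unifRational (m : ℕ) : UnifRational a ε (taylorCoeff a m) :=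
  (UnifRational.eval ((-(X - C a)) ^ m * C ((m.factorial : k))⁻¹)).congr fun b _ => by
    simp [taylorCoeff]

theorem hasDerivAt_taylorCoeff_zero (b : k) : HasDerivAt (taylorCoeff a 0) 0 b := by
  have : taylorCoeff a 0 = fun _ => 1 := funext fun b => by simp [taylorCoeff]
  rw [this]
  exact hasDerivAt_const b 1

theorem hasDerivAt_taylorCoeff_succ [CharZero k] (m : ℕ) (b : k) :
    HasDerivAt (taylorCoeff a (m + 1)) (-taylorCoeff a m b) b := by
  have h := ((((hasDerivAt_id b).sub_const a).neg).pow (m + 1)).mul_const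
    (((m + 1).factorial : k))⁻¹
  have h0 : ((m : k) + 1) ≠ 0 := by exact_mod_cast m.succ_ne_zero
  have h1 : (m.factorial : k) ≠ 0 := Nat.cast_ne_zero.2 m.factorial_ne_zero
  refine (h.congr_deriv ?_)
  simp only [taylorCoeff, Nat.factorial_succ, Nat.cast_mul, Nat.add_sub_cancel, id,
    Pi.neg_apply, Nat.cast_add, Nat.cast_one]
  field_simp

variable [IsUltrametricDist k] [IsAlgClosed k]

theorem UnifRational.exists_bound {ι : Type*} [Finite ι] (hε : 0 < ε) {F : ι → k → k}
    (hF : ∀ i, UnifRational a ε (F i)) : ∃ M : ℝ, 0 < M ∧ ∀ i b, ‖b - a‖ < ε → ‖F i b‖ ≤ M := by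
  have := Fintype.ofFinite ι
  choose M hM H using fun i => (hF i).bounded hε
  refine ⟨1 + ∑ i, M i, ?_, fun i b hb => (H i b hb).trans ?_⟩
  · have := Finset.sum_nonneg fun i (_ : i ∈ Finset.univ) => (hM i).le
    linarith
  · have := Finset.single_le_sum (fun i _ => (hM i).le) (Finset.mem_univ i)
    linarith

variable [CompleteSpace k]

/-- The coordinates of the iterated derivatives `∇^m e` of a section `e`, where the connection is
`v ↦ v' + G v` in coordinates. -/
def iterConn (G : Fin n → Fin n → k → k) (v : Fin n → k → k) : ℕ → Fin n → k → k
  | 0 => v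
  | m + 1 => fun i b => deriv (iterConn G v m i) b + ∑ l, G i l b * iterConn G v m l b

theorem iterConn_unifRational (hε : 0 < ε) (hG : ∀ i j, UnifRational a ε (G i j))
    {v : Fin n → k → k} (hv : ∀ i, UnifRational a ε (v i)) (m : ℕ) (i : Fin n) :
    UnifRational a ε (iterConn G v m i) := by
  induction m generalizing i with
  | zero => exact hv i
  | succ m ih =>
    exact ((ih i).deriv hε).add (UnifRational.sum _ fun l _ => (hG i l).mul hε (ih l))

theorem norm_conn_le (hε : 0 < ε) {M : ℝ} (hM : ∀ i j b, ‖b - a‖ < ε → ‖G i j b‖ ≤ M)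
    {v : Fin n → k → k} (hv : ∀ i, UnifRational a ε (v i)) {A : ℝ}
    (hA : ∀ i b, ‖b - a‖ < ε → ‖v i b‖ ≤ A) (i : Fin n) {b : k} (hb : ‖b - a‖ < ε) :
    ‖deriv (v i) b + ∑ l, G i l b * v l b‖ ≤ (2 / ε + n * M) * A := by
  refine (norm_add_le _ _).trans ?_
  rw [add_mul]
  refine add_le_add ((hv i).norm_deriv_le hε (hA i) hb) ((norm_sum_le _ _).trans ?_)
  have : ∀ l ∈ Finset.univ, ‖G i l b * v l b‖ ≤ M * A := fun l _ => by
    rw [norm_mul]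
    exact mul_le_mul (hM i l b hb) (hA l b hb) (norm_nonneg _)
      ((norm_nonneg _).trans (hM i l b hb))
  refine (Finset.sum_le_sum this).trans (le_of_eq ?_)
  simp [mul_assoc]

variable [CharZero k]

/-- A solution of `f' + G f = 0` vanishing at the centre of a disc vanishes near the centre: it is
divisible by every power of the coordinate. -/
theorem ode_unique (hε : 0 < ε) (hG : ∀ i j, UnifRational a ε (G i j)) {f : Fin n → k → k}
    (hf : ∀ i, UnifRational a ε (f i))
    (hode : ∀ i b, ‖b - a‖ < ε → deriv (f i) b + ∑ j, G i j b * f j b = 0)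
    (h0 : ∀ i, f i a = 0) (i : Fin n) {b : k} (hb : ‖b - a‖ < ε / 2) : f i b = 0 := by
  have haa : ‖a - a‖ < ε := by simpa using hε
  obtain ⟨M, hM, HM⟩ := UnifRational.exists_bound hε hf
  have key : ∀ m : ℕ, ∃ F : Fin n → k → k, (∀ i, UnifRational a ε (F i)) ∧
      (∀ i b, f i b = (b - a) ^ m * F i b) ∧
      ∀ i b, ‖b - a‖ < ε → ‖F i b‖ ≤ (2 / ε) ^ m * M := by
    intro m
    induction m with
    | zero => exact ⟨f, hf, by simp, by simpa using HM⟩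
    | succ m ih =>
      obtain ⟨F, hF, hfF, hFM⟩ := ih
      have hF0 : ∀ i, F i a = 0 := by
        intro i
        rcases Nat.eq_zero_or_pos m with rfl | hm
        · have := hfF i a
          rwa [h0, pow_zero, one_mul, eq_comm] at this
        set Φ : k → k := fun b => (m : k) * F i b + (b - a) * (deriv (F i) b +
          ∑ j, G i j b * F j b) with hΦ
        have hsub : UnifRational a ε fun b => b - a :=
          (UnifRational.eval (X - C a)).congr fun b _ => by simp
        have hΦu : UnifRational a ε Φ := ((UnifRational.const _).mul hε (hF i)).add
          (hsub.mul hε (((hF i).deriv hε).add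
            (UnifRational.sum _ fun j _ => (hG i j).mul hε (hF j))))
        have hΦ0 : ∀ᶠ b in 𝓝[≠] a, Φ b = 0 := by
          filter_upwards [self_mem_nhdsWithin,
            nhdsWithin_le_nhds (Metric.ball_mem_nhds a hε)] with b hba hb
          rw [Metric.mem_ball, dist_eq_norm] at hb
          have hba' : b - a ≠ 0 := sub_ne_zero.2 hba
          have h1 : deriv (f i) b = m * (b - a) ^ (m - 1) * F i b +
              (b - a) ^ m * deriv (F i) b := by
            rw [show f i = fun b => (b - a) ^ m * F i b from funext (hfF i)]
            have := (((hasDerivAt_id b).sub_const a).pow m).mul ((hF i).hasDerivAt hε hb)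
            simp only [id, mul_one] at this
            exact this.deriv
          have h2 := hode i b hb
          simp only [hfF _ b, h1] at h2
          have h3 : ∑ j, G i j b * ((b - a) ^ m * F j b) =
              (b - a) ^ m * ∑ j, G i j b * F j b := by
            rw [Finset.mul_sum]; exact Finset.sum_congr rfl fun j _ => by ring
          have h4 : (b - a) ^ m = (b - a) ^ (m - 1) * (b - a) := by
            rw [← pow_succ, Nat.sub_add_cancel hm]
          rw [h3, h4] at h2
          refine (mul_eq_zero.1 (?_ : (b - a) ^ (m - 1) * Φ b = 0)).resolve_left
            (pow_ne_zero _ hba')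
          rw [hΦ, ← h2]
          ring
        have hc : Tendsto Φ (𝓝[≠] a) (𝓝 (Φ a)) :=
          ((hΦu.hasDerivAt hε haa).continuousAt.tendsto).mono_left nhdsWithin_le_nhds
        have h5 : Φ a = 0 := tendsto_nhds_unique (hc.congr' hΦ0) tendsto_const_nhds
        simp only [hΦ, sub_self, zero_mul, add_zero] at h5
        exact (mul_eq_zero.1 h5).resolve_left (Nat.cast_ne_zero.2 hm.ne')
      choose F' hF' h1 h2 using fun i => (hF i).exists_mul hε (hF0 i) (hFM i)
      refine ⟨F', hF', fun i b => ?_, fun i b hb => ?_⟩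
      · rw [hfF, h1, pow_succ]; ring
      · refine (h2 i b hb).trans (le_of_eq ?_)
        rw [pow_succ]; ring
  have hbε : ‖b - a‖ < ε := by linarith
  have hr : ‖b - a‖ * (2 / ε) < 1 := by
    rw [mul_div_assoc', div_lt_one hε]; linarith
  have hlim : Tendsto (fun m => (‖b - a‖ * (2 / ε)) ^ m * M) atTop (𝓝 0) := by
    simpa using (tendsto_pow_atTop_nhds_zero_of_lt_one (by positivity) hr).mul_const M
  refine norm_eq_zero.1 (le_antisymm (ge_of_tendsto' hlim fun m => ?_) (norm_nonneg _))
  obtain ⟨F, -, h1, h2⟩ := key m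
  rw [h1, norm_mul, norm_pow, mul_pow, mul_assoc]
  gcongr
  exact h2 i b hbε

/-- Taylor sums `∑_{m ≤ p} (-1)^m (T - a)^m / m! ∇^m e` are horizontal up to their last term. -/
theorem conn_taylorSum (hε : 0 < ε) (hG : ∀ i j, UnifRational a ε (G i j))
    {v : Fin n → k → k} (hv : ∀ i, UnifRational a ε (v i)) (p : ℕ) (i : Fin n) {b : k}
    (hb : ‖b - a‖ < ε) :
    deriv (fun b => ∑ m ∈ Finset.range (p + 1), taylorCoeff a m b * iterConn G v m i b) b +
      ∑ l, G i l b * ∑ m ∈ Finset.range (p + 1), taylorCoeff a m b * iterConn G v m l b =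
      taylorCoeff a p b * iterConn G v (p + 1) i b := by
  have hd := fun m i => (iterConn_unifRational hε hG hv m i).hasDerivAt hε hb
  have ht := fun m => (taylorCoeff_unifRational (a := a) (ε := ε) m).hasDerivAt hε hb
  have hs : ∀ p, deriv (fun b => ∑ m ∈ Finset.range p, taylorCoeff a m b * iterConn G v m i b) b =
      ∑ m ∈ Finset.range p, (deriv (taylorCoeff a m) b * iterConn G v m i b +
        taylorCoeff a m b * deriv (iterConn G v m i) b) := fun p =>
    (HasDerivAt.fun_sum fun m _ => (ht m).mul (hd m i)).deriv
  rw [hs]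
  simp only [Finset.mul_sum]
  rw [Finset.sum_comm, ← Finset.sum_add_distrib]
  have hterm : ∀ m, deriv (taylorCoeff a m) b * iterConn G v m i b +
      taylorCoeff a m b * deriv (iterConn G v m i) b +
        ∑ l, G i l b * (taylorCoeff a m b * iterConn G v m l b) =
      deriv (taylorCoeff a m) b * iterConn G v m i b +
        taylorCoeff a m b * iterConn G v (m + 1) i b := by
    intro m
    rw [iterConn, mul_add, Finset.mul_sum, add_assoc]
    congr 2
    exact Finset.sum_congr rfl fun l _ => by ring
  simp only [hterm]
  induction p with
  | zero => simp [(hasDerivAt_taylorCoeff_zero b).deriv]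
  | succ p ih =>
    rw [Finset.sum_range_succ, ih, (hasDerivAt_taylorCoeff_succ p b).deriv]
    ring

/-- The `p`-adic Cauchy theorem: on a small disc, the system `f' + G f = 0` has a solution with
any given value at the centre. It is `∑ (-1)^m (T - a)^m / m! ∇^m e`, where `e` has the given
value as constant coordinates. -/
theorem ode_exists (hε : 0 < ε) (hG : ∀ i j, UnifRational a ε (G i j)) :
    ∃ ε' : ℝ, 0 < ε' ∧ ε' ≤ ε ∧ ∀ v : Fin n → k, ∃ f : Fin n → k → k,
      (∀ i, UnifRational a ε' (f i)) ∧ (∀ i, f i a = v i) ∧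
      ∀ i b, ‖b - a‖ < ε' → deriv (f i) b + ∑ j, G i j b * f j b = 0 := by
  obtain ⟨C, hC, HC⟩ := exists_norm_inv_factorial_le k
  obtain ⟨M, hM, HM'⟩ := UnifRational.exists_bound (ι := Fin n × Fin n) hε
    (F := fun q => G q.1 q.2) fun q => hG q.1 q.2
  have HM : ∀ i j b, ‖b - a‖ < ε → ‖G i j b‖ ≤ M := fun i j b hb => HM' (i, j) b hb
  set K : ℝ := 2 / ε + n * M with hK
  have hK0 : 0 < K := by positivity
  refine ⟨min ε (1 / (2 * C * K)), by positivity, min_le_left _ _, fun v => ?_⟩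
  set ε' := min ε (1 / (2 * C * K)) with hε'
  have hε'0 : 0 < ε' := by positivity
  have hεε : ε' ≤ ε := min_le_left _ _
  have hv : ∀ i, UnifRational a ε fun _ : k => v i := fun i => UnifRational.const _
  set w : ℕ → Fin n → k → k := iterConn G fun i _ => v i with hw
  have hwu : ∀ m i, UnifRational a ε (w m i) := iterConn_unifRational hε hG hv
  set B : ℝ := ∑ i, ‖v i‖ with hB
  have hB0 : 0 ≤ B := Finset.sum_nonneg fun _ _ => norm_nonneg _
  have hwK : ∀ m i b, ‖b - a‖ < ε → ‖w m i b‖ ≤ K ^ m * B := by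
    intro m
    induction m with
    | zero =>
      intro i b _
      simpa [hw, iterConn] using
        Finset.single_le_sum (fun i _ => norm_nonneg (v i)) (Finset.mem_univ i)
    | succ m ih =>
      intro i b hb
      rw [pow_succ', mul_assoc]
      exact norm_conn_le hε HM (hwu m) ih i hb
  have hterm : ∀ m b, ‖b - a‖ < ε' → ‖taylorCoeff a m b‖ * K ^ m ≤ (1 / 2) ^ m := by
    intro m b hb
    have h1 : ‖b - a‖ * C * K ≤ 1 / 2 := by
      have := (hb.trans_le (min_le_right _ _)).le
      rw [le_div_iff₀ (by positivity)] at this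
      linarith
    rw [taylorCoeff, norm_mul, norm_pow, norm_neg]
    calc ‖b - a‖ ^ m * ‖((m.factorial : k))⁻¹‖ * K ^ m ≤ ‖b - a‖ ^ m * C ^ m * K ^ m := by
          gcongr; exact HC m
      _ = (‖b - a‖ * C * K) ^ m := by rw [mul_pow, mul_pow]
      _ ≤ (1 / 2) ^ m := by gcongr
  set S : ℕ → Fin n → k → k := fun p i b =>
    ∑ m ∈ Finset.range p, taylorCoeff a m b * w m i b with hS
  have hSu : ∀ p i, UnifRational a ε (S p i) := fun p i =>
    UnifRational.sum _ fun m _ => (taylorCoeff_unifRational m).mul hε (hwu m i)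
  have hstep : ∀ i b, ‖b - a‖ < ε' → ∀ p, dist (S p i b) (S (p + 1) i b) ≤ B * (1 / 2) ^ p := by
    intro i b hb p
    rw [dist_comm, dist_eq_norm]
    simp only [hS]
    rw [Finset.sum_range_succ, add_sub_cancel_left, norm_mul]
    calc _ ≤ ‖taylorCoeff a p b‖ * (K ^ p * B) := by gcongr; exact hwK p i b (hb.trans_le hεε)
      _ = (‖taylorCoeff a p b‖ * K ^ p) * B := by ring
      _ ≤ (1 / 2) ^ p * B := by gcongr; exact hterm p b hb
      _ = _ := mul_comm _ _
  have hlim : ∀ i b, ∃ y, ‖b - a‖ < ε' → Tendsto (fun p => S p i b) atTop (𝓝 y) := by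
    intro i b
    by_cases hb : ‖b - a‖ < ε'
    · obtain ⟨y, hy⟩ := cauchySeq_tendsto_of_complete
        (cauchySeq_of_le_geometric _ _ (by norm_num) (hstep i b hb))
      exact ⟨y, fun _ => hy⟩
    · exact ⟨0, fun h => absurd h hb⟩
  choose f hf using hlim
  have hdist : ∀ p i b, ‖b - a‖ < ε' → ‖f i b - S p i b‖ ≤ 2 * B * (1 / 2) ^ p := by
    intro p i b hb
    have := dist_le_of_le_geometric_of_tendsto _ _ (by norm_num) (hstep i b hb) (hf i b hb) p
    rw [dist_comm, dist_eq_norm] at this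
    refine this.trans (le_of_eq ?_)
    ring
  have hgeo : ∀ A : ℝ, Tendsto (fun p : ℕ => A * (1 / 2 : ℝ) ^ p) atTop (𝓝 0) := fun A => by
    simpa using (tendsto_pow_atTop_nhds_zero_of_lt_one (by norm_num : (0 : ℝ) ≤ 1 / 2)
      (by norm_num)).const_mul A
  have hfu : ∀ i, UnifRational a ε' (f i) := fun i => UnifRational.of_approx fun η hη => by
    obtain ⟨p, hp⟩ := ((hgeo (2 * B)).eventually_lt_const hη).exists
    exact ⟨S p i, (hSu p i).mono hεε, fun b hb => (hdist p i b hb).trans_lt hp⟩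
  have haa : ‖a - a‖ < ε' := by simpa using hε'0
  refine ⟨f, hfu, fun i => ?_, fun i b hb => ?_⟩
  · refine tendsto_nhds_unique (hf i a haa) (tendsto_const_nhds.congr' ?_)
    filter_upwards [eventually_ge_atTop 1] with p hp
    obtain ⟨q, rfl⟩ := Nat.exists_eq_add_of_le hp
    simp only [hS]
    rw [add_comm, Finset.sum_range_succ', Finset.sum_eq_zero fun m _ => by simp [taylorCoeff]]
    simp [taylorCoeff, hw, iterConn]
  · set K' : ℝ := 2 / ε' + n * M with hK'
    refine norm_eq_zero.1 (le_antisymm (ge_of_tendsto' (hgeo (B * K + K' * B)) fun p => ?_)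
      (norm_nonneg _))
    have hbε := hb.trans_le hεε
    have hEu : ∀ i, UnifRational a ε' fun b => f i b - S (p + 1) i b := fun i => by
      simpa [sub_eq_add_neg] using
        (hfu i).add ((UnifRational.const (-1)).mul hε'0 ((hSu (p + 1) i).mono hεε))
    have h1 := conn_taylorSum hε hG hv p i hbε
    have h2 := norm_conn_le hε'0 (fun i j b hb => HM i j b (hb.trans_le hεε)) hEu
      (fun i b hb => hdist (p + 1) i b hb) i hb
    have h3 : ‖taylorCoeff a p b * w (p + 1) i b‖ ≤ B * K * (1 / 2) ^ p := by
      rw [norm_mul]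
      calc _ ≤ ‖taylorCoeff a p b‖ * (K ^ (p + 1) * B) := by gcongr; exact hwK _ i b hbε
        _ = (‖taylorCoeff a p b‖ * K ^ p) * (B * K) := by ring
        _ ≤ (1 / 2) ^ p * (B * K) := by gcongr; exact hterm p b hb
        _ = _ := mul_comm _ _
    have h4 : deriv (fun b => f i b - S (p + 1) i b) b = deriv (f i) b - deriv (S (p + 1) i) b :=
      (((hfu i).hasDerivAt hε'0 hb).sub ((hSu (p + 1) i).hasDerivAt hε hbε)).deriv
    have h5 : deriv (f i) b + ∑ j, G i j b * f j b =
        (deriv (fun b => f i b - S (p + 1) i b) b + ∑ l, G i l b * (f l b - S (p + 1) l b)) +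
          taylorCoeff a p b * w (p + 1) i b := by
      rw [h4, ← h1]
      simp only [mul_sub, Finset.sum_sub_distrib]
      ring
    rw [h5]
    refine (norm_add_le _ _).trans ?_
    rw [pow_succ] at h2
    linarith

end ODE

/-! ### Small discs around rational points -/

section Discs

variable {k : Type u} [NontriviallyNormedField k] {D : Disc k}

theorem Disc.sub_mono (a : k) {s t : ℝ} (h : s ≤ t) : D.sub a s ≤ D.sub a t := fun y hy =>
  (show y.1.1 (X - C a) < s * D.radius from hy).trans_le
    (mul_le_mul_of_nonneg_right h D.radius_pos.le)

theorem norm_lt_of_mem_rat_sub {a b : k} {s : ℝ} (hb : b ∈ rat (D.sub a s)) :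
    ‖b - a‖ < s * D.radius := by
  obtain ⟨y, hy, e⟩ := hb
  have : y.1.1 (X - C a) < s * D.radius := hy
  rw [e, pt_apply] at this
  simpa using this

theorem exists_seminorm_le (P : k[X]) (R : ℝ) :
    ∃ K : ℝ, ∀ y : Line k, y.1 X ≤ R → y.1 P ≤ K := by
  induction P using Polynomial.induction_on' with
  | add P Q hP hQ =>
    obtain ⟨K, hK⟩ := hP
    obtain ⟨L, hL⟩ := hQ
    exact ⟨K + L, fun y hy => (map_add_le_add y.1 P Q).trans (add_le_add (hK y hy) (hL y hy))⟩
  | monomial n c =>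
    refine ⟨‖c‖ * R ^ n, fun y hy => ?_⟩
    rw [← C_mul_X_pow_eq_monomial, map_mul, map_pow, y.2]
    have := apply_nonneg y.1 X
    gcongr

/-- The discs around a rational point form a basis of its neighbourhoods. -/
theorem eventually_sub_le {U : Opens D.Pt} {a : k} (ha : a ∈ rat U) :
    ∀ᶠ s in 𝓝[>] (0 : ℝ), D.sub a s ≤ U := by
  obtain ⟨z, hz, ez⟩ := ha
  set Λ : Filter D.Pt := comap (fun y : D.Pt => y.1.1 (X - C a)) (𝓝 0) with hΛ
  have h0 : Tendsto (fun y : D.Pt => y.1.1 (X - C a)) Λ (𝓝 0) := tendsto_comap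
  have hbd : ∀ᶠ y in Λ, y.1.1 X ≤ 1 + ‖a‖ := by
    filter_upwards [h0.eventually_lt_const one_pos] with y hy
    have h1 := map_add_le_add y.1.1 (X - C a) (C a)
    rw [sub_add_cancel, y.1.2] at h1
    linarith
  have hlim : Tendsto (fun y : D.Pt => y) Λ (𝓝 z) := by
    have hind : IsInducing fun y : D.Pt => fun P : k[X] => y.1.1 P :=
      line_isInducing.comp IsInducing.subtypeVal
    rw [hind.tendsto_nhds_iff, tendsto_pi_nhds]
    intro P
    obtain ⟨Q, hQ⟩ : (X - C a) ∣ P - C (P.eval a) :=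
      dvd_iff_isRoot.2 (by simp [IsRoot])
    obtain ⟨K, hK⟩ := exists_seminorm_le Q (1 + ‖a‖)
    have hz' : z.1.1 P = ‖P.eval a‖ := by rw [ez, pt_apply]
    rw [hz', tendsto_iff_norm_sub_tendsto_zero]
    have hb : Tendsto (fun y : D.Pt => y.1.1 (X - C a) * K) Λ (𝓝 0) := by
      simpa using h0.mul_const K
    refine squeeze_zero' (Eventually.of_forall fun _ => norm_nonneg _) ?_ hb
    filter_upwards [hbd] with y hy
    have h1 : y.1.1 (C (P.eval a)) = ‖P.eval a‖ := y.1.2 _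
    have h2 : |y.1.1 P - y.1.1 (C (P.eval a))| ≤ y.1.1 (P - C (P.eval a)) :=
      abs_sub_map_le_sub _ _ _
    rw [hQ, map_mul, h1] at h2
    exact h2.trans (mul_le_mul_of_nonneg_left (hK _ hy) (apply_nonneg _ _))
  have hU : {y : D.Pt | y ∈ U} ∈ Λ := hlim (U.isOpen.mem_nhds hz)
  obtain ⟨A, hA, hAU⟩ := mem_comap.1 hU
  obtain ⟨δ, hδ, hδA⟩ := Metric.mem_nhds_iff.1 hA
  have hs : ∀ᶠ s in 𝓝[>] (0 : ℝ), s * D.radius < δ := by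
    refine nhdsWithin_le_nhds (Tendsto.eventually_lt_const hδ ?_)
    simpa using (tendsto_id (α := ℝ) (x := 𝓝 0)).mul_const D.radius
  filter_upwards [hs] with s hs y hy
  refine hAU (hδA ?_)
  rw [mem_ball_zero_iff, Real.norm_of_nonneg (apply_nonneg _ _)]
  exact (show y.1.1 (X - C a) < s * D.radius from hy).trans hs

variable [IsUltrametricDist k]

theorem norm_lt_radius {a b : k} (ha : ‖a - D.center‖ < D.radius) {s : ℝ} (hs : s ≤ 1)
    (hb : ‖b - a‖ < s * D.radius) : ‖b - D.center‖ < D.radius :=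
  (norm_sub_lt_iff ha).1 (hb.trans_le (mul_le_of_le_one_left D.radius_pos.le hs))

theorem mem_rat_sub {a b : k} (ha : ‖a - D.center‖ < D.radius) {s : ℝ} (hs : s ≤ 1)
    (hb : ‖b - a‖ < s * D.radius) : b ∈ rat (D.sub a s) := by
  refine ⟨⟨pt b, pt_mem (norm_lt_radius ha hs hb)⟩, ?_, rfl⟩
  change (pt b).1 (X - C a) < s * D.radius
  simpa [pt_apply] using hb

theorem mem_rat_sub_self (hx : ‖x - D.center‖ < D.radius) {s : ℝ} (hs0 : 0 < s) (hs : s ≤ 1) :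
    x ∈ rat (D.sub x s) :=
  mem_rat_sub hx hs (by simpa using mul_pos hs0 D.radius_pos)

/-- An analytic function is a uniform limit of rational functions on small discs. -/
theorem eventually_unifRational {U : Opens D.Pt} (f : O U) {a : k} (ha : a ∈ rat U) :
    ∀ᶠ s in 𝓝[>] (0 : ℝ), UnifRational a (s * D.radius) (ext0 f.1) := by
  obtain ⟨y, hy, e⟩ := id ha
  obtain ⟨V, hV, hVU, HV⟩ := f.2 y hy
  filter_upwards [eventually_sub_le (U := V) ⟨y, hV, e⟩, nhdsWithin_le_nhds
    (eventually_lt_nhds one_pos)] with s hs hs1 η hη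
  obtain ⟨g, h, hh, H⟩ := HV η hη
  have hb : ∀ b, ‖b - a‖ < s * D.radius → b ∈ rat V := fun b hb =>
    rat_mono hs (mem_rat_sub (rat_norm ha) hs1.le hb)
  refine ⟨g, h, fun b h1 => eval_ne_zero hh (hb b h1), fun b h1 => ?_⟩
  rw [ext0_apply f.1 ⟨b, rat_mono hVU (hb b h1)⟩]
  exact H ⟨b, rat_mono hVU (hb b h1)⟩ (hb b h1)

/-- The element of `𝒪(D(a, s⁻))` given by a uniform limit of rational functions. -/
def UnifRational.toO [IsAlgClosed k] {a : k} {s : ℝ} {f : k → k}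
    (hf : UnifRational a (s * D.radius) f) : O (D.sub a s) :=
  ⟨fun b => f b.1, hf.isAnalytic (fun _ hy => hy) fun _ hb => norm_lt_of_mem_rat_sub hb⟩

theorem ddT_toO [IsAlgClosed k] [CompleteSpace k] {a : k} {s : ℝ} {f : k → k}
    (hf : UnifRational a (s * D.radius) f) (b : rat (D.sub a s)) :
    (ddT (D.sub a s) (UnifRational.toO hf)).1 b = deriv f b.1 := by
  refine Filter.EventuallyEq.deriv_eq ?_
  filter_upwards [(isOpen_rat (D.sub a s)).mem_nhds b.2] with c hc
  exact ext0_apply (UnifRational.toO hf).1 ⟨c, hc⟩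

end Discs

/-! ### The identity principle for sections of locally free sheaves -/

section SheafIdentity

variable {k : Type u} [NontriviallyNormedField k] {D : Disc k} {E : ModSheaf.{u, v} D}
  {r : ℕ} {U V : Opens D.Pt}

/-- The germ of the section `e` at the rational point `b` is zero. -/
def GermZero (E : ModSheaf.{u, v} D) {U : Opens D.Pt} (e : E.Sec U) (b : k) : Prop :=
  ∃ (V : Opens D.Pt) (h : V ≤ U), b ∈ rat V ∧ E.res h e = 0

theorem GermZero.apply_eq_zero {w : Fin r → E.Sec V} (hw : E.IsBasisOn V w) (h : V ≤ U)
    {e : E.Sec U} {c : Fin r → O V} (hc : E.res h e = ∑ i, c i • w i) {b : k} (hb : b ∈ rat V)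
    (he : GermZero E e b) (i : Fin r) : ext0 (c i).1 b = 0 := by
  obtain ⟨W, hW, hbW, h0⟩ := he
  have h1 : E.res (inf_le_left : V ⊓ W ≤ V) (E.res h e) = 0 := by
    rw [E.res_comp, ← E.res_comp hW inf_le_right, h0, map_zero]
  rw [hc, map_sum] at h1
  simp only [E.res_smul] at h1
  have h2 := (hw (V ⊓ W) inf_le_left 0).unique h1.symm (y₂ := 0) (by simp)
  have h3 := congrFun (congrArg Subtype.val (congrFun h2 i)) ⟨b, mem_rat_inf hb hbW⟩
  rw [ext0_apply (c i).1 ⟨b, hb⟩]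
  exact h3

/-- A local basis and the coordinates of a section in this basis. -/
theorem ModSheaf.IsLocallyFree.exists_coords (hE : E.IsLocallyFree r) (e : E.Sec U) {y : D.Pt}
    (hy : y ∈ U) : ∃ (V : Opens D.Pt) (h : V ≤ U) (w : Fin r → E.Sec V) (c : Fin r → O V),
      y ∈ V ∧ E.IsBasisOn V w ∧ E.res h e = ∑ i, c i • w i := by
  obtain ⟨V, hyV, w, hw⟩ := hE y
  have hw' := hw.mono (inf_le_left : V ⊓ U ≤ V)
  obtain ⟨c, hc, -⟩ := hw' _ le_rfl (E.res inf_le_right e)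
  refine ⟨V ⊓ U, inf_le_right, _, c, ⟨hyV, hy⟩, hw', ?_⟩
  simpa only [E.res_id] using hc

theorem eq_zero_of_germZero (hE : E.IsLocallyFree r) {e : E.Sec U}
    (H : ∀ b ∈ rat U, GermZero E e b) : e = 0 := by
  choose V h w c hyV hw hc using fun y : {y : D.Pt // y ∈ U} => hE.exists_coords e y.2
  refine E.eq_of_res V U h (fun y hy => Opens.mem_iSup.2 ⟨⟨y, hy⟩, hyV _⟩) fun y => ?_
  rw [map_zero, hc]
  refine Finset.sum_eq_zero fun i _ => ?_
  have : c y i = 0 := Subtype.ext <| funext fun a => by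
    have := (H a.1 (rat_mono (h y) a.2)).apply_eq_zero (hw y) (h y) (hc y) a.2 i
    rwa [ext0_apply] at this
  rw [this, zero_smul]

variable [IsUltrametricDist k]

theorem germZero_of_eventually (h : V ≤ U) {w : Fin r → E.Sec V}
    {e : E.Sec U} {c : Fin r → O V} (hc : E.res h e = ∑ i, c i • w i) {b : k} (hb : b ∈ rat V)
    (H : ∀ᶠ a in 𝓝 b, ∀ i, ext0 (c i).1 a = 0) : GermZero E e b := by
  obtain ⟨δ, hδ, hδH⟩ := Metric.eventually_nhds_iff.1 H
  have hs : ∀ᶠ s in 𝓝[>] (0 : ℝ), s * D.radius < δ := by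
    refine nhdsWithin_le_nhds (Tendsto.eventually_lt_const hδ ?_)
    simpa using (tendsto_id (α := ℝ) (x := 𝓝 0)).mul_const D.radius
  obtain ⟨s, hsV, hs1, hs2, hs0⟩ := ((eventually_sub_le hb).and (hs.and
    ((eventually_nhdsWithin_of_eventually_nhds (eventually_lt_nhds one_pos)).and
      self_mem_nhdsWithin))).exists
  refine ⟨D.sub b s, hsV.trans h, mem_rat_sub (rat_norm hb) hs2.le ?_, ?_⟩
  · rw [sub_self, norm_zero]; exact mul_pos hs0 D.radius_pos
  · rw [← E.res_comp h hsV, hc, map_sum]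
    refine Finset.sum_eq_zero fun i _ => ?_
    have : resO hsV (c i) = 0 := Subtype.ext <| funext fun a => by
      have h1 := hδH (y := a.1) (by
        rw [dist_eq_norm]; exact (norm_lt_of_mem_rat_sub a.2).trans hs1) i
      rwa [ext0_apply (c i).1 ⟨a.1, rat_mono hsV a.2⟩] at h1
    rw [E.res_smul, this, zero_smul]

theorem isOpen_germZero (e : E.Sec U) : IsOpen {b | GermZero E e b} := by
  refine isOpen_iff_mem_nhds.2 fun b hb => ?_
  obtain ⟨V, h, hbV, h0⟩ := hb
  filter_upwards [(isOpen_rat V).mem_nhds hbV] with a ha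
  exact ⟨V, h, ha, h0⟩

variable [IsAlgClosed k]

/-- A uniform limit of rational functions on a disc is zero if it vanishes near all circles with
the same centre. -/
theorem UnifRational.eq_zero {a : k} {ε : ℝ} {f : k → k} (hf : UnifRational a ε f)
    (H : ∀ t, 0 < t → t < ε → ∀ᶠ b in circ a t, f b = 0) {b : k} (hb : ‖b - a‖ < ε) :
    f b = 0 := by
  obtain ⟨t, hbt, htε⟩ := exists_between hb
  have ht : 0 < t := (norm_nonneg _).trans_lt hbt
  refine norm_eq_zero.1 (le_antisymm (le_of_forall_pos_le_add fun η hη => ?_) (norm_nonneg _))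
  obtain ⟨g, h, hh, Hq⟩ := hf (η / 2) (by positivity)
  have haa : ‖a - a‖ < ε := by simpa using ht.trans htε
  have hball : ∀ᶠ c in circ a t, ‖c - a‖ < ε := eventually_circ_of_nhds (eventually_lt_nhds htε)
  have hht : gaussVal a t h = ‖h.eval a‖ := by
    have := circ_neBot a ht
    refine tendsto_nhds_unique (tendsto_norm_eval a t h) (tendsto_const_nhds.congr' ?_)
    filter_upwards [hball] with c hc
    exact (norm_eval_eq h a hh hc).symm
  have h0 : 0 < ‖h.eval a‖ := norm_pos_iff.2 (hh a haa)
  have hQ : gaussVal a t g / gaussVal a t h ≤ η / 2 := by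
    refine gaussVal_div_le a ht g (hht ▸ h0.ne') ?_
    filter_upwards [hball, H t ht htε] with c hc hc0
    have := Hq c hc
    rw [hc0, zero_sub, norm_neg] at this
    exact this.le
  have hq : ‖g.eval b / h.eval b‖ ≤ η / 2 := by
    refine le_trans ?_ hQ
    rw [norm_div, hht, norm_eval_eq h a hh hb]
    gcongr
    exact norm_eval_le_gaussVal hbt.le g
  have h3 := norm_le_norm_sub_add (f b) (g.eval b / h.eval b)
  linarith [Hq b hb]

theorem exists_gaussPt_mem_sub {x a : k} (hx : ‖x - D.center‖ < D.radius) {s t : ℝ}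
    (hs : s ≤ 1) (ha : ‖a - x‖ < s * D.radius) (ht : t < s * D.radius) :
    ∃ y ∈ D.sub x s, y.1 = gaussPt a t := by
  refine ⟨⟨gaussPt a t, ?_⟩, ?_, rfl⟩
  · rw [gaussPt_X_sub_C, norm_sub_rev]
    exact max_lt (norm_lt_radius hx hs ha)
      (ht.trans_le (mul_le_of_le_one_left D.radius_pos.le hs))
  · change (gaussPt a t).1 (X - C x) < s * D.radius
    rw [gaussPt_X_sub_C, norm_sub_rev]
    exact max_lt ha ht

/-- Analytic continuation along the path of Gauss points `η_{a,t}`, `0 < t < s`. -/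
theorem germZero_circ (hE : E.IsLocallyFree r) {x a : k} (hx : ‖x - D.center‖ < D.radius)
    {s : ℝ} (hs : s ≤ 1) (ha : ‖a - x‖ < s * D.radius) {e : E.Sec (D.sub x s)} {t₁ : ℝ}
    (ht₁ : t₁ ∈ Set.Ioo 0 (s * D.radius)) (H : ∀ᶠ b in circ a t₁, GermZero E e b) {t : ℝ}
    (ht : t ∈ Set.Ioo 0 (s * D.radius)) : ∀ᶠ b in circ a t, GermZero E e b := by
  set I := Set.Ioo 0 (s * D.radius) with hI
  set T : Set ℝ := {t | t ∈ I ∧ ∀ᶠ b in circ a t, GermZero E e b} with hT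
  have hTo : IsOpen T := by
    refine isOpen_iff_mem_nhds.2 fun t ht => ?_
    have h1 := eventually_eventually_nhds.2 (eventually_circ.1 ht.2)
    filter_upwards [isOpen_Ioo.mem_nhds ht.1, h1] with u hu hu'
    refine ⟨hu, eventually_circ.2 ?_⟩
    rcases eq_or_ne u t with rfl | hut
    · exact hu'
    · filter_upwards [hu', eventually_ne_nhds hut] with v hv hvt _ b hb
      exact hv hvt b hb
  have hsub : I ⊆ T := by
    refine isPreconnected_Ioo.subset_of_closure_inter_subset hTo ⟨t₁, ht₁, ht₁, H⟩ ?_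
    rintro t₀ ⟨ht₀, hI₀⟩
    refine ⟨hI₀, ?_⟩
    obtain ⟨y, hy, ey⟩ := exists_gaussPt_mem_sub hx hs ha hI₀.2
    obtain ⟨V, h, w, c, hyV, hw, hc⟩ := hE.exists_coords e hy
    have hfreq : ∃ᶠ t in 𝓝 t₀, t ∈ T := mem_closure_iff_frequently.1 ht₀
    have hci : ∀ i, ∀ᶠ b in circ a t₀, ext0 (c i).1 b = 0 := fun i => by
      refine circ_zero_of_frequently (c i) hyV ey hI₀.1 ?_
      refine (hfreq.and_eventually (eventually_gaussPt_mem hyV ey)).mono ?_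
      rintro t ⟨ht, z, hz, ez⟩
      filter_upwards [ht.2, eventually_mem_rat hz ez] with b hb hbV
      exact hb.apply_eq_zero hw h hc hbV i
    have hall := eventually_eventually_nhds.2 (eventually_circ.1 ((eventually_all.2 hci).and
      (eventually_mem_rat hyV ey)))
    refine eventually_circ.2 (hall.mono fun t ht htt b hb => ?_)
    refine germZero_of_eventually h hc (ht.self_of_nhds htt b hb).2 ?_
    have hcont : Tendsto (fun b => ‖b - a‖) (𝓝 b) (𝓝 t) := by
      have : Continuous fun b : k => ‖b - a‖ := by fun_prop
      rw [← hb]; exact this.tendsto b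
    filter_upwards [hcont.eventually ht, hcont.eventually (eventually_ne_nhds htt)] with c h1 h2
    exact (h1 h2 c rfl).1
  exact (hsub ht).2

/-- Identity principle: a section over a disc with zero germ at the centre is zero. Vanishing is
propagated from the centre `x` to a rational point `a` along the path
`x → η_{x,ρ} = η_{a,ρ} → a` of Gauss points, where `|a - x| < ρ`. -/
theorem eq_zero_of_germZero_center (hE : E.IsLocallyFree r) {x : k}
    (hx : ‖x - D.center‖ < D.radius) {s : ℝ} (hs : s ≤ 1) {e : E.Sec (D.sub x s)}
    (H : GermZero E e x) : e = 0 := by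
  refine eq_zero_of_germZero hE fun a haU => ?_
  have ha : ‖a - x‖ < s * D.radius := norm_lt_of_mem_rat_sub haU
  have hsR : 0 < s * D.radius := (norm_nonneg _).trans_lt ha
  obtain ⟨δ, hδ, hδH⟩ := Metric.isOpen_iff.1 (isOpen_germZero e) x H
  obtain ⟨t₁, h1, h1'⟩ := exists_between (lt_min hδ hsR)
  obtain ⟨ρ, h2, h2'⟩ := exists_between ha
  have hρ : ρ ∈ Set.Ioo 0 (s * D.radius) := ⟨(norm_nonneg _).trans_lt h2, h2'⟩
  have hxρ : ∀ᶠ b in circ x ρ, GermZero E e b := by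
    refine germZero_circ hE hx hs (by simpa using hsR)
      ⟨h1, h1'.trans_le (min_le_right _ _)⟩ ?_ hρ
    filter_upwards [eventually_circ_of_nhds
      (eventually_lt_nhds (h1'.trans_le (min_le_left _ _)))] with b hb
    exact hδH (by rwa [Metric.mem_ball, dist_eq_norm])
  have haρ : ∀ᶠ b in circ a ρ, GermZero E e b := by
    refine eventually_circ.2 ?_
    filter_upwards [eventually_circ.1 hxρ, eventually_gt_nhds h2] with t ht hta htρ b hb
    refine ht htρ b ?_
    rw [norm_sub_rev] at hta
    rw [norm_sub_eq_max (a := a) (by rw [hb]; exact hta.ne), hb, max_eq_right hta.le]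
  obtain ⟨y, hy, ey⟩ := id haU
  obtain ⟨V, h, w, c, hyV, hw, hc⟩ := hE.exists_coords e hy
  have haV : a ∈ rat V := ⟨y, hyV, ey⟩
  refine germZero_of_eventually h hc haV (eventually_all.2 fun i => ?_)
  obtain ⟨u, hu, hu', hus, hu0⟩ := ((eventually_unifRational (c i) haV).and
    ((eventually_sub_le haV).and ((eventually_nhdsWithin_of_eventually_nhds
      (eventually_lt_nhds (lt_min one_pos (pos_of_mul_pos_left hsR D.radius_pos.le)))).and
        self_mem_nhdsWithin))).exists
  have huR : 0 < u * D.radius := mul_pos hu0 D.radius_pos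
  filter_upwards [Metric.ball_mem_nhds a huR] with b hb
  rw [Metric.mem_ball, dist_eq_norm] at hb
  refine hu.eq_zero (fun t ht0 ht => ?_) hb
  have hts : t ∈ Set.Ioo 0 (s * D.radius) := ⟨ht0, ht.trans_le
    (mul_le_mul_of_nonneg_right (hus.le.trans (min_le_right _ _)) D.radius_pos.le)⟩
  filter_upwards [germZero_circ hE hx hs ha hρ haρ hts,
    eventually_circ_of_nhds (eventually_lt_nhds ht)] with b hb hbu
  refine hb.apply_eq_zero hw h hc (rat_mono hu' (mem_rat_sub (rat_norm haU) ?_ hbu)) i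
  exact hus.le.trans (min_le_left _ _)

end SheafIdentity

/-! ### Horizontal sections on concentric discs -/

section Coords

variable {k : Type u} [NontriviallyNormedField k] {D : Disc k} {E : ModSheaf.{u, v} D}
  {r : ℕ} {U V W : Opens D.Pt}

/-- Restriction of sections as a `k`-linear map. -/
def ModSheaf.resLin (E : ModSheaf.{u, v} D) (h : V ≤ U) : E.Sec U →ₗ[k] E.Sec V where
  toFun := E.res h
  map_add' := map_add _
  map_smul' c e := E.res_smul h (algebraMap k (O U) c) e

/-- The coordinates of sections in a basis. -/
def ModSheaf.IsBasisOn.coords {w : Fin r → E.Sec V} (hw : E.IsBasisOn V w) :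
    E.Sec V ≃ₗ[k] (Fin r → O V) :=
  (LinearEquiv.ofBijective
    { toFun := fun c : Fin r → O V => ∑ i, c i • w i
      map_add' := fun c c' => by simp only [Pi.add_apply, add_smul, Finset.sum_add_distrib]
      map_smul' := fun a c => by
        simp only [Pi.smul_apply, RingHom.id_apply, Finset.smul_sum, ModSheaf.smul_def,
          smul_smul, Algebra.smul_def] }
    ((Function.bijective_iff_existsUnique _).2 fun m => by
      obtain ⟨c, h1, h2⟩ := hw V le_rfl m
      simp only [E.res_id] at h1 h2
      exact ⟨c, h1.symm, fun c' h => h2 c' h.symm⟩)).symm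

theorem ModSheaf.IsBasisOn.sum_coords {w : Fin r → E.Sec V} (hw : E.IsBasisOn V w)
    (m : E.Sec V) : m = ∑ i, hw.coords m i • w i :=
  (hw.coords.symm_apply_apply m).symm

theorem ModSheaf.IsBasisOn.coords_sum {w : Fin r → E.Sec V} (hw : E.IsBasisOn V w)
    (c : Fin r → O V) : hw.coords (∑ i, c i • w i) = c :=
  hw.coords.apply_symm_apply c

/-- The values at a rational point of the coordinates of a section. -/
def ModSheaf.IsBasisOn.evalAt {w : Fin r → E.Sec V} (hw : E.IsBasisOn V w) {b : k}
    (hb : b ∈ rat V) : E.Sec V →ₗ[k] (Fin r → k) where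
  toFun m i := (hw.coords m i).1 ⟨b, hb⟩
  map_add' m m' := by rw [map_add]; rfl
  map_smul' c m := by rw [map_smul]; rfl

end Coords

section Horizontal

variable {k : Type u} [NontriviallyNormedField k] [IsUltrametricDist k] [IsAlgClosed k]
  [CompleteSpace k] {D : Disc k} {N : ℕ} (F : DiffEq.{u, v} D N) {x : k}

/-- The connection in coordinates: `f ↦ f' + G f`, where `G` is the connection matrix. -/
theorem DiffEq.conn_sum {V W : Opens D.Pt} {w : Fin N → F.sheaf.Sec V}
    {G : Fin N → Fin N → O V} (hG : ∀ j, F.conn V (w j) = ∑ i, G i j • w i) (h : W ≤ V)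
    (c : Fin N → O W) : F.conn W (∑ j, c j • F.sheaf.res h (w j)) =
      ∑ i, (ddT W (c i) + ∑ j, resO h (G i j) * c j) • F.sheaf.res h (w i) := by
  have h1 : ∀ j, F.conn W (F.sheaf.res h (w j)) =
      ∑ i, resO h (G i j) • F.sheaf.res h (w i) := fun j => by
    rw [← F.conn_res, hG, map_sum]
    exact Finset.sum_congr rfl fun i _ => F.sheaf.res_smul h _ _
  simp only [map_sum, F.leibniz, h1, Finset.smul_sum, add_smul, Finset.sum_smul,
    Finset.sum_add_distrib]
  congr 1
  rw [Finset.sum_comm]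
  exact Finset.sum_congr rfl fun i _ => Finset.sum_congr rfl fun j _ => by
    rw [smul_smul, mul_comm]

/-- On a small disc there is a basis such that the entries of the connection matrix are uniform
limits of rational functions. -/
theorem DiffEq.exists_frame (hx : ‖x - D.center‖ < D.radius) :
    ∃ s : ℝ, 0 < s ∧ s < 1 ∧ ∃ (w : Fin N → F.sheaf.Sec (D.sub x s))
      (G : Fin N → Fin N → O (D.sub x s)), F.sheaf.IsBasisOn (D.sub x s) w ∧
      (∀ j, F.conn _ (w j) = ∑ i, G i j • w i) ∧
      ∀ i j, UnifRational x (s * D.radius) (ext0 (G i j).1) := by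
  obtain ⟨V, hyV, w, hw⟩ := F.locallyFree ⟨pt x, pt_mem hx⟩
  have hxV : x ∈ rat V := ⟨_, hyV, rfl⟩
  set G : Fin N → Fin N → O V := fun i j => hw.coords (F.conn V (w j)) i with hG
  have hGw : ∀ j, F.conn V (w j) = ∑ i, G i j • w i := fun j => hw.sum_coords _
  have hev : ∀ᶠ s in 𝓝[>] (0 : ℝ), ∀ i j, UnifRational x (s * D.radius) (ext0 (G i j).1) :=
    eventually_all.2 fun i => eventually_all.2 fun j => eventually_unifRational (G i j) hxV
  obtain ⟨s, h1, h2, h3, h4⟩ := (hev.and ((eventually_sub_le hxV).and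
    ((eventually_nhdsWithin_of_eventually_nhds (eventually_lt_nhds one_pos)).and
      self_mem_nhdsWithin))).exists
  refine ⟨s, h4, h3, fun i => F.sheaf.res h2 (w i), fun i j => resO h2 (G i j), hw.mono h2,
    fun j => ?_, fun i j => (h1 i j).congr fun b hb => ?_⟩
  · rw [← F.conn_res, hGw, map_sum]
    exact Finset.sum_congr rfl fun i _ => F.sheaf.res_smul h2 _ _
  · have hb' := mem_rat_sub hx h3.le hb
    rw [ext0_apply (G i j).1 ⟨b, rat_mono h2 hb'⟩, ext0_apply (resO h2 (G i j)).1 ⟨b, hb'⟩]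
    rfl

/-- Restriction of horizontal sections. -/
def DiffEq.resH0 {U V : Opens D.Pt} (h : V ≤ U) : F.H0 U →ₗ[k] F.H0 V :=
  (F.sheaf.resLin h).restrict fun e he => by
    have h1 : F.conn U e = 0 := he
    change F.conn V (F.sheaf.res h e) = 0
    rw [← F.conn_res, h1, map_zero]

theorem DiffEq.resH0_apply {U V : Opens D.Pt} (h : V ≤ U) (e : F.H0 U) :
    (F.resH0 h e).1 = F.sheaf.res h e.1 := rfl

theorem DiffEq.resH0_injective (hx : ‖x - D.center‖ < D.radius) {s t : ℝ} (hs0 : 0 < s)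
    (hst : s ≤ t) (ht : t ≤ 1) : Function.Injective (F.resH0 (Disc.sub_mono x hst)) := by
  refine (injective_iff_map_eq_zero _).2 fun e he => Subtype.ext ?_
  exact eq_zero_of_germZero_center F.locallyFree hx ht ⟨_, Disc.sub_mono x hst,
    mem_rat_sub_self hx hs0 (hst.trans ht), congrArg Subtype.val he⟩

variable [CharZero k]

/-- A horizontal section over a disc is determined by its value at the centre. -/
theorem DiffEq.evalAt_injective (hx : ‖x - D.center‖ < D.radius) {s : ℝ} (hs0 : 0 < s)
    (hs : s ≤ 1) {w : Fin N → F.sheaf.Sec (D.sub x s)} (hw : F.sheaf.IsBasisOn (D.sub x s) w)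
    (hxs : x ∈ rat (D.sub x s)) :
    Function.Injective ((hw.evalAt hxs).comp (F.H0 (D.sub x s)).subtype) := by
  refine (injective_iff_map_eq_zero _).2 fun e he => Subtype.ext ?_
  set c := hw.coords e.1 with hc
  have hec : e.1 = ∑ i, c i • w i := hw.sum_coords e.1
  set G : Fin N → Fin N → O (D.sub x s) := fun i j => hw.coords (F.conn _ (w j)) i with hG
  have hGw : ∀ j, F.conn _ (w j) = ∑ i, G i j • w i := fun j => hw.sum_coords _
  have hode : ∀ i, ddT (D.sub x s) (c i) + ∑ j, G i j * c j = 0 := by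
    have h1 : F.conn _ e.1 = 0 := e.2
    have h2 := F.conn_sum hGw le_rfl c
    simp only [F.sheaf.res_id] at h2
    rw [← hec, h1, eq_comm] at h2
    have h3 := (hw.coords_sum _).symm.trans (congrArg hw.coords h2)
    rw [map_zero] at h3
    exact fun i => congrFun h3 i
  have hev : ∀ᶠ u in 𝓝[>] (0 : ℝ),
      (∀ i j, UnifRational x (u * D.radius) (ext0 (G i j).1)) ∧
        ∀ i, UnifRational x (u * D.radius) (ext0 (c i).1) :=
    (eventually_all.2 fun i => eventually_all.2 fun j => eventually_unifRational (G i j) hxs).and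
      (eventually_all.2 fun i => eventually_unifRational (c i) hxs)
  obtain ⟨u, ⟨h1, h2⟩, h3, h4⟩ := (hev.and
    ((eventually_nhdsWithin_of_eventually_nhds (eventually_lt_nhds hs0)).and
      self_mem_nhdsWithin)).exists
  have huR : 0 < u * D.radius := mul_pos h4 D.radius_pos
  refine eq_zero_of_germZero_center F.locallyFree hx hs
    (germZero_of_eventually le_rfl (w := w) (c := c) (by rw [F.sheaf.res_id]; exact hec) hxs ?_)
  filter_upwards [Metric.ball_mem_nhds x (half_pos huR)] with b hb i
  rw [Metric.mem_ball, dist_eq_norm] at hb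
  refine ode_unique huR h1 h2 (fun i b hb => ?_) (fun i => ?_) i hb
  · have hb' : b ∈ rat (D.sub x s) := mem_rat_sub hx hs
      (hb.trans_le (mul_le_mul_of_nonneg_right h3.le D.radius_pos.le))
    have h5 := congrFun (congrArg Subtype.val (hode i)) ⟨b, hb'⟩
    simp only [ext0_apply _ (⟨b, hb'⟩ : rat (D.sub x s))]
    refine Eq.trans ?_ h5
    simp only [AddMemClass.coe_add, Pi.add_apply, ddT_apply, AddSubmonoidClass.coe_finsetSum,
      Finset.sum_apply, MulMemClass.coe_mul, Pi.mul_apply]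
  · rw [ext0_apply (c i).1 ⟨x, hxs⟩]
    exact congrFun he i

theorem DiffEq.exists_injective (hx : ‖x - D.center‖ < D.radius) {s : ℝ} (hs0 : 0 < s)
    (hs : s ≤ 1) : ∃ l : F.H0 (D.sub x s) →ₗ[k] (Fin N → k), Function.Injective l := by
  obtain ⟨s₀, h0, h1, w, -, hw, -⟩ := F.exists_frame hx
  have hm0 : 0 < min s s₀ := lt_min hs0 h0
  have hm1 : min s s₀ ≤ 1 := (min_le_left _ _).trans hs
  have hw' := hw.mono (Disc.sub_mono x (min_le_right s s₀))
  refine ⟨((hw'.evalAt (mem_rat_sub_self hx hm0 hm1)).comp (F.H0 _).subtype).comp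
    (F.resH0 (Disc.sub_mono x (min_le_left s s₀))), ?_⟩
  exact (F.evalAt_injective hx hm0 hm1 hw' _).comp
    (F.resH0_injective hx hm0 (min_le_left _ _) hs)

theorem DiffEq.finite_H0 (hx : ‖x - D.center‖ < D.radius) {s : ℝ} (hs0 : 0 < s)
    (hs : s ≤ 1) : Module.Finite k (F.H0 (D.sub x s)) := by
  obtain ⟨l, hl⟩ := F.exists_injective hx hs0 hs
  exact Module.Finite.of_injective l hl

theorem DiffEq.finrank_H0_le (hx : ‖x - D.center‖ < D.radius) {s : ℝ} (hs0 : 0 < s)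
    (hs : s ≤ 1) : Module.finrank k (F.H0 (D.sub x s)) ≤ N := by
  obtain ⟨l, hl⟩ := F.exists_injective hx hs0 hs
  simpa using LinearMap.finrank_le_finrank_of_injective hl

theorem DiffEq.finrank_H0_anti (hx : ‖x - D.center‖ < D.radius) {s t : ℝ} (hs0 : 0 < s)
    (hst : s ≤ t) (ht : t ≤ 1) :
    Module.finrank k (F.H0 (D.sub x t)) ≤ Module.finrank k (F.H0 (D.sub x s)) := by
  have := F.finite_H0 hx hs0 (hst.trans ht)
  exact LinearMap.finrank_le_finrank_of_injective (F.resH0_injective hx hs0 hst ht)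

/-- On a small disc, the horizontal sections form a space of maximal dimension. -/
theorem DiffEq.exists_finrank_H0_eq (hx : ‖x - D.center‖ < D.radius) :
    ∃ s : ℝ, 0 < s ∧ s < 1 ∧ Module.finrank k (F.H0 (D.sub x s)) = N := by
  obtain ⟨s₀, h0, h1, w, G, hw, hGw, hG⟩ := F.exists_frame hx
  obtain ⟨ε, hε, hε', H⟩ := ode_exists (mul_pos h0 D.radius_pos) hG
  set s := ε / D.radius with hs
  have hR := D.radius_pos
  have hsR : s * D.radius = ε := div_mul_cancel₀ _ hR.ne'
  have hs0 : 0 < s := div_pos hε hR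
  have hss₀ : s ≤ s₀ := (div_le_iff₀ hR).2 hε'
  have hs1 : s < 1 := hss₀.trans_lt h1
  refine ⟨s, hs0, hs1, le_antisymm (F.finrank_H0_le hx hs0 hs1.le) ?_⟩
  have hsub := Disc.sub_mono (D := D) x hss₀
  have hw' := hw.mono hsub
  have hxs := mem_rat_sub_self hx hs0 hs1.le
  have hsurj : Function.Surjective ((hw'.evalAt hxs).comp (F.H0 (D.sub x s)).subtype) := by
    intro v
    obtain ⟨f, hf, hfv, hode⟩ := H v
    have hf' : ∀ i, UnifRational x (s * D.radius) (f i) := fun i => hsR.symm ▸ hf i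
    set c : Fin N → O (D.sub x s) := fun i => (hf' i).toO with hc
    refine ⟨⟨∑ i, c i • F.sheaf.res hsub (w i), ?_⟩, ?_⟩
    · change F.conn _ _ = 0
      rw [F.conn_sum hGw hsub c]
      refine Finset.sum_eq_zero fun i _ => ?_
      have : ddT (D.sub x s) (c i) + ∑ j, resO hsub (G i j) * c j = 0 := Subtype.ext <| funext fun b => by
        have h2 := hode i b.1 (hsR ▸ norm_lt_of_mem_rat_sub b.2)
        simp only [ext0_apply _ (⟨b.1, rat_mono hsub b.2⟩ : rat (D.sub x s₀))] at h2
        refine Eq.trans ?_ h2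
        simp only [AddMemClass.coe_add, Pi.add_apply, AddSubmonoidClass.coe_finsetSum,
          Finset.sum_apply, MulMemClass.coe_mul, Pi.mul_apply, hc, ddT_toO]
        rfl
      rw [this, zero_smul]
    · funext i
      change (hw'.coords (∑ i, c i • F.sheaf.res hsub (w i)) i).1 ⟨x, hxs⟩ = v i
      rw [hw'.coords_sum]
      exact hfv i
  have := F.finite_H0 hx hs0 hs1.le
  simpa using LinearMap.finrank_le_finrank_of_surjective hsurj

/-- The dimension of the space of horizontal sections is left continuous in the radius:
if it is constant on `[t, s)`, then horizontal sections over `D(x, t⁻)` extend compatibly to all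
smaller discs of radius in `[t, s)`, and glue to a section over `D(x, s⁻)`. -/
theorem DiffEq.exists_finrank_H0_left (hx : ‖x - D.center‖ < D.radius) {s : ℝ} (hs0 : 0 < s)
    (hs : s ≤ 1) : ∃ t : ℝ, 0 < t ∧ t < s ∧
      Module.finrank k (F.H0 (D.sub x t)) = Module.finrank k (F.H0 (D.sub x s)) := by
  set h : ℝ → ℕ := fun t => Module.finrank k (F.H0 (D.sub x t)) with hh
  obtain ⟨t₀, ht₀, hmin⟩ := exists_minimalFor_of_wellFoundedLT (· ∈ Set.Ioo 0 s) h
    ⟨s / 2, by constructor <;> linarith⟩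
  have ht₀1 : t₀ ≤ 1 := ht₀.2.le.trans hs
  refine ⟨t₀, ht₀.1, ht₀.2, ?_⟩
  have hbij : ∀ t (ht : t ∈ Set.Ico t₀ s), Function.Bijective
      (F.resH0 (Disc.sub_mono (D := D) x ht.1)) := by
    intro t ht
    have ht0 := ht₀.1.trans_le ht.1
    have ht1 := ht.2.le.trans hs
    have hinj := F.resH0_injective hx ht₀.1 ht.1 ht1
    have := F.finite_H0 hx ht₀.1 ht₀1
    have := F.finite_H0 hx ht0 ht1
    have hanti := F.finrank_H0_anti hx ht₀.1 ht.1 ht1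
    exact ⟨hinj, (LinearMap.injective_iff_surjective_of_finrank_eq_finrank
      (le_antisymm hanti (hmin ⟨ht0, ht.2⟩ hanti))).1 hinj⟩
  have hinj := F.resH0_injective hx ht₀.1 ht₀.2.le hs
  suffices hsurj : Function.Surjective (F.resH0 (Disc.sub_mono (D := D) x ht₀.2.le)) from
    (LinearEquiv.ofBijective _ ⟨hinj, hsurj⟩).finrank_eq.symm
  intro m
  choose e he using fun t : Set.Ico t₀ s => (hbij t.1 t.2).2 m
  have hcomp : ∀ t t' : Set.Ico t₀ s, ∀ h : t.1 ≤ t'.1,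
      F.sheaf.res (Disc.sub_mono x h) (e t').1 = (e t).1 := by
    intro t t' h
    have : F.resH0 (Disc.sub_mono x h) (e t') = e t := (hbij t.1 t.2).1 <| by
      rw [he, ← he t']
      exact Subtype.ext (F.sheaf.res_comp _ _ _)
    exact congrArg Subtype.val this
  let ι : Type u := ULift.{u} (Set.Ico t₀ s)
  let U : ι → Opens D.Pt := fun t => D.sub x t.down.1
  have hU : ∀ t, U t ≤ D.sub x s := fun t => Disc.sub_mono x t.down.2.2.le
  have hcov : D.sub x s ≤ ⨆ t, U t := by
    intro y hy
    have hy' : y.1.1 (X - C x) < s * D.radius := hy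
    have hR := D.radius_pos
    obtain ⟨t, h1, h2⟩ := exists_between (max_lt ((div_lt_iff₀ hR).2 hy') ht₀.2)
    refine Opens.mem_iSup.2 ⟨⟨t, ((le_max_right _ _).trans_lt h1).le, h2⟩, ?_⟩
    exact (div_lt_iff₀ hR).1 ((le_max_left _ _).trans_lt h1)
  have hglue := (F.sheaf.glue U _ hU hcov (fun t => (e t.down).1) fun t t' => by
    rcases le_total t.down.1 t'.down.1 with h | h
    · rw [← hcomp _ _ h, F.sheaf.res_comp]
    · rw [← hcomp _ _ h, F.sheaf.res_comp]).exists
  obtain ⟨g, hg⟩ := hglue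
  refine ⟨⟨g, ?_⟩, ?_⟩
  · change F.conn _ g = 0
    refine F.sheaf.eq_of_res U _ hU hcov fun t => ?_
    rw [F.conn_res, hg, map_zero]
    exact (e t.down).2
  · have h1 := hg ⟨t₀, le_rfl, ht₀.2⟩
    have h2 := congrArg Subtype.val (he ⟨t₀, le_rfl, ht₀.2⟩)
    refine Subtype.ext (h1.trans ?_)
    rw [← h2, F.resH0_apply, F.sheaf.res_id]

end Horizontal

/-! ### Jumps of a dimension function -/

/-- The formal properties of the dimension, as a function of the radius `s ∈ (0, 1]`, of the space
of horizontal sections of an equation of rank `N` over concentric discs. -/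
structure IsDimFun (N : ℕ) (h : ℝ → ℕ) : Prop where
  le : ∀ s, 0 < s → s ≤ 1 → h s ≤ N
  anti : ∀ s t, 0 < s → s ≤ t → t ≤ 1 → h t ≤ h s
  eq_top : ∃ s, 0 < s ∧ s < 1 ∧ h s = N
  left : ∀ s, 0 < s → s ≤ 1 → ∃ t, 0 < t ∧ t < s ∧ h t = h s

/-- The largest radius up to which the dimension function `h` is at least `m`. -/
def lastRadius (h : ℝ → ℕ) (m : ℕ) : ℝ := sSup {s : ℝ | s ∈ Set.Ioo 0 1 ∧ m ≤ h s}

namespace IsDimFun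

variable {N : ℕ} {h : ℝ → ℕ} (hh : IsDimFun N h) {m : ℕ} {R : ℝ}
include hh

theorem exists_mem (hm : m ≤ N) : ∃ s, s ∈ Set.Ioo (0 : ℝ) 1 ∧ m ≤ h s := by
  obtain ⟨s, h0, h1, e⟩ := hh.eq_top
  exact ⟨s, ⟨h0, h1⟩, e ▸ hm⟩

theorem lastRadius_pos (hm : m ≤ N) : 0 < lastRadius h m := by
  obtain ⟨s, hs⟩ := hh.exists_mem hm
  exact hs.1.1.trans_le (le_csSup ⟨1, fun t ht => ht.1.2.le⟩ hs)

theorem le_apply_lastRadius (hm : m ≤ N) (hR0 : 0 < R) (hR1 : R ≤ 1)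
    (hR : lastRadius h m = R) : m ≤ h R := by
  obtain ⟨t, ht0, htR, e⟩ := hh.left R hR0 hR1
  obtain ⟨s, hs, hts⟩ := exists_lt_of_lt_csSup (hh.exists_mem hm) (hR.symm ▸ htR)
  exact hs.2.trans ((hh.anti t s ht0 hts.le hs.1.2.le).trans e.le)

theorem lastRadius_eq_one_iff (hm : m ≤ N) : lastRadius h m = 1 ↔ m ≤ h 1 := by
  refine ⟨hh.le_apply_lastRadius hm one_pos le_rfl, fun H => ?_⟩
  have : {s : ℝ | s ∈ Set.Ioo 0 1 ∧ m ≤ h s} = Set.Ioo 0 1 :=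
    Set.ext fun s => ⟨fun hs => hs.1, fun hs => ⟨hs, H.trans (hh.anti s 1 hs.1 hs.2.le le_rfl)⟩⟩
  rw [lastRadius, this, csSup_Ioo one_pos]

theorem lastRadius_eq_iff (hm : m ≤ N) (hR : R ∈ Set.Ioo (0 : ℝ) 1) :
    lastRadius h m = R ↔ m ≤ h R ∧ ∀ s ∈ Set.Ioo R 1, h s < m := by
  refine ⟨fun H => ⟨hh.le_apply_lastRadius hm hR.1 hR.2.le H, fun s hs => ?_⟩, fun H => ?_⟩
  · by_contra! hc
    have : s ≤ lastRadius h m :=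
      le_csSup ⟨1, fun t ht => ht.1.2.le⟩ ⟨⟨hR.1.trans hs.1, hs.2⟩, hc⟩
    exact absurd hs.1 (not_lt.2 (H ▸ this))
  · refine IsGreatest.csSup_eq ⟨⟨hR, H.1⟩, fun s hs => ?_⟩
    by_contra! hc
    exact absurd hs.2 (not_le.2 (H.2 s ⟨hc, hs.1.2⟩))

/-- The right limit of a dimension function at `R` is the largest value beyond `R`. -/
theorem exists_right (hR : R ∈ Set.Ioo (0 : ℝ) 1) : ∃ L : ℕ, L ≤ h R ∧
    (∀ᶠ s in 𝓝[>] R, h s = L) ∧ ∀ m, (∀ s ∈ Set.Ioo R 1, h s < m) ↔ L < m := by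
  obtain ⟨s₁, hs₁, hmin⟩ := exists_minimalFor_of_wellFoundedLT (· ∈ Set.Ioo R 1)
    (fun s => N - h s) (Set.nonempty_Ioo.2 hR.2)
  have hmax : ∀ s ∈ Set.Ioo R 1, h s ≤ h s₁ := by
    intro s hs
    by_contra! hc
    have h1 := hmin hs (Nat.sub_le_sub_left hc.le N)
    have h2 := hh.le s (hR.1.trans hs.1) hs.2.le
    simp only at h1
    omega
  refine ⟨h s₁, hh.anti R s₁ hR.1 hs₁.1.le hs₁.2.le, ?_, fun m =>
    ⟨fun H => H s₁ hs₁, fun H s hs => (hmax s hs).trans_lt H⟩⟩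
  filter_upwards [Ioo_mem_nhdsGT hs₁.1] with s hs
  exact le_antisymm (hmax s ⟨hs.1, hs.2.trans hs₁.2⟩)
    (hh.anti s s₁ (hR.1.trans hs.1) hs.2.le hs₁.2.le)

theorem continuousAt_iff (hR : R ∈ Set.Ioo (0 : ℝ) 1) {L : ℕ} (hL : ∀ᶠ s in 𝓝[>] R, h s = L) :
    ContinuousAt h R ↔ h R = L := by
  rw [ContinuousAt, nhds_discrete ℕ, tendsto_pure]
  constructor
  · intro H
    obtain ⟨s, h1, h2⟩ := ((H.filter_mono nhdsWithin_le_nhds).and hL).exists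
    exact h1.symm.trans h2
  · intro H
    obtain ⟨t, ht0, htR, e⟩ := hh.left R hR.1 hR.2.le
    have hleft : ∀ᶠ s in 𝓝[≤] R, h s = h R := by
      filter_upwards [Ioc_mem_nhdsLE htR] with s hs
      exact le_antisymm ((hh.anti t s ht0 hs.1.le (hs.2.trans hR.2.le)).trans e.le)
        (hh.anti s R (ht0.trans hs.1) hs.2 hR.2.le)
    rw [← nhdsLE_sup_nhdsGT, eventually_sup]
    exact ⟨hleft, H ▸ hL⟩

theorem ncard_eq_one :
    {i | i ∈ Set.Icc 1 N ∧ lastRadius h (N - i + 1) = 1}.ncard = h 1 := by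
  have h1 := hh.le 1 one_pos le_rfl
  have : {i | i ∈ Set.Icc 1 N ∧ lastRadius h (N - i + 1) = 1} =
      (Finset.Icc (N - h 1 + 1) N : Finset ℕ) := by
    ext i
    simp only [Set.mem_ofPred_eq, Finset.coe_Icc, Set.mem_Icc]
    constructor
    · rintro ⟨hi, H⟩
      rw [hh.lastRadius_eq_one_iff (by omega)] at H
      omega
    · intro hi
      refine ⟨by omega, ?_⟩
      rw [hh.lastRadius_eq_one_iff (by omega)]
      omega
  rw [this, Set.ncard_coe_finset, Nat.card_Icc]
  omega

theorem lastRadius_eq_iff_lt (hR : R ∈ Set.Ioo (0 : ℝ) 1) {L : ℕ}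
    (hL : ∀ m, (∀ s ∈ Set.Ioo R 1, h s < m) ↔ L < m) {i : ℕ} (hi : i ∈ Set.Icc 1 N) :
    lastRadius h (N - i + 1) = R ↔ N - i + 1 ≤ h R ∧ L < N - i + 1 := by
  have := hi.1
  have := hi.2
  rw [hh.lastRadius_eq_iff (by omega) hR, hL]

theorem ncard_eq (hR : R ∈ Set.Ioo (0 : ℝ) 1) {L : ℕ} (hLR : L ≤ h R)
    (hL : ∀ m, (∀ s ∈ Set.Ioo R 1, h s < m) ↔ L < m) :
    {i | i ∈ Set.Icc 1 N ∧ lastRadius h (N - i + 1) = R}.ncard = h R - L := by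
  have h1 := hh.le R hR.1 hR.2.le
  have : {i | i ∈ Set.Icc 1 N ∧ lastRadius h (N - i + 1) = R} =
      (Finset.Icc (N - h R + 1) (N - L) : Finset ℕ) := by
    ext i
    simp only [Set.mem_ofPred_eq, Finset.coe_Icc]
    constructor
    · rintro ⟨hi, H⟩
      rw [hh.lastRadius_eq_iff_lt hR hL hi] at H
      rw [Set.mem_Icc] at hi ⊢
      omega
    · intro hi
      rw [Set.mem_Icc] at hi
      have hi' : i ∈ Set.Icc 1 N := ⟨by omega, by omega⟩
      refine ⟨hi', ?_⟩
      rw [hh.lastRadius_eq_iff_lt hR hL hi']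
      omega
  rw [this, Set.ncard_coe_finset, Nat.card_Icc]
  omega

theorem radii_eq_breaks :
    {R : ℝ | R < 1 ∧ ∃ i ∈ Set.Icc 1 N, lastRadius h (N - i + 1) = R} =
      {R : ℝ | R ∈ Set.Ioo (0 : ℝ) 1 ∧ ¬ ContinuousAt h R} := by
  ext R
  simp only [Set.mem_ofPred_eq]
  constructor
  · rintro ⟨hR1, i, hi, H⟩
    have hiN : N - i + 1 ≤ N := by have := hi.1; have := hi.2; omega
    have hR : R ∈ Set.Ioo (0 : ℝ) 1 := ⟨H ▸ hh.lastRadius_pos hiN, hR1⟩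
    obtain ⟨L, hLR, hev, hL⟩ := hh.exists_right hR
    rw [hh.lastRadius_eq_iff_lt hR hL hi] at H
    refine ⟨hR, ?_⟩
    rw [hh.continuousAt_iff hR hev]
    omega
  · rintro ⟨hR, H⟩
    obtain ⟨L, hLR, hev, hL⟩ := hh.exists_right hR
    rw [hh.continuousAt_iff hR hev] at H
    have h1 := hh.le R hR.1 hR.2.le
    have hi : N - L ∈ Set.Icc 1 N := ⟨by omega, by omega⟩
    refine ⟨hR.2, N - L, hi, ?_⟩
    rw [hh.lastRadius_eq_iff_lt hR hL hi]
    omega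

end IsDimFun

/-! ### Horizontal sections of a direct image -/

section Direct

variable {k : Type u} [NontriviallyNormedField k] [IsUltrametricDist k] [IsAlgClosed k]
  [CompleteSpace k] {D D₂ D₁ : Disc k} {φ : Mor D₂ D₁} {r d N : ℕ}

theorem DiffEq.isDimFun [CharZero k] (F : DiffEq.{u, v} D N) {x : k}
    (hx : ‖x - D.center‖ < D.radius) :
    IsDimFun N fun s => Module.finrank k (F.H0 (D.sub x s)) where
  le _ h0 h1 := F.finrank_H0_le hx h0 h1
  anti _ _ h0 h1 h2 := F.finrank_H0_anti hx h0 h1 h2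
  eq_top := F.exists_finrank_H0_eq hx
  left _ h0 h1 := F.exists_finrank_H0_left hx h0 h1

/-- The horizontal sections of the direct image over `U` are the horizontal sections over the
preimage of `U`, as the two connections differ by an invertible function. -/
def DiffEq.pushH0Equiv (E : DiffEq.{u, v} D₂ r) (hφ : φ.IsFiniteEtale d) (U : Opens D₁.Pt) :
    (E.push hφ).H0 U ≃ₗ[k] E.H0 (φ.pre U) where
  toFun e := ⟨e.1, by
    have h : hφ.invJac U • E.conn (φ.pre U) e.1 = 0 := e.2
    change E.conn (φ.pre U) e.1 = 0
    have h1 := congrArg (φ.jac U • ·) h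
    simp only [smul_smul, smul_zero] at h1
    rwa [mul_comm, hφ.jac_mul_invJac, one_smul] at h1⟩
  invFun e := ⟨e.1, by
    have h : E.conn (φ.pre U) e.1 = 0 := e.2
    change hφ.invJac U • E.conn (φ.pre U) e.1 = 0
    rw [h, smul_zero]⟩
  map_add' _ _ := rfl
  map_smul' _ _ := rfl
  left_inv _ := rfl
  right_inv _ := rfl

end Direct

end

end Berk

theorem mainTheorem4 {k : Type u} [NontriviallyNormedField k] [IsUltrametricDist k]
    [CompleteSpace k] [IsAlgClosed k] [CharZero k] {D₂ D₁ : Disc k} {r d : ℕ}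
    (φ : Mor D₂ D₁) (hφ : φ.IsFiniteEtale d) (E : DiffEq.{u, v} D₂ r)
    (x : k) (hx : x ∈ rat (⊤ : Opens D₁.Pt)) :
    (∀ s ∈ Set.Ioc (0 : ℝ) 1, Module.Finite k (E.H0 (φ.pre (D₁.sub x s)))) ∧
    {i | i ∈ Set.Icc 1 (r * d) ∧ (E.push hφ).radius x i = 1}.ncard = Phi φ E x 1 ∧
    (∀ R ∈ Set.Ioo (0 : ℝ) 1, ∃ L : ℕ, Tendsto (Phi φ E x) (𝓝[>] R) (𝓝 L) ∧
      ({i | i ∈ Set.Icc 1 (r * d) ∧ (E.push hφ).radius x i = R}.ncard : ℤ) =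
        (Phi φ E x R : ℤ) - (L : ℤ)) ∧
    {R : ℝ | R < 1 ∧ ∃ i ∈ Set.Icc 1 (r * d), (E.push hφ).radius x i = R} =
      {R : ℝ | R ∈ Set.Ioo (0 : ℝ) 1 ∧ ¬ ContinuousAt (Phi φ E x) R} := by
  have hx' := rat_norm hx
  have hPhi : (fun s => Module.finrank k ((E.push hφ).H0 (D₁.sub x s))) = Phi φ E x :=
    funext fun s => (E.pushH0Equiv hφ (D₁.sub x s)).finrank_eq
  have hrad : ∀ i, (E.push hφ).radius x i = lastRadius (Phi φ E x) (r * d - i + 1) :=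
    fun i => by rw [← hPhi]; rfl
  have hh : IsDimFun (r * d) (Phi φ E x) := hPhi ▸ (E.push hφ).isDimFun hx'
  simp only [hrad]
  refine ⟨fun s hs => ?_, hh.ncard_eq_one, fun R hR => ?_, hh.radii_eq_breaks⟩
  · have := (E.push hφ).finite_H0 hx' hs.1 hs.2
    exact Module.Finite.equiv (E.pushH0Equiv hφ (D₁.sub x s))
  · obtain ⟨L, hLR, hev, hL⟩ := hh.exists_right hR
    refine ⟨L, tendsto_const_nhds.congr' (hev.mono fun _ h => h.symm), ?_⟩
    rw [hh.ncard_eq hR hLR hL, Nat.cast_sub hLR]
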